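/- Let $S^1=\mathbb{R}/\mathbb{Z}$. A vortex is a pair $(u,\eta)\in C^\infty(\mathbb{R}\times S^1,\mathbb{C})\times C^\infty(\mathbb{R},\mathbb{R})$ that solves $$\partial_s u+i\,\partial_t u-2\pi\eta u=0,\qquad \partial_s\eta-\pi\int_0^1|u(s,t)|^2\,dt+\pi=0$$ and has finite energy $\int_{\mathbb{R}\times S^1}|\partial_s u|^2\,ds\,dt+\int_{\mathbb{R}}|\partial_s\eta|^2\,ds<\infty$. These are the negative $L^2$-gradient flow lines of the Rabinowitz action functional $\mathcal{A}^\mu(v,\eta)=-\int v^*(x\,dy)-\eta\int_0^1\pi(|v|^2-1)\,dt$ on $C^\infty(S^1,\mathbb{C})\times\mathbb{R}$. Its $L^2$-Hessian at a critical point $(v,\eta)$ is $$(\hat v,\hat\eta)\mapsto\Big(i\,\partial_t\hat v-2\pi\eta\hat v-2\pi v\hat\eta,\ -2\pi\int_0^1\langle v,\hat v\rangle\,dt\Big),$$ where $\langle\cdot,\cdot\rangle$ is the real inner product of $\mathbb{C}=\mathbb{R}^2$; its spectrum is the same at all critical points. Let $\delta>0$ be smaller than the minimum of the absolute values of the nonzero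 eigenvalues of this Hessian. Let $\beta\in C^\infty(\mathbb{R},[-1,1])$ be such that for some $T>0$ one has $\beta(s)=-1$ for $s<-T$ and $\beta(s)=1$ for $s>T$. For $\kappa\in\mathbb{R}$ put $\gamma_\kappa(s)=e^{\kappa\beta(s)s}$, and, for functions on $\mathbb{R}\times S^1$ or on $\mathbb{R}$, put $$L^2_\kappa=\{f\in L^2_{loc}: f\gamma_\kappa\in L^2\},\qquad W^{1,2}_\kappa=\{f\in W^{1,2}_{loc}: f\gamma_\kappa\in W^{1,2}\}.$$ Then, for every vortex $(u,\eta)$, the formula $$D(\hat u,\hat\eta)=\Big(\partial_s\hat u+i\,\partial_t\hat u-2\pi\eta\hat u-2\pi u\hat\eta,\ \ \partial_s\hat\eta-2\pi\int_0^1\langle u,\hat u\rangle\,dt\Big)$$ (with weak derivatives) defines an operator $$D\colon W^{1,2}_{-\delta}(\mathbb{R}\times S^1,\mathbb{C})\times W^{1,2}_{-\delta}(\mathbb{R},\mathbb{R})\to L^2_{-\delta}(\mathbb{R}\times S^1,\mathbb{C})\times L^2_{-\delta}(\mathbb{R},\mathbb{R}),$$ and $D$ is surjective. -/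

import Mathlib

open MeasureTheory
open scoped ContDiff ENNReal

noncomputable section

namespace Vortex

/-- The circle `S¹ = ℝ/ℤ`, with its measure of total mass one. -/
abbrev Circ : Type := UnitAddCircle

/-- The cylinder `ℝ × S¹`; points are written `(s, t)`. -/
abbrev Cyl : Type := ℝ × Circ

/-! ### Smooth functions and their derivatives on the circle and on the cylinder -/

/-- Smoothness on the circle, read off on the universal cover `ℝ → S¹`. -/
def SmoothCirc (v : Circ → ℂ) : Prop :=
  ContDiff ℝ ∞ (fun t : ℝ => v (t : Circ))

/-- The derivative `∂ₜ v` of a function on the circle. -/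
def derivCirc (v : Circ → ℂ) (t : Circ) : ℂ :=
  deriv (fun τ : ℝ => v (t + (τ : Circ))) 0

/-- Smoothness on the cylinder, read off on the universal cover `ℝ × ℝ → ℝ × S¹`. -/
def SmoothCyl {E : Type*} [NormedAddCommGroup E] [NormedSpace ℝ E] (f : Cyl → E) : Prop :=
  ContDiff ℝ ∞ (fun p : ℝ × ℝ => f (p.1, (p.2 : Circ)))

/-- The classical partial derivative `∂ₛ f`. -/
def dS {E : Type*} [NormedAddCommGroup E] [NormedSpace ℝ E] (f : Cyl → E) (p : Cyl) : E :=
  deriv (fun σ : ℝ => f (σ, p.2)) p.1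

/-- The classical partial derivative `∂ₜ f`. -/
def dT {E : Type*} [NormedAddCommGroup E] [NormedSpace ℝ E] (f : Cyl → E) (p : Cyl) : E :=
  deriv (fun τ : ℝ => f (p.1, p.2 + (τ : Circ))) 0

/-! ### Vortices -/

/-- The energy `∫ |∂ₛ u|² ds dt + ∫ |∂ₛ η|² ds`, with values in `[0, ∞]`. -/
def energy (u : Cyl → ℂ) (η : ℝ → ℝ) : ℝ≥0∞ :=
  (∫⁻ p : Cyl, ‖dS u p‖ₑ ^ 2) + ∫⁻ s : ℝ, ‖deriv η s‖ₑ ^ 2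

/-- A vortex: a smooth solution `(u, η)` of the vortex equations of finite energy. -/
structure IsVortex (u : Cyl → ℂ) (η : ℝ → ℝ) : Prop where
  smooth_u : SmoothCyl u
  smooth_η : ContDiff ℝ ∞ η
  eq_u : ∀ p : Cyl,
    dS u p + Complex.I * dT u p - 2 * (Real.pi : ℂ) * (η p.1 : ℂ) * u p = 0
  eq_η : ∀ s : ℝ,
    deriv η s - Real.pi * (∫ t : Circ, ‖u (s, t)‖ ^ 2) + Real.pi = 0
  finite_energy : energy u η < ⊤

/-! ### The Hessian of the Rabinowitz action functional

The vortex equations are the negative `L²`-gradient flow equations of the functional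
`A(v, η) = - ∫ v^* (x dy) - η ∫ π (|v|² - 1) dt` on `C^∞(S¹, ℂ) × ℝ`. -/

/-- The loop component `i ∂ₜ v - 2 π η v` of the `L²`-gradient of `A` at `(v, η)`. -/
def gradLoop (v : Circ → ℂ) (η : ℝ) (t : Circ) : ℂ :=
  Complex.I * derivCirc v t - 2 * (Real.pi : ℂ) * (η : ℂ) * v t

/-- The real component `- π ∫ |v|² dt + π` of the `L²`-gradient of `A` at `(v, η)`. -/
def gradReal (v : Circ → ℂ) : ℝ :=
  - Real.pi * (∫ t : Circ, ‖v t‖ ^ 2) + Real.pi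

/-- The critical points of `A`. -/
def IsCritical (v : Circ → ℂ) (η : ℝ) : Prop :=
  SmoothCirc v ∧ (∀ t, gradLoop v η t = 0) ∧ gradReal v = 0

/-- The loop component of the Hessian of `A` at `(v, η)`, applied to `(w, ξ)`. It is the
linearization of the gradient. -/
def hessLoop (v : Circ → ℂ) (η : ℝ) (w : Circ → ℂ) (ξ : ℝ) (t : Circ) : ℂ :=
  Complex.I * derivCirc w t - 2 * (Real.pi : ℂ) * (η : ℂ) * w t
    - 2 * (Real.pi : ℂ) * v t * (ξ : ℂ)

/-- The real component of the Hessian of `A` at `(v, η)`, applied to `(w, ξ)`. -/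
def hessReal (v w : Circ → ℂ) : ℝ :=
  - 2 * Real.pi * ∫ t : Circ, inner ℝ (v t) (w t)

/-- `c` is an eigenvalue of the (real linear, `L²`-symmetric) Hessian of `A` at `(v, η)`. -/
def IsHessianEigenvalue (v : Circ → ℂ) (η : ℝ) (c : ℝ) : Prop :=
  ∃ (w : Circ → ℂ) (ξ : ℝ), SmoothCirc w ∧ ¬ (w = 0 ∧ ξ = 0) ∧
    (∀ t, hessLoop v η w ξ t = (c : ℂ) * w t) ∧ hessReal v w = c * ξ

/-- The spectral gap at zero: the least absolute value of a nonzero eigenvalue of the Hessian at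
a critical point. (All critical points form one orbit of an isometric symmetry group of the
gradient of `A`, so that the spectrum is the same at each of them.) -/
def spectralGap : ℝ :=
  sInf {a : ℝ | ∃ (v : Circ → ℂ) (η c : ℝ),
    IsCritical v η ∧ IsHessianEigenvalue v η c ∧ c ≠ 0 ∧ a = |c|}

/-! ### Weak derivatives -/

/-- `g` is a weak derivative `∂ₛ f` on the cylinder. -/
def IsWeakDS (f g : Cyl → ℂ) : Prop :=
  LocallyIntegrable f ∧ LocallyIntegrable g ∧
    ∀ φ : Cyl → ℝ, SmoothCyl φ → HasCompactSupport φ →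
      ∫ p : Cyl, dS φ p • f p = - ∫ p : Cyl, φ p • g p

/-- `g` is a weak derivative `∂ₜ f` on the cylinder. -/
def IsWeakDT (f g : Cyl → ℂ) : Prop :=
  LocallyIntegrable f ∧ LocallyIntegrable g ∧
    ∀ φ : Cyl → ℝ, SmoothCyl φ → HasCompactSupport φ →
      ∫ p : Cyl, dT φ p • f p = - ∫ p : Cyl, φ p • g p

/-- `g` is a weak derivative of `f` on the line. -/
def IsWeakDLine (f g : ℝ → ℝ) : Prop :=
  LocallyIntegrable f ∧ LocallyIntegrable g ∧
    ∀ φ : ℝ → ℝ, ContDiff ℝ ∞ φ → HasCompactSupport φ →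
      ∫ s : ℝ, deriv φ s * f s = - ∫ s : ℝ, φ s * g s

open Classical in
/-- The weak derivative `∂ₛ f` (unique up to a null set; zero if there is none). -/
def weakDS (f : Cyl → ℂ) : Cyl → ℂ :=
  if h : ∃ g, IsWeakDS f g then h.choose else 0

open Classical in
/-- The weak derivative `∂ₜ f` (unique up to a null set; zero if there is none). -/
def weakDT (f : Cyl → ℂ) : Cyl → ℂ :=
  if h : ∃ g, IsWeakDT f g then h.choose else 0

open Classical in
/-- The weak derivative on the line (unique up to a null set; zero if there is none). -/
def weakDLine (f : ℝ → ℝ) : ℝ → ℝ :=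
  if h : ∃ g, IsWeakDLine f g then h.choose else 0

/-! ### Sobolev spaces -/

/-- `L²_loc`. -/
def MemL2Loc {X E : Type*} [TopologicalSpace X] [MeasureSpace X] [NormedAddCommGroup E]
    (f : X → E) : Prop :=
  ∀ K : Set X, IsCompact K → MemLp f 2 ((volume : Measure X).restrict K)

/-- `W^{1,2}_loc(ℝ × S¹, ℂ)`. -/
def MemW12LocCyl (f : Cyl → ℂ) : Prop :=
  MemL2Loc f ∧ (∃ g, IsWeakDS f g ∧ MemL2Loc g) ∧ ∃ g, IsWeakDT f g ∧ MemL2Loc g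

/-- `W^{1,2}(ℝ × S¹, ℂ)`. -/
def MemW12Cyl (f : Cyl → ℂ) : Prop :=
  MemLp f 2 ∧ (∃ g, IsWeakDS f g ∧ MemLp g 2) ∧ ∃ g, IsWeakDT f g ∧ MemLp g 2

/-- `W^{1,2}_loc(ℝ, ℝ)`. -/
def MemW12LocLine (f : ℝ → ℝ) : Prop :=
  MemL2Loc f ∧ ∃ g, IsWeakDLine f g ∧ MemL2Loc g

/-- `W^{1,2}(ℝ, ℝ)`. -/
def MemW12Line (f : ℝ → ℝ) : Prop :=
  MemLp f 2 ∧ ∃ g, IsWeakDLine f g ∧ MemLp g 2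

/-- A smooth function `β : ℝ → [-1, 1]` with `β = -1` near `-∞` and `β = 1` near `∞`. -/
structure IsCutoff (β : ℝ → ℝ) : Prop where
  smooth : ContDiff ℝ ∞ β
  mem_Icc : ∀ s, β s ∈ Set.Icc (-1 : ℝ) 1
  eventually_const : ∃ T > 0, (∀ s, s < -T → β s = -1) ∧ ∀ s, T < s → β s = 1

/-- The weight `γ_δ(s) = exp(δ β(s) s)`, equal to `exp(δ |s|)` for large `|s|`. -/
def weight (β : ℝ → ℝ) (δ : ℝ) (s : ℝ) : ℝ :=
  Real.exp (δ * β s * s)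

/-- `L²_δ(ℝ × S¹, ℂ)`. -/
def MemL2WeightedCyl (β : ℝ → ℝ) (δ : ℝ) (f : Cyl → ℂ) : Prop :=
  MemLp (fun p : Cyl => weight β δ p.1 • f p) 2

/-- `L²_δ(ℝ, ℝ)`. -/
def MemL2WeightedLine (β : ℝ → ℝ) (δ : ℝ) (f : ℝ → ℝ) : Prop :=
  MemLp (fun s : ℝ => weight β δ s * f s) 2

/-- `W^{1,2}_δ(ℝ × S¹, ℂ)`. -/
def MemW12WeightedCyl (β : ℝ → ℝ) (δ : ℝ) (f : Cyl → ℂ) : Prop :=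
  MemW12LocCyl f ∧ MemW12Cyl (fun p : Cyl => weight β δ p.1 • f p)

/-- `W^{1,2}_δ(ℝ, ℝ)`. -/
def MemW12WeightedLine (β : ℝ → ℝ) (δ : ℝ) (f : ℝ → ℝ) : Prop :=
  MemW12LocLine f ∧ MemW12Line (fun s : ℝ => weight β δ s * f s)

/-! ### The linearized operator -/

/-- First component of `D(û, η̂)`: `∂ₛ û + i ∂ₜ û - 2 π η û - 2 π u η̂`. -/
def linCyl (u : Cyl → ℂ) (η : ℝ → ℝ) (uh : Cyl → ℂ) (ηh : ℝ → ℝ) (p : Cyl) : ℂ :=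
  weakDS uh p + Complex.I * weakDT uh p - 2 * (Real.pi : ℂ) * (η p.1 : ℂ) * uh p
    - 2 * (Real.pi : ℂ) * u p * (ηh p.1 : ℂ)

/-- Second component of `D(û, η̂)`: `∂ₛ η̂ - 2 π ∫ ⟨u, û⟩ dt`, with the real inner product of
`ℂ = ℝ²`. -/
def linLine (u : Cyl → ℂ) (uh : Cyl → ℂ) (ηh : ℝ → ℝ) (s : ℝ) : ℝ :=
  weakDLine ηh s - 2 * Real.pi * ∫ t : Circ, inner ℝ (u (s, t)) (uh (s, t))

end Vortex

end

/-! Surjectivity reduces to a Cauchy-Riemann equation and one scalar second-order equation. Given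
`(f, g)`, suppose `v` solves `∂ₛ v + i ∂ₜ v - 2πη v = f`, and try `û = v + u H` with `H` a real
function of `s`. Since `u` is annihilated by `∂ₛ + i ∂ₜ - 2πη`, the term `u H` contributes exactly
`u H'`, and the first component of `D` becomes `f` for `η̂ = H' / (2π)`. The second component then
reads `H'' = 4π² N H + 2π g + 4π² ∫ ⟨u, v⟩ dt`, where `N = ∫ |u|² dt`.

The equation for `v` splits into Fourier modes `y' = 2π(k + η) y + f_k`. Finite energy forces `N →
1` at both ends, `η → -n` at `+∞` and `η → -m` at `-∞` with integers `m ≤ n`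
(`ModeData.exists_limits`). Hence mode `k` is expanding at both ends if `k > n`, contracting at both
ends if `k < m`, and for `m ≤ k ≤ n` its homogeneous solution grows more slowly than `exp(δ|s|)` in
both directions, which the decaying weight absorbs. In each case variation of constants from a
suitable base point (`+∞`, `-∞`, `0`) has a kernel with exponential off-diagonal decay, bounded on
weighted `L²` by the Schur test (`exists_solution_of_kernel`, `exists_modeSolvable`). The bounds
gain a factor `1 + |k|`, so the modes sum to a function with `∂ₜ v` in the weighted space
(`exists_cyl_solution`).

For the equation of `H`, the potential `q = 4π² N` is positive and tends to `4π²`. A positive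
solution of `ψ' = ψ² - q` factors `∂² - q = (∂ - ψ)(∂ + ψ)`, and the two factors are an expanding
and a contracting first-order equation whose rate eventually exceeds `δ`
(`exists_second_order_solution`). The spectral hypothesis enters only through `δ < 2π`
(`spectralGap_le`). -/

namespace Vortex

open Filter Topology Set

/-! ### Schur test for exponentially decaying kernels -/

lemma eLpNorm_two_sq {α E : Type*} [MeasurableSpace α] [NormedAddCommGroup E] {μ : Measure α}
    (f : α → E) : eLpNorm f 2 μ ^ 2 = ∫⁻ x, ‖f x‖ₑ ^ 2 ∂μ := by
  have h := eLpNorm_nnreal_pow_eq_lintegral (f := f) (μ := μ) (p := 2) (by norm_num)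
  simpa using h

lemma integral_exp_neg_mul_abs {c : ℝ} (hc : 0 < c) :
    ∫ x : ℝ, Real.exp (-c * |x|) = 2 / c := by
  rw [integral_comp_abs (f := fun x => Real.exp (-c * x)),
    integral_exp_mul_Ioi (by linarith) 0]
  field_simp
  simp

lemma integrable_exp_neg_mul_abs {c : ℝ} (hc : 0 < c) :
    Integrable fun x : ℝ => Real.exp (-c * |x|) := by
  by_contra h
  have h1 := integral_exp_neg_mul_abs hc
  rw [integral_undef h] at h1
  have : 0 < 2 / c := by positivity
  linarith

lemma lintegral_exp_kernel {C c : ℝ} (hc : 0 < c) (hC : 0 ≤ C) (s : ℝ) :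
    ∫⁻ r : ℝ, ENNReal.ofReal (C * Real.exp (-c * |s - r|)) = ENNReal.ofReal (2 * C / c) := by
  have h := lintegral_sub_left_eq_self (μ := (volume : Measure ℝ))
    (fun x => ENNReal.ofReal (C * Real.exp (-c * |x|))) s
  rw [h, ← ofReal_integral_eq_lintegral_ofReal, integral_const_mul, integral_exp_neg_mul_abs hc]
  · congr 1; ring
  · exact (integrable_exp_neg_mul_abs hc).const_mul C
  · exact Eventually.of_forall fun x => by positivity

/-- The Schur test for kernels with exponential off-diagonal decay. -/
lemma lintegral_exp_kernel_sq_le {C c : ℝ} (hc : 0 < c) (hC : 0 ≤ C) {φ : ℝ → ℝ≥0∞}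
    (hφ : AEMeasurable φ) :
    ∫⁻ s : ℝ, (∫⁻ r : ℝ, ENNReal.ofReal (C * Real.exp (-c * |s - r|)) * φ r) ^ 2
      ≤ ENNReal.ofReal (2 * C / c) ^ 2 * ∫⁻ r : ℝ, φ r ^ 2 := by
  set k : ℝ → ℝ → ℝ≥0∞ := fun s r => ENNReal.ofReal (C * Real.exp (-c * |s - r|)) with hk
  have hkm : Measurable (Function.uncurry k) := by
    simp only [hk, Function.uncurry_def]; fun_prop
  have hkm' : ∀ s, Measurable (k s) := fun s => hkm.comp measurable_prodMk_left
  set A := ENNReal.ofReal (2 * C / c)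
  -- Cauchy-Schwarz after splitting `k φ = k^(1/2) · (k φ²)^(1/2)`; the factor `∫ k(s, r) dr` is the
  -- constant `A`.
  have h1 : ∀ s, (∫⁻ r, k s r * φ r) ^ 2 ≤ A * ∫⁻ r, k s r * φ r ^ 2 := by
    intro s
    have := ENNReal.lintegral_mul_norm_pow_le (μ := (volume : Measure ℝ)) (f := k s)
      (g := fun r => k s r * φ r ^ 2) (hkm' s).aemeasurable
      ((hkm' s).aemeasurable.mul (hφ.pow_const 2)) (p := 1 / 2) (q := 1 / 2)
      (by norm_num) (by norm_num) (by norm_num)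
    have e : ∀ r, k s r ^ (1 / 2 : ℝ) * (k s r * φ r ^ 2) ^ (1 / 2 : ℝ) = k s r * φ r := by
      intro r
      rw [ENNReal.mul_rpow_of_nonneg _ _ (by norm_num : (0:ℝ) ≤ 1 / 2), ← mul_assoc,
        ← ENNReal.rpow_add_of_nonneg _ _ (by norm_num) (by norm_num),
        ← ENNReal.rpow_natCast, ← ENNReal.rpow_mul]
      norm_num
    simp_rw [e] at this
    calc (∫⁻ r, k s r * φ r) ^ 2
        ≤ ((∫⁻ r, k s r) ^ (1 / 2 : ℝ) * (∫⁻ r, k s r * φ r ^ 2) ^ (1 / 2 : ℝ)) ^ 2 := by gcongr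
      _ = (∫⁻ r, k s r) * ∫⁻ r, k s r * φ r ^ 2 := by
          rw [mul_pow, ← ENNReal.rpow_natCast, ← ENNReal.rpow_natCast, ← ENNReal.rpow_mul,
            ← ENNReal.rpow_mul]
          norm_num
      _ = _ := by rw [lintegral_exp_kernel hc hC]
  calc ∫⁻ s : ℝ, (∫⁻ r : ℝ, k s r * φ r) ^ 2
      ≤ ∫⁻ s : ℝ, A * ∫⁻ r, k s r * φ r ^ 2 := lintegral_mono h1
    _ = A * ∫⁻ s : ℝ, ∫⁻ r, k s r * φ r ^ 2 := lintegral_const_mul' _ _ ENNReal.ofReal_ne_top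
    _ = A * ∫⁻ r : ℝ, ∫⁻ s, k s r * φ r ^ 2 := by
        rw [lintegral_lintegral_swap]
        exact hkm.aemeasurable.mul (hφ.comp_snd.pow_const 2)
    _ = A * ∫⁻ r : ℝ, A * φ r ^ 2 := by
        congr 1
        refine lintegral_congr fun r => ?_
        have hm : Measurable fun s => k s r := hkm.comp measurable_prodMk_right
        rw [lintegral_mul_const _ hm]
        congr 1
        refine Eq.trans (lintegral_congr fun s => ?_) (lintegral_exp_kernel hc hC r)
        rw [hk, abs_sub_comm]
    _ = A ^ 2 * ∫⁻ r : ℝ, φ r ^ 2 := by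
        rw [lintegral_const_mul' _ _ ENNReal.ofReal_ne_top, sq, mul_assoc]

variable {E : Type*} [NormedAddCommGroup E] [NormedSpace ℝ E]

section Kernel

variable {K : ℝ → ℝ → ℝ} {C c : ℝ} {F : ℝ → E}

lemma integrable_kernel (hc : 0 < c) (hKm : Measurable (Function.uncurry K))
    (hK : ∀ s r, |K s r| ≤ C * Real.exp (-c * |s - r|)) (hF : MemLp F 2) (s : ℝ) :
    Integrable fun r => K s r • F r := by
  have hm : Measurable (K s) := hKm.comp measurable_prodMk_left
  have h2 : MemLp (K s) 2 := by
    have h3 : MemLp (fun r => C * Real.exp (-c * |s - r|)) 2 := by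
      rw [memLp_two_iff_integrable_sq (by fun_prop)]
      have h4 := ((integrable_exp_neg_mul_abs (c := 2 * c) (by linarith)).comp_sub_left s).const_mul
        (C ^ 2)
      refine h4.congr (Eventually.of_forall fun r => ?_)
      simp only [mul_pow, ← Real.exp_nat_mul]
      congr 2; push_cast; ring
    exact h3.mono hm.aestronglyMeasurable (Eventually.of_forall fun r => by
      rw [Real.norm_eq_abs]; exact (hK s r).trans (le_abs_self _))
  exact memLp_one_iff_integrable.1 (hF.smul h2)

lemma aestronglyMeasurable_kernel (hKm : Measurable (Function.uncurry K)) (hF : MemLp F 2) :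
    AEStronglyMeasurable fun s => ∫ r, K s r • F r := by
  have h : AEStronglyMeasurable (fun p : ℝ × ℝ => K p.1 p.2 • F p.2)
      ((volume : Measure ℝ).prod volume) :=
    hKm.aestronglyMeasurable.smul hF.1.comp_snd
  exact h.integral_prod_right'

lemma eLpNorm_kernel_le (hc : 0 < c) (hC : 0 ≤ C)
    (hK : ∀ s r, |K s r| ≤ C * Real.exp (-c * |s - r|)) (hF : MemLp F 2) :
    eLpNorm (fun s => ∫ r, K s r • F r) 2 volume
      ≤ ENNReal.ofReal (2 * C / c) * eLpNorm F 2 volume := by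
  rw [← ENNReal.pow_le_pow_left_iff two_ne_zero, mul_pow, eLpNorm_two_sq, eLpNorm_two_sq]
  refine le_trans (lintegral_mono fun s => ?_) (lintegral_exp_kernel_sq_le hc hC hF.1.enorm)
  gcongr
  refine (enorm_integral_le_lintegral_enorm _).trans (lintegral_mono fun r => ?_)
  rw [enorm_smul]
  gcongr
  rw [Real.enorm_eq_ofReal_abs]
  exact ENNReal.ofReal_le_ofReal (hK s r)

end Kernel

end Vortex

/-! ### Weak derivatives on the line and variation of constants -/

namespace Vortex

open Filter Topology Set

variable {E : Type*} [NormedAddCommGroup E] [NormedSpace ℝ E]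

/-- `g` is a weak derivative of `f : ℝ → E`, tested against `C¹` functions. -/
structure WeakDeriv (f g : ℝ → E) : Prop where
  left : LocallyIntegrable f
  right : LocallyIntegrable g
  eq : ∀ φ : ℝ → ℝ, ContDiff ℝ 1 φ → HasCompactSupport φ →
    ∫ s, deriv φ s • f s = - ∫ s, φ s • g s

lemma integrable_smul_of_hasCompactSupport {X : Type*} [TopologicalSpace X] [MeasurableSpace X]
    [BorelSpace X] [T2Space X] [SecondCountableTopology X]
    {μ : Measure X} {φ : X → ℝ} {f : X → E}
    (hφ : Continuous φ) (hc : HasCompactSupport φ) (hf : LocallyIntegrable f μ) :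
    Integrable (fun x => φ x • f x) μ :=
  hf.integrable_smul_left_of_hasCompactSupport hφ hc

lemma integral_deriv_eq_zero {Φ : ℝ → ℝ} (hΦ : ContDiff ℝ 1 Φ) (hc : HasCompactSupport Φ) :
    ∫ s, deriv Φ s = 0 :=
  integral_eq_zero_of_hasDerivAt_of_integrable
    (fun x => (hΦ.differentiable one_ne_zero x).hasDerivAt)
    ((hΦ.continuous_deriv le_rfl).integrable_of_hasCompactSupport hc.deriv)
    (hΦ.continuous.integrable_of_hasCompactSupport hc)

/-- This is Fubini: the primitive is a constant plus an integral over `r < s`, and after the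
exchange the inner integral of `Φ'` over `(r, ∞)` is `-Φ(r)`. Only local integrability of `h` is
needed, since `Φ` confines everything to a bounded interval. -/
lemma integral_deriv_smul_primitive [CompleteSpace E] {h : ℝ → E} (hh : LocallyIntegrable h)
    (c₀ : E) {Φ : ℝ → ℝ} (hΦ : ContDiff ℝ 1 Φ) (hc : HasCompactSupport Φ) :
    ∫ s, deriv Φ s • (c₀ + ∫ r in (0 : ℝ)..s, h r) = - ∫ s, Φ s • h s := by
  obtain ⟨L, hL⟩ := hc.isCompact.isBounded.subset_closedBall 0
  rw [Real.closedBall_eq_Icc] at hL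
  simp only [zero_sub, zero_add] at hL
  have hΦ0 : ∀ s, s ∉ Icc (-L) L → Φ s = 0 := fun s hs =>
    image_eq_zero_of_notMem_tsupport fun h => hs (hL h)
  have hΦ'0 : ∀ s, s ∉ Icc (-L) L → deriv Φ s = 0 := fun s hs =>
    Function.notMem_support.1 fun h => hs (hL (support_deriv_subset h))
  have hii : ∀ a b, IntervalIntegrable h volume a b := fun a b => by
    rw [intervalIntegrable_iff]
    exact (hh.integrableOn_isCompact isCompact_uIcc).mono_set uIoc_subset_uIcc
  set k : ℝ → E := (Ioc (-L) L).indicator h with hk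
  have hki : Integrable k := by
    rw [hk, integrable_indicator_iff measurableSet_Ioc]
    exact (hh.integrableOn_isCompact isCompact_Icc).mono_set Ioc_subset_Icc_self
  have hΦ'i : Integrable (deriv Φ) :=
    (hΦ.continuous_deriv le_rfl).integrable_of_hasCompactSupport hc.deriv
  set c₁ : E := c₀ - ∫ r in (-L)..0, h r with hc₁
  have e1 : ∀ s, deriv Φ s • (c₀ + ∫ r in (0 : ℝ)..s, h r)
      = deriv Φ s • c₁ + ∫ r, (Ioi r).indicator (deriv Φ) s • k r := by
    intro s
    by_cases hs : s ∈ Icc (-L) L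
    · have : (∫ r, (Ioi r).indicator (deriv Φ) s • k r) = deriv Φ s • ∫ r in (-L)..s, h r := by
        rw [intervalIntegral.integral_of_le hs.1, ← integral_smul, integral_Ioc_eq_integral_Ioo,
          ← integral_indicator measurableSet_Ioo]
        congr 1
        ext r
        by_cases h1 : r < s
        · by_cases h2 : -L < r
          · simp [h1, h2, hk, indicator, h1.le.trans hs.2]
          · simp [h2, hk, indicator]
        · simp [h1, indicator]
      rw [this, ← smul_add, hc₁, ← intervalIntegral.integral_add_adjacent_intervals (hii (-L) 0)
        (hii 0 s)]
      congr 1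
      abel
    · have : ∀ r, (Ioi r).indicator (deriv Φ) s • k r = 0 := by
        intro r
        by_cases h1 : r < s <;> simp [indicator, h1, hΦ'0 s hs]
      simp [this, hΦ'0 s hs]
  have hG : Integrable (fun p : ℝ × ℝ => (Ioi p.2).indicator (deriv Φ) p.1 • k p.2)
      (volume.prod volume) := by
    have h1 : Integrable (fun p : ℝ × ℝ => deriv Φ p.1 • k p.2) (volume.prod volume) :=
      hΦ'i.smul_prod hki
    have h2 : MeasurableSet {p : ℝ × ℝ | p.2 < p.1} := measurableSet_lt measurable_snd measurable_fst
    refine (h1.indicator h2).congr (Eventually.of_forall fun p => ?_)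
    by_cases h3 : p.2 < p.1 <;> simp [indicator, h3]
  simp_rw [e1]
  rw [integral_add (hΦ'i.smul_const c₁) hG.integral_prod_left, integral_smul_const,
    integral_deriv_eq_zero hΦ hc, zero_smul, zero_add, integral_integral_swap hG, ← integral_neg]
  congr 1
  ext r
  change ∫ s, (Ioi r).indicator (deriv Φ) s • k r = _
  rw [integral_smul_const, integral_indicator measurableSet_Ioi, hc.integral_Ioi_deriv_eq hΦ]
  by_cases hr : r ∈ Ioc (-L) L
  · simp [hk, hr]
  · rw [hk, indicator_of_notMem hr]
    -- The endpoint `-L` is missing from the half-open interval; there `Φ` vanishes by continuity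
    -- from the left.
    have : Φ r = 0 := by
      by_cases h2 : r = -L
      · have h3 : r ∈ closure (Iio (-L)) := by rw [closure_Iio, h2]; exact le_refl (-L)
        have h4 : IsClosed {x | Φ x = 0} := isClosed_eq hΦ.continuous continuous_const
        exact closure_minimal (fun x (hx : x < -L) => hΦ0 x fun h => absurd h.1 (not_le.2 hx)) h4 h3
      · refine hΦ0 r fun h => hr ⟨lt_of_le_of_ne h.1 (Ne.symm h2), h.2⟩
    simp [this]

/-- For `a` of class `C¹` the product `φ a` is again a `C¹` test function. This is why weak
derivatives on the line are tested against `C¹` functions: the multipliers that occur are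
exponentials of primitives of continuous functions and solutions of a Riccati equation. -/
lemma WeakDeriv.smul {f g : ℝ → E} (h : WeakDeriv f g) {a : ℝ → ℝ} (ha : ContDiff ℝ 1 a) :
    WeakDeriv (fun s => a s • f s) (fun s => deriv a s • f s + a s • g s) where
  left := h.left.continuous_smul ha.continuous
  right := (h.left.continuous_smul (ha.continuous_deriv le_rfl)).add
    (h.right.continuous_smul ha.continuous)
  eq φ hφ hc := by
    have h1 := h.eq (fun s => φ s * a s) (hφ.mul ha) hc.mul_right
    have hd : ∀ s, deriv (fun s => φ s * a s) s = deriv φ s * a s + φ s * deriv a s := fun s =>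
      deriv_fun_mul (hφ.differentiable one_ne_zero s) (ha.differentiable one_ne_zero s)
    have i1 : Integrable fun s => deriv φ s • a s • f s :=
      integrable_smul_of_hasCompactSupport (hφ.continuous_deriv le_rfl) hc.deriv
        (h.left.continuous_smul ha.continuous)
    have i2 : Integrable fun s => φ s • deriv a s • f s :=
      integrable_smul_of_hasCompactSupport hφ.continuous hc
        (h.left.continuous_smul (ha.continuous_deriv le_rfl))
    have i3 : Integrable fun s => φ s • a s • g s :=
      integrable_smul_of_hasCompactSupport hφ.continuous hc
        (h.right.continuous_smul ha.continuous)
    simp_rw [hd, add_smul, mul_smul] at h1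
    rw [integral_add i1 i2] at h1
    simp_rw [smul_add]
    rw [integral_add i2 i3, neg_add, ← h1]
    abel

lemma WeakDeriv.congr_ae {f f' g g' : ℝ → E} (h : WeakDeriv f g) (hf : f =ᵐ[volume] f')
    (hg : g =ᵐ[volume] g') : WeakDeriv f' g' where
  left := h.left.congr hf
  right := h.right.congr hg
  eq φ hφ hc := by
    have e1 : ∫ s, deriv φ s • f s = ∫ s, deriv φ s • f' s :=
      integral_congr_ae (hf.mono fun s hs => by simp only [hs])
    have e2 : ∫ s, φ s • g s = ∫ s, φ s • g' s :=
      integral_congr_ae (hg.mono fun s hs => by simp only [hs])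
    rw [← e1, ← e2, h.eq φ hφ hc]

lemma WeakDeriv.add {f g f' g' : ℝ → E} (h : WeakDeriv f g) (h' : WeakDeriv f' g') :
    WeakDeriv (fun s => f s + f' s) (fun s => g s + g' s) where
  left := h.left.add h'.left
  right := h.right.add h'.right
  eq φ hφ hc := by
    simp_rw [smul_add]
    rw [integral_add, integral_add, h.eq φ hφ hc, h'.eq φ hφ hc, neg_add]
    · exact integrable_smul_of_hasCompactSupport hφ.continuous hc h.right
    · exact integrable_smul_of_hasCompactSupport hφ.continuous hc h'.right
    · exact integrable_smul_of_hasCompactSupport (hφ.continuous_deriv le_rfl) hc.deriv h.left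
    · exact integrable_smul_of_hasCompactSupport (hφ.continuous_deriv le_rfl) hc.deriv h'.left

lemma weakDeriv_primitive [CompleteSpace E] {h : ℝ → E} (hh : LocallyIntegrable h) (c₀ : E) :
    WeakDeriv (fun s => c₀ + ∫ r in (0 : ℝ)..s, h r) h where
  left := by
    refine Continuous.locallyIntegrable (continuous_const.add ?_)
    refine intervalIntegral.continuous_primitive (fun a b => ?_) 0
    rw [intervalIntegrable_iff]
    exact (hh.integrableOn_isCompact isCompact_uIcc).mono_set uIoc_subset_uIcc
  right := hh
  eq φ hφ hc := integral_deriv_smul_primitive hh c₀ hφ hc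

lemma contDiff_one_primitive {σ : ℝ → ℝ} (hσ : Continuous σ) :
    ContDiff ℝ 1 (fun s => ∫ r in (0 : ℝ)..s, σ r) ∧
      deriv (fun s => ∫ r in (0 : ℝ)..s, σ r) = σ := by
  have h : deriv (fun s => ∫ r in (0 : ℝ)..s, σ r) = σ :=
    funext fun s => hσ.deriv_integral _ 0 s
  refine ⟨contDiff_one_iff_deriv.2 ⟨fun s => ?_, by rwa [h]⟩, h⟩
  exact (hσ.integral_hasStrictDerivAt 0 s).hasDerivAt.differentiableAt

/-- The kernel construction of a solution of `y' = σ y + f` with a weighted `L²` bound. -/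
lemma exists_solution_of_kernel [CompleteSpace E] {σ ρ : ℝ → ℝ} (hσ : Continuous σ)
    (hρ : Continuous ρ) (hρ0 : ∀ s, 0 < ρ s) {C c : ℝ} (hc : 0 < c) (hC : 0 ≤ C)
    {χ : ℝ → ℝ → ℝ} (hχm : Measurable (Function.uncurry χ)) (hχ1 : ∀ s r, |χ s r| ≤ 1)
    (hχ : ∀ s r, χ s r - χ 0 r =
      (Ioc 0 s).indicator (fun _ => (1 : ℝ)) r - (Ioc s 0).indicator (fun _ => (1 : ℝ)) r)
    (hb : ∀ s r, χ s r ≠ 0 → ρ s * Real.exp (∫ x in (0 : ℝ)..s, σ x)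
      ≤ C * Real.exp (-c * |s - r|) * (ρ r * Real.exp (∫ x in (0 : ℝ)..r, σ x)))
    {f : ℝ → E} (hf : MemLp (fun s => ρ s • f s) 2) :
    ∃ y : ℝ → E, WeakDeriv y (fun s => σ s • y s + f s) ∧ MemLp (fun s => ρ s • y s) 2 ∧
      eLpNorm (fun s => ρ s • y s) 2 volume
        ≤ ENNReal.ofReal (2 * C / c) * eLpNorm (fun s => ρ s • f s) 2 volume := by
  obtain ⟨hS, hS'⟩ := contDiff_one_primitive hσ
  set S : ℝ → ℝ := fun s => ∫ x in (0 : ℝ)..s, σ x with hSdef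
  have hSc := hS.continuous
  -- The kernel of the solution operator conjugated by the weight, so that it acts on unweighted
  -- `L²`. The cutoff `χ` encodes the base point of the integration.
  set K : ℝ → ℝ → ℝ := fun s r =>
    χ s r * (ρ s * Real.exp (S s)) * (ρ r * Real.exp (S r))⁻¹ with hK
  have hKm : Measurable (Function.uncurry K) := by
    have h1 : Measurable fun p : ℝ × ℝ => ρ p.1 * Real.exp (S p.1) :=
      ((hρ.mul hSc.rexp).comp continuous_fst).measurable
    have h2 : Measurable fun p : ℝ × ℝ => (ρ p.2 * Real.exp (S p.2))⁻¹ :=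
      ((hρ.mul hSc.rexp).comp continuous_snd).measurable.inv
    exact (hχm.mul h1).mul h2
  have hpos : ∀ s, 0 < ρ s * Real.exp (S s) := fun s => mul_pos (hρ0 s) (Real.exp_pos _)
  have hKb : ∀ s r, |K s r| ≤ C * Real.exp (-c * |s - r|) := by
    intro s r
    by_cases h0 : χ s r = 0
    · simp only [hK, h0, zero_mul, abs_zero]; positivity
    · rw [hK, abs_mul, abs_mul, abs_of_pos (hpos s), abs_of_pos (inv_pos.2 (hpos r)),
        ← div_eq_mul_inv, div_le_iff₀ (hpos r)]
      exact (mul_le_of_le_one_left (hpos s).le (hχ1 s r)).trans (hb s r h0)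
  have hKi := fun s => integrable_kernel hc hKm hKb hf s
  have hfl : LocallyIntegrable f := by
    have := (hf.locallyIntegrable one_le_two).continuous_smul
      (hρ.inv₀ fun s => (hρ0 s).ne')
    refine this.congr (Eventually.of_forall fun s => ?_)
    simp [smul_smul, inv_mul_cancel₀ (hρ0 s).ne']
  set h : ℝ → E := fun r => Real.exp (-S r) • f r with hh
  have hhl : LocallyIntegrable h := hfl.continuous_smul hSc.neg.rexp
  have e0 : ∀ s r, K s r • ρ r • f r = (ρ s * Real.exp (S s)) • χ s r • h r := by
    intro s r
    simp only [hK, hh, smul_smul]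
    congr 1
    rw [Real.exp_neg]
    have := (hρ0 r).ne'
    have := (Real.exp_pos (S r)).ne'
    field_simp
  have hχi : ∀ s, Integrable fun r => χ s r • h r := by
    intro s
    have := (hKi s).smul (ρ s * Real.exp (S s))⁻¹
    refine this.congr (Eventually.of_forall fun r => ?_)
    simp only [Pi.smul_apply, e0, smul_smul]
    rw [inv_mul_cancel_left₀ (hpos s).ne']
  set y : ℝ → E := fun s => Real.exp (S s) • ∫ r, χ s r • h r with hy
  have hyK : (fun s => ρ s • y s) = fun s => ∫ r, K s r • ρ r • f r := by
    ext s
    simp_rw [e0, integral_smul, hy, smul_smul]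
  -- The hypothesis on `χ s - χ 0` says that changing the base point changes the integral only by a
  -- constant, so it is a primitive of `h` whatever the choice of `χ`.
  have hprim : ∀ s, ∫ r, χ s r • h r = (∫ r, χ 0 r • h r) + ∫ r in (0 : ℝ)..s, h r := by
    intro s
    rw [← sub_eq_iff_eq_add', ← integral_sub (hχi s) (hχi 0)]
    simp_rw [← sub_smul, hχ, sub_smul]
    have h1 : ∀ a b, Integrable fun r => (Ioc a b).indicator (fun _ => (1 : ℝ)) r • h r := by
      intro a b
      have : Integrable ((Ioc a b).indicator h) := by
        rw [integrable_indicator_iff measurableSet_Ioc]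
        exact (hhl.integrableOn_isCompact isCompact_Icc).mono_set Ioc_subset_Icc_self
      refine this.congr (Eventually.of_forall fun r => ?_)
      by_cases hr : r ∈ Ioc a b <;> simp [hr]
    have h2 : ∀ a b, ∫ r, (Ioc a b).indicator (fun _ => (1 : ℝ)) r • h r
        = ∫ r in Ioc a b, h r := by
      intro a b
      rw [← integral_indicator measurableSet_Ioc]
      congr 1
      ext r
      by_cases hr : r ∈ Ioc a b <;> simp [hr]
    rw [integral_sub (h1 _ _) (h1 _ _), h2, h2]
    rfl
  refine ⟨y, ?_, ?_, ?_⟩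
  · have h1 := (weakDeriv_primitive hhl (∫ r, χ 0 r • h r)).smul (a := fun s => Real.exp (S s))
      hS.exp
    have hd : ∀ s, deriv (fun s => Real.exp (S s)) s = Real.exp (S s) * σ s := by
      intro s
      rw [deriv_exp (hS.differentiable one_ne_zero s), hS']
    have hyP : ∀ s, y s
        = Real.exp (S s) • ((∫ r, χ 0 r • h r) + ∫ r in (0 : ℝ)..s, h r) := fun s => by
      rw [← hprim]
    refine h1.congr_ae (Eventually.of_forall fun s => (hyP s).symm)
      (Eventually.of_forall fun s => ?_)
    simp only [hyP, hd, hh]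
    rw [smul_smul (Real.exp (S s)), ← Real.exp_add, add_neg_cancel, Real.exp_zero, one_smul,
      smul_smul, mul_comm]
  · rw [hyK]
    exact ⟨aestronglyMeasurable_kernel hKm hf, (eLpNorm_kernel_le hc hC hKb hf).trans_lt
      (ENNReal.mul_lt_top ENNReal.ofReal_lt_top hf.2)⟩
  · rw [hyK]
    exact eLpNorm_kernel_le hc hC hKb hf

end Vortex

/-! ### Weighted solvability of first-order scalar equations -/

namespace Vortex

open Filter Topology Set

variable {E : Type*} [NormedAddCommGroup E] [NormedSpace ℝ E]

section Growth

variable {θ : ℝ → ℝ}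

/-- The integrand can be negative only on a bounded interval `[0, L]`, where its primitive is
bounded by some `M`. A difference of two values of the primitive there costs at most `2 * M`. -/
lemma integral_ge_of_eventually_nonneg_atTop (hθ : Continuous θ) (h : ∀ᶠ s in atTop, 0 ≤ θ s) :
    ∃ A, 0 ≤ A ∧ ∀ s r, 0 ≤ s → s ≤ r → -A ≤ ∫ x in s..r, θ x := by
  obtain ⟨L, hL⟩ := eventually_atTop.1 (h.and (eventually_ge_atTop 0))
  set F : ℝ → ℝ := fun r => ∫ x in (0 : ℝ)..r, θ x
  have hF : Continuous F := (contDiff_one_primitive hθ).1.continuous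
  have hsub : ∀ s r, ∫ x in s..r, θ x = F r - F s := fun s r =>
    (intervalIntegral.integral_interval_sub_left (hθ.intervalIntegrable _ _)
      (hθ.intervalIntegrable _ _)).symm
  obtain ⟨M, hM⟩ := (isCompact_Icc (a := (0 : ℝ)) (b := L)).exists_bound_of_continuousOn
    hF.continuousOn
  have hL0 : 0 ≤ L := (hL L le_rfl).2
  have hM0 : 0 ≤ M := (norm_nonneg _).trans (hM 0 ⟨le_rfl, hL0⟩)
  have hmono : ∀ s r, L ≤ s → s ≤ r → 0 ≤ ∫ x in s..r, θ x := fun s r hs hr =>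
    intervalIntegral.integral_nonneg hr fun x hx => (hL x (hs.trans hx.1)).1
  refine ⟨2 * M, by linarith, fun s r hs hr => ?_⟩
  rcases le_total r L with hrL | hrL
  · have h1 := abs_le.1 (hM s ⟨hs, hr.trans hrL⟩)
    have h2 := abs_le.1 (hM r ⟨hs.trans hr, hrL⟩)
    rw [hsub]; linarith
  · rcases le_total s L with hsL | hsL
    · have h1 := abs_le.1 (hM s ⟨hs, hsL⟩)
      have h2 := abs_le.1 (hM L ⟨hL0, le_rfl⟩)
      have h3 := hmono L r le_rfl hrL
      rw [hsub] at h3 ⊢; linarith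
    · have := hmono s r hsL hr
      linarith

lemma integral_ge_of_eventually_nonneg_atBot (hθ : Continuous θ) (h : ∀ᶠ s in atBot, 0 ≤ θ s) :
    ∃ A, 0 ≤ A ∧ ∀ s r, r ≤ 0 → s ≤ r → -A ≤ ∫ x in s..r, θ x := by
  obtain ⟨A, hA, h1⟩ := integral_ge_of_eventually_nonneg_atTop (θ := fun s => θ (-s))
    (hθ.comp continuous_neg) (tendsto_neg_atTop_atBot.eventually h)
  refine ⟨A, hA, fun s r hr hs => ?_⟩
  have := h1 (-r) (-s) (by linarith) (by linarith)
  simpa using this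

lemma integral_ge_of_eventually_nonneg (hθ : Continuous θ) (h : ∀ᶠ s in atTop, 0 ≤ θ s)
    (h' : ∀ᶠ s in atBot, 0 ≤ θ s) :
    ∃ A, 0 ≤ A ∧ ∀ s r, s ≤ r → -A ≤ ∫ x in s..r, θ x := by
  obtain ⟨A, hA, h1⟩ := integral_ge_of_eventually_nonneg_atTop hθ h
  obtain ⟨B, hB, h2⟩ := integral_ge_of_eventually_nonneg_atBot hθ h'
  refine ⟨A + B, by positivity, fun s r hs => ?_⟩
  rcases le_total 0 s with h0 | h0
  · have := h1 s r h0 hs; linarith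
  · rcases le_total r 0 with h3 | h3
    · have := h2 s r h3 hs; linarith
    · have := h1 0 r le_rfl h3
      have := h2 s 0 le_rfl h0
      rw [← intervalIntegral.integral_add_adjacent_intervals (b := 0)
        (hθ.intervalIntegrable _ _) (hθ.intervalIntegrable _ _)]
      linarith

end Growth

section Solve

variable [CompleteSpace E] {σ ρ : ℝ → ℝ} {δ B c A : ℝ} {f : ℝ → E}

/-- By `hB` the weight equals `exp(-δ|s|)` up to a factor between `exp(-B)` and `exp(B)`. Using this
at `s` and at `r` accounts for the constant `2 * B`. -/
lemma kernel_bound (hρ0 : ∀ s, 0 < ρ s) (hB : ∀ s, |Real.log (ρ s) + δ * (|s|)| ≤ B) {s r S R a : ℝ}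
    (h : S - R + δ * |r| - δ * |s| ≤ A - a * |s - r|) :
    ρ s * Real.exp S ≤ Real.exp (2 * B + A) * Real.exp (-a * |s - r|) * (ρ r * Real.exp R) := by
  rw [← Real.exp_log (hρ0 s), ← Real.exp_log (hρ0 r), ← Real.exp_add, ← Real.exp_add,
    ← Real.exp_add, ← Real.exp_add, Real.exp_le_exp]
  have h1 := abs_le.1 (hB s)
  have h2 := abs_le.1 (hB r)
  linarith

/-- For an expanding equation the integral is taken from `+∞` down to `s`, whence the cutoff `-1` on
`s < r`. The weight changes by at most `exp(δ|s - r|)`, which leaves the decay rate `c - δ`. -/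
lemma exists_solution_of_expanding (hσ : Continuous σ) (hρ : Continuous ρ) (hρ0 : ∀ s, 0 < ρ s)
    (hδ : 0 < δ) (hB : ∀ s, |Real.log (ρ s) + δ * (|s|)| ≤ B) (hc : δ < c)
    (hA : ∀ s r, s ≤ r → c * (r - s) - A ≤ ∫ x in s..r, σ x)
    (hf : MemLp (fun s => ρ s • f s) 2) :
    ∃ y : ℝ → E, WeakDeriv y (fun s => σ s • y s + f s) ∧ MemLp (fun s => ρ s • y s) 2 ∧
      eLpNorm (fun s => ρ s • y s) 2 volume
        ≤ ENNReal.ofReal (2 * Real.exp (2 * B + A) / (c - δ))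
          * eLpNorm (fun s => ρ s • f s) 2 volume := by
  refine exists_solution_of_kernel hσ hρ hρ0 (sub_pos.2 hc) (Real.exp_pos _).le
    (χ := fun s r => if s < r then -1 else 0) ?_ ?_ ?_ ?_ hf
  · exact Measurable.ite (measurableSet_lt measurable_fst measurable_snd) measurable_const
      measurable_const
  · intro s r; split_ifs <;> simp
  · intro s r
    simp only [indicator, mem_Ioc]
    rcases lt_or_ge s r with h1 | h1 <;> rcases lt_or_ge 0 r with h2 | h2 <;>
      simp [h1, h2, not_lt.2, not_le.2]
  · intro s r h
    have hsr : s < r := by by_contra h'; simp [h'] at h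
    refine kernel_bound hρ0 hB ?_
    have h1 := hA s r hsr.le
    rw [← intervalIntegral.integral_interval_sub_left (hσ.intervalIntegrable 0 r)
      (hσ.intervalIntegrable 0 s)] at h1
    rw [abs_of_neg (sub_neg.2 hsr)]
    have h2 : |r| - |s| ≤ r - s := (abs_sub_abs_le_abs_sub r s).trans_eq
      (abs_of_pos (sub_pos.2 hsr))
    nlinarith

/-- The mirror case: the integral is taken from `-∞` up to `s`. -/
lemma exists_solution_of_contracting (hσ : Continuous σ) (hρ : Continuous ρ) (hρ0 : ∀ s, 0 < ρ s)
    (hδ : 0 < δ) (hB : ∀ s, |Real.log (ρ s) + δ * (|s|)| ≤ B) (hc : δ < c)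
    (hA : ∀ s r, s ≤ r → ∫ x in s..r, σ x ≤ A - c * (r - s))
    (hf : MemLp (fun s => ρ s • f s) 2) :
    ∃ y : ℝ → E, WeakDeriv y (fun s => σ s • y s + f s) ∧ MemLp (fun s => ρ s • y s) 2 ∧
      eLpNorm (fun s => ρ s • y s) 2 volume
        ≤ ENNReal.ofReal (2 * Real.exp (2 * B + A) / (c - δ))
          * eLpNorm (fun s => ρ s • f s) 2 volume := by
  refine exists_solution_of_kernel hσ hρ hρ0 (sub_pos.2 hc) (Real.exp_pos _).le
    (χ := fun s r => if r ≤ s then 1 else 0) ?_ ?_ ?_ ?_ hf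
  · exact Measurable.ite (measurableSet_le measurable_snd measurable_fst) measurable_const
      measurable_const
  · intro s r; split_ifs <;> simp
  · intro s r
    simp only [indicator, mem_Ioc]
    rcases lt_or_ge s r with h1 | h1 <;> rcases lt_or_ge 0 r with h2 | h2 <;>
      simp [h1, h2, not_lt.2, not_le.2]
  · intro s r h
    have hsr : r ≤ s := by by_contra h'; simp [h'] at h
    refine kernel_bound hρ0 hB ?_
    have h1 := hA r s hsr
    rw [← intervalIntegral.integral_interval_sub_left (hσ.intervalIntegrable 0 s)
      (hσ.intervalIntegrable 0 r)] at h1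
    rw [abs_of_nonneg (sub_nonneg.2 hsr)]
    have h2 : |r| - |s| ≤ s - r := (abs_sub_abs_le_abs_sub r s).trans_eq
      (by rw [abs_sub_comm, abs_of_nonneg (sub_nonneg.2 hsr)])
    nlinarith

/-- Here the integration starts at `0`, so `r` lies between `0` and `s` and `|s| - |r| = |s - r|`.
The weight then gains `exp(-δ|s - r|)` and beats growth at a rate `c < δ`. This case depends on the
weight being decaying. -/
lemma exists_solution_of_slow_growth (hσ : Continuous σ) (hρ : Continuous ρ) (hρ0 : ∀ s, 0 < ρ s)
    (hB : ∀ s, |Real.log (ρ s) + δ * (|s|)| ≤ B) (hc : c < δ)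
    (hA : ∀ s r, 0 ≤ s → s ≤ r → ∫ x in s..r, σ x ≤ A + c * (r - s))
    (hA' : ∀ s r, r ≤ 0 → s ≤ r → -A - c * (r - s) ≤ ∫ x in s..r, σ x)
    (hf : MemLp (fun s => ρ s • f s) 2) :
    ∃ y : ℝ → E, WeakDeriv y (fun s => σ s • y s + f s) ∧ MemLp (fun s => ρ s • y s) 2 ∧
      eLpNorm (fun s => ρ s • y s) 2 volume
        ≤ ENNReal.ofReal (2 * Real.exp (2 * B + A) / (δ - c))
          * eLpNorm (fun s => ρ s • f s) 2 volume := by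
  refine exists_solution_of_kernel hσ hρ hρ0 (sub_pos.2 hc) (Real.exp_pos _).le
    (χ := fun s r => if 0 < r ∧ r ≤ s then 1 else if s < r ∧ r ≤ 0 then -1 else 0) ?_ ?_ ?_ ?_ hf
  · refine Measurable.ite ?_ measurable_const (Measurable.ite ?_ measurable_const measurable_const)
    · exact (measurableSet_lt measurable_const measurable_snd).inter
        (measurableSet_le measurable_snd measurable_fst)
    · exact (measurableSet_lt measurable_fst measurable_snd).inter
        (measurableSet_le measurable_snd measurable_const)
  · intro s r; split_ifs <;> simp
  · intro s r
    have h0 : ¬ (0 < r ∧ r ≤ 0) := fun h => absurd h.1 (not_lt.2 h.2)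
    simp only [indicator, mem_Ioc, h0, if_false, sub_zero]
    by_cases h1 : 0 < r ∧ r ≤ s
    · have h2 : ¬ (s < r ∧ r ≤ 0) := fun h => absurd h1.1 (not_lt.2 h.2)
      simp [h1, h2]
    · by_cases h2 : s < r ∧ r ≤ 0 <;> simp [h1, h2]
  · intro s r h
    refine kernel_bound hρ0 hB ?_
    have e : ∀ a b, (∫ x in a..b, σ x) = (∫ x in (0:ℝ)..b, σ x) - ∫ x in (0:ℝ)..a, σ x := fun a b =>
      (intervalIntegral.integral_interval_sub_left (hσ.intervalIntegrable 0 b)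
        (hσ.intervalIntegrable 0 a)).symm
    by_cases h1 : 0 < r ∧ r ≤ s
    · have h2 := hA r s h1.1.le h1.2
      rw [e] at h2
      rw [abs_of_nonneg (sub_nonneg.2 h1.2), abs_of_pos h1.1, abs_of_pos (h1.1.trans_le h1.2)]
      nlinarith
    · have h3 : s < r ∧ r ≤ 0 := by by_contra h'; simp [h1, h'] at h
      have h2 := hA' s r h3.2 h3.1.le
      rw [e] at h2
      rw [abs_of_neg (sub_neg.2 h3.1), abs_of_nonpos h3.2, abs_of_neg (h3.1.trans_le h3.2)]
      nlinarith

end Solve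

end Vortex

/-! ### Solvability of the Fourier modes with uniform bounds -/

namespace Vortex

open Filter Topology Set

variable {E : Type*} [NormedAddCommGroup E] [NormedSpace ℝ E]

section Modes

variable {η ρ : ℝ → ℝ} {δ B : ℝ} {m n : ℤ}

/-- The equation `y' = 2π(k + η) y + f` is solvable in the weighted space, with the gain of one
derivative expressed by the constant `C`. -/
def ModeSolvable (E : Type*) [NormedAddCommGroup E] [NormedSpace ℝ E] (η ρ : ℝ → ℝ) (C : ℝ)
    (k : ℤ) : Prop :=
  ∀ f : ℝ → E, MemLp (fun s => ρ s • f s) 2 →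
    ∃ y : ℝ → E, WeakDeriv y (fun s => (2 * Real.pi * (k + η s)) • y s + f s) ∧
      MemLp (fun s => ρ s • y s) 2 ∧
      ENNReal.ofReal (1 + |(k : ℝ)|) * eLpNorm (fun s => ρ s • y s) 2 volume
        ≤ ENNReal.ofReal C * eLpNorm (fun s => ρ s • f s) 2 volume

lemma ModeSolvable.mono {C C' : ℝ} {k : ℤ} (h : ModeSolvable E η ρ C k) (hC : C ≤ C') :
    ModeSolvable E η ρ C' k := fun f hf => by
  obtain ⟨y, h1, h2, h3⟩ := h f hf
  exact ⟨y, h1, h2, h3.trans (by gcongr)⟩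

lemma mul_le_of_le {a b c : ℝ} {x y : ℝ≥0∞} (h : x ≤ ENNReal.ofReal b * y) (ha : 0 ≤ a)
    (hab : a * b ≤ c) : ENNReal.ofReal a * x ≤ ENNReal.ofReal c * y := by
  calc _ ≤ ENNReal.ofReal a * (ENNReal.ofReal b * y) := by gcongr
    _ = ENNReal.ofReal (a * b) * y := by rw [← mul_assoc, ENNReal.ofReal_mul ha]
    _ ≤ _ := by gcongr

/-- The decay rate of the mode kernel grows linearly in the distance `j` of `k` from the critical
range, and so does `|k|`. Their quotient therefore stays bounded, which is the gain of one
derivative. -/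
lemma gain_bound {ε x j D p : ℝ} {k : ℝ} (hε : 0 < ε) (hεp : ε ≤ p) (hj : 0 ≤ j) (hx : 0 ≤ x)
    (hk : |k| ≤ j + 1 + D) (hD : 0 ≤ D) :
    (1 + |k|) * (2 * x / (ε + p * j)) ≤ 2 * x * (2 + D) / ε := by
  have h1 : ε * (1 + j) ≤ ε + p * j := by nlinarith
  have h2 : 1 + |k| ≤ (2 + D) * (1 + j) := by nlinarith
  have h3 : 0 < ε + p * j := lt_of_lt_of_le (by positivity) h1
  rw [mul_div_assoc', div_le_div_iff₀ h3 hε]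
  have h4 : (1 + |k|) * ε ≤ (2 + D) * (ε + p * j) := by nlinarith
  nlinarith

variable [CompleteSpace E]

/-- The coefficients for `k` and `n + 1` differ by the constant `2π(k - n - 1)`. A lower bound for
mode `n + 1` with offset `A` thus serves all `k > n` with the same `A`, at a rate that increases
with `k`. -/
lemma modeSolvable_above (hη : Continuous η) (hρ : Continuous ρ) (hρ0 : ∀ s, 0 < ρ s)
    (hδ : 0 < δ) (hδ' : δ < 2 * Real.pi) (hB : ∀ s, |Real.log (ρ s) + δ * (|s|)| ≤ B)
    (hmn : m ≤ n) (hn : Tendsto η atTop (𝓝 (-n))) (hm : Tendsto η atBot (𝓝 (-m))) :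
    ∃ C, 0 ≤ C ∧ ∀ k, n < k → ModeSolvable E η ρ C k := by
  -- The midpoint of `δ` and `2π`. Both limits of the coefficient of mode `n + 1` are at least `2π`,
  -- so the coefficient eventually exceeds `c`, and `c` exceeds `δ`.
  set c := (2 * Real.pi + δ) / 2 with hc
  have hmn' : (m : ℝ) ≤ n := by exact_mod_cast hmn
  have hpi := Real.pi_pos
  have h1 : ∀ᶠ s in atTop, 0 ≤ 2 * Real.pi * ((n + 1 : ℤ) + η s) - c := by
    have : Tendsto (fun s => 2 * Real.pi * ((n + 1 : ℤ) + η s) - c) atTop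
        (𝓝 (2 * Real.pi * ((n + 1 : ℤ) + -n) - c)) := ((hn.const_add _).const_mul _).sub_const _
    exact (this.eventually (lt_mem_nhds (a := 0) (by push_cast; rw [hc]; linarith))).mono
      fun _ => le_of_lt
  have h2 : ∀ᶠ s in atBot, 0 ≤ 2 * Real.pi * ((n + 1 : ℤ) + η s) - c := by
    have : Tendsto (fun s => 2 * Real.pi * ((n + 1 : ℤ) + η s) - c) atBot
        (𝓝 (2 * Real.pi * ((n + 1 : ℤ) + -m) - c)) := ((hm.const_add _).const_mul _).sub_const _
    exact (this.eventually (lt_mem_nhds (a := 0) (by push_cast; rw [hc]; nlinarith))).mono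
      fun _ => le_of_lt
  obtain ⟨A, hA, h3⟩ := integral_ge_of_eventually_nonneg
    (θ := fun s => 2 * Real.pi * ((n + 1 : ℤ) + η s) - c) (by fun_prop) h1 h2
  refine ⟨2 * Real.exp (2 * B + A) * (2 + |(n : ℝ)|) / ((2 * Real.pi - δ) / 2),
    div_nonneg (by positivity) (by linarith), fun k hk f hf => ?_⟩
  have hj : (0 : ℝ) ≤ k - n - 1 := by
    have : ((n + 1 : ℤ) : ℝ) ≤ k := by exact_mod_cast hk
    push_cast at this; linarith
  have hδc : δ < c + 2 * Real.pi * (k - n - 1) := by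
    have : 0 ≤ 2 * Real.pi * (k - n - 1 : ℝ) := by positivity
    rw [hc]; linarith
  obtain ⟨y, e1, e2, e3⟩ := exists_solution_of_expanding (A := A)
    (σ := fun s => 2 * Real.pi * (k + η s)) (by fun_prop) hρ hρ0 hδ hB hδc (fun s r hsr => by
      have h4 := h3 s r hsr
      have h5 : (∫ x in s..r, 2 * Real.pi * (k + η x)) =
          (∫ x in s..r, (2 * Real.pi * ((n + 1 : ℤ) + η x) - c))
            + ∫ x in s..r, (c + 2 * Real.pi * (k - n - 1)) := by
        rw [← intervalIntegral.integral_add (Continuous.intervalIntegrable (by fun_prop) _ _)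
          (Continuous.intervalIntegrable (by fun_prop) _ _)]
        congr 1; ext x; push_cast; ring
      rw [h5, intervalIntegral.integral_const, smul_eq_mul]
      linarith) hf
  refine ⟨y, e1, e2, mul_le_of_le e3 (by positivity) ?_⟩
  have e4 : c + 2 * Real.pi * (k - n - 1) - δ
      = (2 * Real.pi - δ) / 2 + 2 * Real.pi * (k - n - 1) := by rw [hc]; ring
  rw [e4]
  refine gain_bound (by linarith) (by linarith) hj (Real.exp_pos _).le ?_ (abs_nonneg _)
  have := abs_add_le ((k : ℝ) - n) n
  rw [sub_add_cancel, abs_of_nonneg (show (0 : ℝ) ≤ k - n by linarith)] at this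
  linarith

lemma modeSolvable_below (hη : Continuous η) (hρ : Continuous ρ) (hρ0 : ∀ s, 0 < ρ s)
    (hδ : 0 < δ) (hδ' : δ < 2 * Real.pi) (hB : ∀ s, |Real.log (ρ s) + δ * (|s|)| ≤ B)
    (hmn : m ≤ n) (hn : Tendsto η atTop (𝓝 (-n))) (hm : Tendsto η atBot (𝓝 (-m))) :
    ∃ C, 0 ≤ C ∧ ∀ k, k < m → ModeSolvable E η ρ C k := by
  set c := (2 * Real.pi + δ) / 2 with hc
  have hmn' : (m : ℝ) ≤ n := by exact_mod_cast hmn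
  have hpi := Real.pi_pos
  have h1 : ∀ᶠ s in atTop, 0 ≤ -(2 * Real.pi * ((m - 1 : ℤ) + η s)) - c := by
    have : Tendsto (fun s => -(2 * Real.pi * ((m - 1 : ℤ) + η s)) - c) atTop
        (𝓝 (-(2 * Real.pi * ((m - 1 : ℤ) + -n)) - c)) :=
      (((hn.const_add _).const_mul _).neg).sub_const _
    exact (this.eventually (lt_mem_nhds (a := 0) (by push_cast; rw [hc]; nlinarith))).mono
      fun _ => le_of_lt
  have h2 : ∀ᶠ s in atBot, 0 ≤ -(2 * Real.pi * ((m - 1 : ℤ) + η s)) - c := by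
    have : Tendsto (fun s => -(2 * Real.pi * ((m - 1 : ℤ) + η s)) - c) atBot
        (𝓝 (-(2 * Real.pi * ((m - 1 : ℤ) + -m)) - c)) :=
      (((hm.const_add _).const_mul _).neg).sub_const _
    exact (this.eventually (lt_mem_nhds (a := 0) (by push_cast; rw [hc]; nlinarith))).mono
      fun _ => le_of_lt
  obtain ⟨A, hA, h3⟩ := integral_ge_of_eventually_nonneg
    (θ := fun s => -(2 * Real.pi * ((m - 1 : ℤ) + η s)) - c) (by fun_prop) h1 h2
  refine ⟨2 * Real.exp (2 * B + A) * (2 + |(m : ℝ)|) / ((2 * Real.pi - δ) / 2),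
    div_nonneg (by positivity) (by linarith), fun k hk f hf => ?_⟩
  have hj : (0 : ℝ) ≤ m - 1 - k := by
    have : (k : ℝ) ≤ ((m - 1 : ℤ) : ℝ) := by exact_mod_cast Int.le_sub_one_of_lt hk
    push_cast at this; linarith
  have hδc : δ < c + 2 * Real.pi * (m - 1 - k) := by
    have : 0 ≤ 2 * Real.pi * (m - 1 - k : ℝ) := by positivity
    rw [hc]; linarith
  obtain ⟨y, e1, e2, e3⟩ := exists_solution_of_contracting (A := A)
    (σ := fun s => 2 * Real.pi * (k + η s)) (by fun_prop) hρ hρ0 hδ hB hδc (fun s r hsr => by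
      have h4 := h3 s r hsr
      have h5 : (∫ x in s..r, 2 * Real.pi * (k + η x)) =
          -((∫ x in s..r, (-(2 * Real.pi * ((m - 1 : ℤ) + η x)) - c))
            + ∫ x in s..r, (c + 2 * Real.pi * (m - 1 - k))) := by
        rw [← intervalIntegral.integral_add (Continuous.intervalIntegrable (by fun_prop) _ _)
          (Continuous.intervalIntegrable (by fun_prop) _ _), ← intervalIntegral.integral_neg]
        congr 1; ext x; push_cast; ring
      rw [h5, intervalIntegral.integral_const, smul_eq_mul]
      linarith) hf
  refine ⟨y, e1, e2, mul_le_of_le e3 (by positivity) ?_⟩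
  have e4 : c + 2 * Real.pi * (m - 1 - k) - δ
      = (2 * Real.pi - δ) / 2 + 2 * Real.pi * (m - 1 - k) := by rw [hc]; ring
  rw [e4]
  refine gain_bound (by linarith) (by linarith) hj (Real.exp_pos _).le ?_ (abs_nonneg _)
  have := abs_add_le ((k : ℝ) - m) m
  rw [sub_add_cancel, abs_of_nonpos (show (k : ℝ) - m ≤ 0 by linarith)] at this
  linarith

/-- The coefficient tends to `2π(k - n) ≤ 0` at `+∞` and to `2π(k - m) ≥ 0` at `-∞`, so outward
growth from `0` has rate at most `δ / 2` up to a bounded error. Only finitely many `k` occur, hence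
no uniformity in `k` is needed. -/
lemma modeSolvable_between (hη : Continuous η) (hρ : Continuous ρ) (hρ0 : ∀ s, 0 < ρ s)
    (hδ : 0 < δ) (hB : ∀ s, |Real.log (ρ s) + δ * (|s|)| ≤ B)
    (hn : Tendsto η atTop (𝓝 (-n))) (hm : Tendsto η atBot (𝓝 (-m)))
    (k : ℤ) (hmk : m ≤ k) (hkn : k ≤ n) :
    ∃ C, 0 ≤ C ∧ ModeSolvable E η ρ C k := by
  set c := δ / 2 with hc
  have hmk' : (m : ℝ) ≤ k := by exact_mod_cast hmk
  have hkn' : (k : ℝ) ≤ n := by exact_mod_cast hkn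
  have hpi := Real.pi_pos
  have h1 : ∀ᶠ s in atTop, 0 ≤ c - 2 * Real.pi * (k + η s) := by
    have : Tendsto (fun s => c - 2 * Real.pi * (k + η s)) atTop
        (𝓝 (c - 2 * Real.pi * (k + -n))) := ((hn.const_add _).const_mul _).const_sub _
    exact (this.eventually (lt_mem_nhds (a := 0) (by nlinarith))).mono fun _ => le_of_lt
  have h2 : ∀ᶠ s in atBot, 0 ≤ c + 2 * Real.pi * (k + η s) := by
    have : Tendsto (fun s => c + 2 * Real.pi * (k + η s)) atBot
        (𝓝 (c + 2 * Real.pi * (k + -m))) := ((hm.const_add _).const_mul _).const_add _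
    exact (this.eventually (lt_mem_nhds (a := 0) (by nlinarith))).mono fun _ => le_of_lt
  obtain ⟨A, hA, h3⟩ := integral_ge_of_eventually_nonneg_atTop
    (θ := fun s => c - 2 * Real.pi * (k + η s)) (by fun_prop) h1
  obtain ⟨A', hA', h4⟩ := integral_ge_of_eventually_nonneg_atBot
    (θ := fun s => c + 2 * Real.pi * (k + η s)) (by fun_prop) h2
  have hi : ∀ s r, IntervalIntegrable (fun s => 2 * Real.pi * (k + η s)) volume s r :=
    fun s r => Continuous.intervalIntegrable (by fun_prop) _ _
  have hci : ∀ s r, IntervalIntegrable (fun _ => c) volume s r :=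
    fun s r => continuous_const.intervalIntegrable _ _
  refine ⟨(1 + |(k : ℝ)|) * (2 * Real.exp (2 * B + (A + A')) / (δ - c)),
    mul_nonneg (by positivity) (div_nonneg (by positivity) (by linarith)), fun f hf => ?_⟩
  obtain ⟨y, e1, e2, e3⟩ := exists_solution_of_slow_growth (A := A + A') (c := c)
    (σ := fun s => 2 * Real.pi * (k + η s)) (by fun_prop) hρ hρ0 hB (by linarith)
    (fun s r hs hsr => by
      have := h3 s r hs hsr
      rw [intervalIntegral.integral_sub (hci s r) (hi s r), intervalIntegral.integral_const,
        smul_eq_mul] at this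
      linarith)
    (fun s r hs hsr => by
      have := h4 s r hs hsr
      rw [intervalIntegral.integral_add (hci s r) (hi s r), intervalIntegral.integral_const,
        smul_eq_mul] at this
      linarith) hf
  exact ⟨y, e1, e2, mul_le_of_le e3 (by positivity) le_rfl⟩

lemma exists_modeSolvable (hη : Continuous η) (hρ : Continuous ρ) (hρ0 : ∀ s, 0 < ρ s)
    (hδ : 0 < δ) (hδ' : δ < 2 * Real.pi) (hB : ∀ s, |Real.log (ρ s) + δ * (|s|)| ≤ B)
    (hmn : m ≤ n) (hn : Tendsto η atTop (𝓝 (-n))) (hm : Tendsto η atBot (𝓝 (-m))) :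
    ∃ C, 0 ≤ C ∧ ∀ k, ModeSolvable E η ρ C k := by
  obtain ⟨C₁, hC₁, h1⟩ := modeSolvable_above (E := E) hη hρ hρ0 hδ hδ' hB hmn hn hm
  obtain ⟨C₂, hC₂, h2⟩ := modeSolvable_below (E := E) hη hρ hρ0 hδ hδ' hB hmn hn hm
  have h3 : ∀ k, ∃ C, 0 ≤ C ∧ (m ≤ k → k ≤ n → ModeSolvable E η ρ C k) := fun k => by
    by_cases h : m ≤ k ∧ k ≤ n
    · obtain ⟨C, hC, h4⟩ := modeSolvable_between (E := E) hη hρ hρ0 hδ hB hn hm k h.1 h.2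
      exact ⟨C, hC, fun _ _ => h4⟩
    · exact ⟨0, le_rfl, fun a b => absurd ⟨a, b⟩ h⟩
  choose D hD h4 using h3
  have hDs : 0 ≤ ∑ k ∈ Finset.Icc m n, D k := Finset.sum_nonneg fun k _ => hD k
  refine ⟨C₁ + C₂ + ∑ k ∈ Finset.Icc m n, D k, by positivity, fun k => ?_⟩
  rcases lt_or_ge n k with hk | hk
  · exact (h1 k hk).mono (by linarith)
  · rcases lt_or_ge k m with hk' | hk'
    · exact (h2 k hk').mono (by linarith)
    · refine (h4 k hk' hk).mono ?_
      have := Finset.single_le_sum (f := D) (fun k _ => hD k) (Finset.mem_Icc.2 ⟨hk', hk⟩)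
      linarith

end Modes

end Vortex

/-! ### Riccati factorization of a second-order equation -/

namespace Vortex

open Filter Topology Set
open scoped BoundedContinuousFunction

section Laplace

variable {M W lo hi : ℝ} {w w' : ℝ → ℝ}

/-- The bounded solution of `y' = M y - w`. -/
noncomputable def forwardLaplace (M : ℝ) (w : ℝ → ℝ) (s : ℝ) : ℝ :=
  Real.exp (M * s) * ∫ r in Ioi s, Real.exp (-M * r) * w r

lemma integrableOn_exp_mul_bounded (hM : 0 < M) (hw : Continuous w) (hW : ∀ s, |w s| ≤ W) (s : ℝ) :
    IntegrableOn (fun r => Real.exp (-M * r) * w r) (Ioi s) := by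
  have h := (integrableOn_exp_mul_Ioi (by linarith : -M < 0) s)
  refine Integrable.mono' (h.mul_const W) (by fun_prop) (Eventually.of_forall fun r => ?_)
  rw [norm_mul, Real.norm_of_nonneg (Real.exp_pos _).le]
  exact mul_le_mul_of_nonneg_left (hW r) (Real.exp_pos _).le

lemma forwardLaplace_const (hM : 0 < M) (a s : ℝ) : forwardLaplace M (fun _ => a) s = a / M := by
  rw [forwardLaplace, integral_mul_const, integral_exp_mul_Ioi (by linarith)]
  have : Real.exp (M * s) * Real.exp (-M * s) = 1 := by
    rw [← Real.exp_add]; simp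
  rw [mul_comm _ a, div_eq_mul_inv a, mul_left_comm, neg_div_neg_eq, ← mul_div_assoc, this, one_div]

lemma forwardLaplace_mono (hM : 0 < M) (hw : Continuous w) (hW : ∀ s, |w s| ≤ W)
    (hw' : Continuous w') (hW' : ∀ s, |w' s| ≤ W) (h : ∀ s, w s ≤ w' s) (s : ℝ) :
    forwardLaplace M w s ≤ forwardLaplace M w' s := by
  refine mul_le_mul_of_nonneg_left ?_ (Real.exp_pos _).le
  exact integral_mono (integrableOn_exp_mul_bounded hM hw hW s)
    (integrableOn_exp_mul_bounded hM hw' hW' s)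
    fun r => mul_le_mul_of_nonneg_left (h r) (Real.exp_pos _).le

/-- The kernel is positive with total mass `1 / M`, so pointwise bounds on `w` pass through. -/
lemma forwardLaplace_mem_Icc (hM : 0 < M) (hw : Continuous w) (h : ∀ s, w s ∈ Icc lo hi) (s : ℝ) :
    forwardLaplace M w s ∈ Icc (lo / M) (hi / M) := by
  have hW : ∀ s, |w s| ≤ max |lo| |hi| := fun s => abs_le_max_abs_abs (h s).1 (h s).2
  constructor
  · rw [← forwardLaplace_const hM lo s]
    exact forwardLaplace_mono hM continuous_const (fun _ => le_max_left _ _) hw hW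
      (fun s => (h s).1) s
  · rw [← forwardLaplace_const hM hi s]
    exact forwardLaplace_mono hM hw hW continuous_const (fun _ => le_max_right _ _)
      (fun s => (h s).2) s

lemma forwardLaplace_sub (hM : 0 < M) (hw : Continuous w) (hW : ∀ s, |w s| ≤ W)
    (hw' : Continuous w') (hW' : ∀ s, |w' s| ≤ W) (s : ℝ) :
    forwardLaplace M w s - forwardLaplace M w' s = forwardLaplace M (fun r => w r - w' r) s := by
  rw [forwardLaplace, forwardLaplace, forwardLaplace, ← mul_sub,
    ← integral_sub (integrableOn_exp_mul_bounded hM hw hW s)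
      (integrableOn_exp_mul_bounded hM hw' hW' s)]
  simp_rw [mul_sub]

lemma hasDerivAt_forwardLaplace (hM : 0 < M) (hw : Continuous w) (hW : ∀ s, |w s| ≤ W) (s : ℝ) :
    HasDerivAt (forwardLaplace M w) (M * forwardLaplace M w s - w s) s := by
  have hc : Continuous fun r => Real.exp (-M * r) * w r := by fun_prop
  have e : ∀ s, ∫ r in Ioi s, Real.exp (-M * r) * w r
      = (∫ r in Ioi 0, Real.exp (-M * r) * w r) - ∫ r in (0 : ℝ)..s, Real.exp (-M * r) * w r :=
    fun s => by
      rw [← intervalIntegral.integral_Ioi_sub_Ioi' (integrableOn_exp_mul_bounded hM hw hW 0)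
        (integrableOn_exp_mul_bounded hM hw hW s)]
      ring
  have h1 : HasDerivAt (fun s => ∫ r in Ioi s, Real.exp (-M * r) * w r)
      (-(Real.exp (-M * s) * w s)) s := by
    rw [funext e]
    exact (hc.integral_hasStrictDerivAt 0 s).hasDerivAt.const_sub _
  have h2 : HasDerivAt (fun s => Real.exp (M * s)) (Real.exp (M * s) * M) s := by
    simpa using ((hasDerivAt_id s).const_mul M).exp
  refine (h2.mul h1).congr_deriv ?_
  have : Real.exp (M * s) * Real.exp (-M * s) = 1 := by
    rw [← Real.exp_add]; simp
  rw [forwardLaplace]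
  linear_combination (-w s) * this

end Laplace

section Riccati

variable {a b : ℝ} {q : ℝ → ℝ}

/-- With `w = q + Mψ - ψ²` the equation reads `ψ' = Mψ - w`, so a bounded solution is a fixed point
of `ψ ↦ forwardLaplace M w`. For `M = 2b` the function `x ↦ Mx - x²` is nondecreasing on `[a, b]`
with Lipschitz constant `M - 2a`. Hence the map takes values in `[a, b]` and contracts with ratio
`(M - 2a) / M < 1`. -/
lemma exists_riccati (ha : 0 < a) (hab : a ≤ b) (hq : Continuous q)
    (hqa : ∀ s, a ^ 2 ≤ q s) (hqb : ∀ s, q s ≤ b ^ 2) :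
    ∃ ψ : ℝ → ℝ, (∀ s, HasDerivAt ψ (ψ s ^ 2 - q s) s) ∧ ∀ s, ψ s ∈ Icc a b := by
  set M := 2 * b with hM
  have hb : 0 < b := ha.trans_le hab
  have hM0 : 0 < M := by positivity
  -- Clamping to `[a, b]` defines the map on all bounded continuous functions. It has no effect at
  -- the fixed point, whose values lie in `[a, b]`.
  set cl : ℝ → ℝ := fun x => max a (min x b) with hcl
  have hclm : ∀ x, cl x ∈ Icc a b := fun x => ⟨le_max_left _ _, max_le hab (min_le_right _ _)⟩
  have hcll : ∀ x y, |cl x - cl y| ≤ |x - y| := fun x y =>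
    (abs_max_sub_max_le_max a (min x b) a (min y b)).trans (by
      rw [sub_self, abs_zero, max_eq_right (abs_nonneg _)]
      exact (abs_min_sub_min_le_max x b y b).trans (by simp))
  set G : ℝ → ℝ := fun x => M * cl x - cl x ^ 2 with hG
  have hGc : Continuous G := by simp only [hG, hcl]; fun_prop
  have hGm : ∀ x, G x ∈ Icc (M * a - a ^ 2) (M * b - b ^ 2) := fun x => by
    obtain ⟨h1, h2⟩ := hclm x
    constructor
    · simp only [hG, hM]; nlinarith
    · simp only [hG, hM]; nlinarith
  have hGl : ∀ x y, |G x - G y| ≤ (M - 2 * a) * |x - y| := fun x y => by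
    obtain ⟨h1, h2⟩ := hclm x
    obtain ⟨h3, h4⟩ := hclm y
    have e : G x - G y = (M - (cl x + cl y)) * (cl x - cl y) := by simp only [hG]; ring
    rw [e, abs_mul, abs_of_nonneg (by rw [hM]; linarith)]
    exact mul_le_mul (by linarith) (hcll x y) (abs_nonneg _) (by rw [hM]; linarith)
  set w : (ℝ →ᵇ ℝ) → ℝ → ℝ := fun ψ s => q s + G (ψ s) with hw
  have hwc : ∀ ψ, Continuous (w ψ) := fun ψ => hq.add (hGc.comp ψ.continuous)
  have hwm : ∀ ψ s, w ψ s ∈ Icc (M * a) (M * b) := fun ψ s => by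
    have h1 := hGm (ψ s)
    have h2 := hqa s
    have h3 := hqb s
    exact ⟨by simp only [hw]; linarith [h1.1], by simp only [hw]; linarith [h1.2]⟩
  have hwb : ∀ ψ s, |w ψ s| ≤ M * b := fun ψ s => by
    have h := hwm ψ s
    rw [abs_of_nonneg (le_trans (by positivity) h.1)]
    exact h.2
  have hTm : ∀ ψ s, forwardLaplace M (w ψ) s ∈ Icc a b := fun ψ s => by
    have := forwardLaplace_mem_Icc hM0 (hwc ψ) (hwm ψ) s
    rwa [mul_div_cancel_left₀ _ hM0.ne', mul_div_cancel_left₀ _ hM0.ne'] at this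
  have hTd : ∀ ψ s, HasDerivAt (forwardLaplace M (w ψ))
      (M * forwardLaplace M (w ψ) s - w ψ s) s :=
    fun ψ s => hasDerivAt_forwardLaplace hM0 (hwc ψ) (hwb ψ) s
  have hTc : ∀ ψ, Continuous (forwardLaplace M (w ψ)) := fun ψ =>
    continuous_iff_continuousAt.2 fun s => (hTd ψ s).continuousAt
  set Φ : (ℝ →ᵇ ℝ) → (ℝ →ᵇ ℝ) := fun ψ =>
    BoundedContinuousFunction.ofNormedAddCommGroup (forwardLaplace M (w ψ)) (hTc ψ) b
      (fun s => by
        have := hTm ψ s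
        rw [Real.norm_of_nonneg (ha.le.trans this.1)]
        exact this.2) with hΦ
  have hK1 : (M - 2 * a) / M < 1 := by rw [div_lt_one hM0]; linarith
  have hK0 : 0 ≤ (M - 2 * a) / M := div_nonneg (by rw [hM]; linarith) hM0.le
  have hcon : ContractingWith ⟨(M - 2 * a) / M, hK0⟩ Φ := by
    refine ⟨by exact_mod_cast hK1, LipschitzWith.of_dist_le_mul fun ψ ψ' => ?_⟩
    rw [BoundedContinuousFunction.dist_le (by positivity)]
    intro s
    change |forwardLaplace M (w ψ) s - forwardLaplace M (w ψ') s| ≤ (M - 2 * a) / M * dist ψ ψ'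
    rw [forwardLaplace_sub hM0 (hwc ψ) (hwb ψ) (hwc ψ') (hwb ψ')]
    have h1 : ∀ r, w ψ r - w ψ' r ∈
        Icc (-((M - 2 * a) * dist ψ ψ')) ((M - 2 * a) * dist ψ ψ') := fun r => by
      refine abs_le.1 ?_
      have e : w ψ r - w ψ' r = G (ψ r) - G (ψ' r) := by simp only [hw]; ring
      rw [e]
      exact (hGl _ _).trans (mul_le_mul_of_nonneg_left
        (BoundedContinuousFunction.dist_coe_le_dist (f := ψ) (g := ψ') r) (by rw [hM]; linarith))
    have h2 := forwardLaplace_mem_Icc hM0 ((hwc ψ).sub (hwc ψ')) h1 s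
    rw [abs_le]
    refine ⟨le_trans (le_of_eq ?_) h2.1, h2.2.trans (le_of_eq ?_)⟩ <;> ring
  set ψ := ContractingWith.fixedPoint Φ hcon
  have hfix : Φ ψ = ψ := hcon.fixedPoint_isFixedPt
  have hψ : ∀ s, ψ s = forwardLaplace M (w ψ) s := fun s => by
    conv_lhs => rw [← hfix]
    rfl
  have hψm : ∀ s, ψ s ∈ Icc a b := fun s => by rw [hψ]; exact hTm ψ s
  refine ⟨ψ, fun s => ?_, hψm⟩
  have h1 := hTd ψ s
  rw [← funext hψ] at h1
  refine h1.congr_deriv ?_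
  have h2 : cl (ψ s) = ψ s := by
    simp only [hcl]
    rw [min_eq_left (hψm s).2, max_eq_right (hψm s).1]
  simp only [hw, hG, h2]
  ring

/-- A bounded positive solution of `ψ' = ψ² - q` is bounded below near `±∞` as soon as `q` is. -/
lemma riccati_eventually_ge {ψ : ℝ → ℝ} (hψ : ∀ s, HasDerivAt ψ (ψ s ^ 2 - q s) s)
    (hψm : ∀ s, ψ s ∈ Icc a b) (ha : 0 < a) {c d : ℝ} (hc : 0 < c) (hd : 0 < d) :
    ((∀ᶠ s in atTop, c ^ 2 + d ≤ q s) → ∀ᶠ s in atTop, c ≤ ψ s) ∧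
    ((∀ᶠ s in atBot, c ^ 2 + d ≤ q s) → ∀ᶠ s in atBot, c ≤ ψ s) := by
  -- Once `ψ` is below `c` in a region where `q ≥ c² + d`, it keeps decreasing at rate at least `d`.
  -- After a time `c / d` it would be negative, which positivity forbids.
  have key : ∀ s₀ s₁, s₀ ≤ s₁ → (∀ s ∈ Icc s₀ s₁, c ^ 2 + d ≤ q s) → ψ s₀ < c →
      ψ s₁ ≤ ψ s₀ - d * (s₁ - s₀) := by
    intro s₀ s₁ h01 hq hlt
    have h := image_le_of_deriv_right_lt_deriv_boundary' (f := ψ) (f' := fun s => ψ s ^ 2 - q s)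
      (a := s₀) (b := s₁) (fun s _ => (hψ s).continuousAt.continuousWithinAt)
      (fun s _ => (hψ s).hasDerivWithinAt)
      (B := fun s => ψ s₀ - d * (s - s₀)) (B' := fun _ => -d) (by simp) (by fun_prop)
      (fun s _ => by
        have : HasDerivAt (fun s => ψ s₀ - d * (s - s₀)) (-d) s := by
          simpa using (((hasDerivAt_id s).sub_const s₀).const_mul d).const_sub (ψ s₀)
        exact this.hasDerivWithinAt)
      (fun s hs he => by
        have h1 := hq s ⟨hs.1, hs.2.le⟩
        have h2 : ψ s < c := by
          rw [he]
          have : 0 ≤ d * (s - s₀) := mul_nonneg hd.le (sub_nonneg.2 hs.1)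
          linarith
        have h3 := (hψm s).1
        nlinarith)
    exact h ⟨h01, le_rfl⟩
  constructor
  · intro hq
    obtain ⟨L, hL⟩ := eventually_atTop.1 hq
    refine eventually_atTop.2 ⟨L, fun s hs => ?_⟩
    by_contra! hlt
    have h1 := key s (s + c / d) (by linarith [div_pos hc hd]) (fun r hr => hL r (hs.trans hr.1)) hlt
    have h2 := (hψm (s + c / d)).1
    have h3 : d * (s + c / d - s) = c := by field_simp; ring
    linarith
  · intro hq
    obtain ⟨L, hL⟩ := eventually_atBot.1 hq
    -- The comparison runs forward in `s` at both ends, so near `-∞` room of length `c / d` is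
    -- reserved before `L`.
    refine eventually_atBot.2 ⟨L - c / d, fun s hs => ?_⟩
    by_contra! hlt
    have h0 := div_pos hc hd
    have h1 := key s (s + c / d) (by linarith) (fun r hr => hL r (hr.2.trans (by linarith))) hlt
    have h2 := (hψm (s + c / d)).1
    have h3 : d * (s + c / d - s) = c := by field_simp; ring
    linarith

end Riccati

lemma _root_.MeasureTheory.MemLp.bdd_smul' {α F : Type*} [MeasurableSpace α]
    [NormedAddCommGroup F] [NormedSpace ℝ F] {μ : Measure α} {f : α → F} (hf : MemLp f 2 μ)
    {a : α → ℝ} (ha : AEStronglyMeasurable a μ) {C : ℝ} (hC : ∀ x, |a x| ≤ C) :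
    MemLp (fun x => a x • f x) 2 μ :=
  hf.smul (memLp_top_of_bound ha C (Eventually.of_forall hC))

/-- If `y' = ψ y + R` and `H' = -ψ H + y`, then `H'' = (ψ² - ψ') H + R = q H + R`. The lower bound
on `q` near both ends makes `ψ ≥ c > δ` there, so the first equation is expanding and the second
contracting. -/
lemma exists_second_order_solution {a b c d δ B : ℝ} {q ρ R : ℝ → ℝ} (ha : 0 < a) (hab : a ≤ b)
    (hq : Continuous q) (hqa : ∀ s, a ^ 2 ≤ q s) (hqb : ∀ s, q s ≤ b ^ 2)
    (hδ : 0 < δ) (hc : δ < c) (hd : 0 < d)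
    (htop : ∀ᶠ s in atTop, c ^ 2 + d ≤ q s) (hbot : ∀ᶠ s in atBot, c ^ 2 + d ≤ q s)
    (hρ : Continuous ρ) (hρ0 : ∀ s, 0 < ρ s)
    (hB : ∀ s, |Real.log (ρ s) + δ * (|s|)| ≤ B) (hR : MemLp (fun s => ρ s • R s) 2) :
    ∃ H H₁ : ℝ → ℝ, WeakDeriv H H₁ ∧ WeakDeriv H₁ (fun s => q s * H s + R s) ∧
      MemLp (fun s => ρ s • H s) 2 ∧ MemLp (fun s => ρ s • H₁ s) 2 := by
  obtain ⟨ψ, hψ, hψm⟩ := exists_riccati ha hab hq hqa hqb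
  obtain ⟨h1, h2⟩ := riccati_eventually_ge hψ hψm ha (hδ.trans hc) hd
  have hψc : Continuous ψ := continuous_iff_continuousAt.2 fun s => (hψ s).continuousAt
  have hψ1 : ContDiff ℝ 1 ψ := contDiff_one_iff_deriv.2
    ⟨fun s => (hψ s).differentiableAt, by rw [funext fun s => (hψ s).deriv]; fun_prop⟩
  obtain ⟨A, hA, h3⟩ := integral_ge_of_eventually_nonneg (θ := fun s => ψ s - c) (by fun_prop)
    ((h1 htop).mono fun s hs => sub_nonneg.2 hs) ((h2 hbot).mono fun s hs => sub_nonneg.2 hs)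
  have h4 : ∀ s r, s ≤ r → c * (r - s) - A ≤ ∫ x in s..r, ψ x := fun s r hsr => by
    have := h3 s r hsr
    rw [intervalIntegral.integral_sub (hψc.intervalIntegrable _ _)
      (continuous_const.intervalIntegrable _ _), intervalIntegral.integral_const,
      smul_eq_mul] at this
    linarith
  obtain ⟨y, y1, y2, -⟩ := exists_solution_of_expanding hψc hρ hρ0 hδ hB hc h4 hR
  obtain ⟨H, H1, H2, -⟩ := exists_solution_of_contracting (σ := fun s => -ψ s) hψc.neg hρ hρ0 hδ hB
    hc (fun s r hsr => by
      have := h4 s r hsr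
      rw [intervalIntegral.integral_neg]
      linarith) y2
  refine ⟨H, _, H1, ?_, H2, ?_⟩
  · refine ((H1.smul (a := fun s => -ψ s) hψ1.neg).add y1).congr_ae
      (Eventually.of_forall fun s => rfl) (Eventually.of_forall fun s => ?_)
    have : deriv (fun s => -ψ s) s = -(ψ s ^ 2 - q s) := (hψ s).neg.deriv
    simp only [this, smul_eq_mul]
    ring
  · have h5 := (H2.bdd_smul' (a := fun s => -ψ s) hψc.neg.aestronglyMeasurable (C := b) (fun s => by
      rw [abs_neg, abs_of_pos (ha.trans_le (hψm s).1)]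
      exact (hψm s).2)).add y2
    refine h5.congr_norm (h5.1.congr (Eventually.of_forall fun s => ?_))
      (Eventually.of_forall fun s => ?_)
    · simp only [smul_eq_mul, Pi.add_apply]; ring
    · simp only [smul_eq_mul, Pi.add_apply]; congr 1; ring

end Vortex

/-! ### Smooth calculus and Fourier coefficients on the cylinder -/

namespace Vortex

open Filter Topology Set

variable {E : Type*} [NormedAddCommGroup E] [NormedSpace ℝ E]

section SmoothCyl

lemma isOpenQuotientMap_cover :
    IsOpenQuotientMap (fun p : ℝ × ℝ => ((p.1, (p.2 : Circ)) : Cyl)) :=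
  IsOpenQuotientMap.id.prodMap QuotientAddGroup.isOpenQuotientMap_mk

lemma SmoothCyl.continuous {f : Cyl → E} (hf : SmoothCyl f) : Continuous f :=
  isOpenQuotientMap_cover.isQuotientMap.continuous_iff.2 (ContDiff.continuous hf)

lemma dS_coe {f : Cyl → E} (hf : SmoothCyl f) (s t : ℝ) :
    HasDerivAt (fun σ => f (σ, (t : Circ)))
      (fderiv ℝ (fun p : ℝ × ℝ => f (p.1, (p.2 : Circ))) (s, t) (1, 0)) s := by
  have h1 := (ContDiff.differentiable hf (by simp) (s, t)).hasFDerivAt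
  have h2 : HasDerivAt (fun σ : ℝ => ((σ, t) : ℝ × ℝ)) (1, 0) s :=
    (hasDerivAt_id s).prodMk (hasDerivAt_const s t)
  exact h1.comp_hasDerivAt s h2

lemma dT_coe {f : Cyl → E} (hf : SmoothCyl f) (s t : ℝ) :
    HasDerivAt (fun τ : ℝ => f (s, (τ : Circ)))
      (fderiv ℝ (fun p : ℝ × ℝ => f (p.1, (p.2 : Circ))) (s, t) (0, 1)) t := by
  have h1 := (ContDiff.differentiable hf (by simp) (s, t)).hasFDerivAt
  have h2 : HasDerivAt (fun τ : ℝ => ((s, τ) : ℝ × ℝ)) (0, 1) t :=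
    (hasDerivAt_const t s).prodMk (hasDerivAt_id t)
  exact h1.comp_hasDerivAt t h2

lemma dS_eq_fderiv {f : Cyl → E} (hf : SmoothCyl f) (s t : ℝ) :
    dS f (s, (t : Circ)) = fderiv ℝ (fun p : ℝ × ℝ => f (p.1, (p.2 : Circ))) (s, t) (1, 0) :=
  (dS_coe hf s t).deriv

lemma hasDerivAt_dT_coe {f : Cyl → E} (hf : SmoothCyl f) (s t τ : ℝ) :
    HasDerivAt (fun τ : ℝ => f (s, (t : Circ) + (τ : Circ)))
      (fderiv ℝ (fun p : ℝ × ℝ => f (p.1, (p.2 : Circ))) (s, t + τ) (0, 1)) τ := by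
  have h := (dT_coe hf s (t + τ)).comp_const_add t τ
  simpa only [AddCircle.coe_add] using h

lemma dT_eq_fderiv {f : Cyl → E} (hf : SmoothCyl f) (s t : ℝ) :
    dT f (s, (t : Circ)) = fderiv ℝ (fun p : ℝ × ℝ => f (p.1, (p.2 : Circ))) (s, t) (0, 1) := by
  have := (hasDerivAt_dT_coe hf s t 0).deriv
  rwa [add_zero] at this

lemma SmoothCyl.dS {f : Cyl → E} (hf : SmoothCyl f) : SmoothCyl (dS f) := by
  rw [SmoothCyl, funext fun p : ℝ × ℝ => dS_eq_fderiv hf p.1 p.2]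
  exact (ContDiff.fderiv_right (m := ∞) hf (by simp)).clm_apply contDiff_const

lemma SmoothCyl.dT {f : Cyl → E} (hf : SmoothCyl f) : SmoothCyl (dT f) := by
  rw [SmoothCyl, funext fun p : ℝ × ℝ => dT_eq_fderiv hf p.1 p.2]
  exact (ContDiff.fderiv_right (m := ∞) hf (by simp)).clm_apply contDiff_const

lemma SmoothCyl.hasDerivAt_dS {f : Cyl → E} (hf : SmoothCyl f) (s : ℝ) (t : Circ) :
    HasDerivAt (fun σ => f (σ, t)) (Vortex.dS f (s, t)) s := by
  induction t using QuotientAddGroup.induction_on with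
  | H t =>
    have := dS_coe hf s t
    rwa [← dS_eq_fderiv hf] at this

lemma SmoothCyl.hasDerivAt_dT_coe {f : Cyl → E} (hf : SmoothCyl f) (s t : ℝ) :
    HasDerivAt (fun τ : ℝ => f (s, (τ : Circ))) (Vortex.dT f (s, (t : Circ))) t := by
  rw [dT_eq_fderiv hf]
  exact dT_coe hf s t

lemma SmoothCyl.hasDerivAt_dT {f : Cyl → E} (hf : SmoothCyl f) (s : ℝ) (t : Circ) :
    HasDerivAt (fun τ : ℝ => f (s, t + (τ : Circ))) (Vortex.dT f (s, t)) 0 := by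
  induction t using QuotientAddGroup.induction_on with
  | H t =>
    have := Vortex.hasDerivAt_dT_coe hf s t 0
    rwa [add_zero, ← dT_eq_fderiv hf] at this

lemma SmoothCyl.contDiff_left {f : Cyl → E} (hf : SmoothCyl f) (t : Circ) :
    ContDiff ℝ ∞ fun s => f (s, t) := by
  induction t using QuotientAddGroup.induction_on with
  | H t =>
    have hf' : ContDiff ℝ ∞ (fun p : ℝ × ℝ => f (p.1, (p.2 : Circ))) := hf
    exact hf'.comp (contDiff_id.prodMk (contDiff_const (c := t)))

lemma SmoothCyl.hasDerivAt_integral {f : Cyl → E} (hf : SmoothCyl f) (s : ℝ) :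
    HasDerivAt (fun s => ∫ t : Circ, f (s, t)) (∫ t : Circ, Vortex.dS f (s, t)) s := by
  obtain ⟨C, hC⟩ := ((isCompact_closedBall s 1).prod (isCompact_univ (X := Circ))
    ).exists_bound_of_continuousOn hf.dS.continuous.continuousOn
  have hcont : ∀ s, Continuous fun t : Circ => f (s, t) := fun s =>
    hf.continuous.comp (Continuous.prodMk_right s)
  have hcont' : ∀ s, Continuous fun t : Circ => Vortex.dS f (s, t) := fun s =>
    hf.dS.continuous.comp (Continuous.prodMk_right s)
  refine (hasDerivAt_integral_of_dominated_loc_of_deriv_le (bound := fun _ => C)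
    (F' := fun s t => Vortex.dS f (s, t))
    (Metric.closedBall_mem_nhds s one_pos)
    (Eventually.of_forall fun s => (hcont s).aestronglyMeasurable)
    ((hcont s).integrable_of_hasCompactSupport (HasCompactSupport.of_compactSpace _))
    (hcont' s).aestronglyMeasurable
    (Eventually.of_forall fun t x hx => hC (x, t) ⟨hx, mem_univ _⟩)
    (integrable_const C)
    (Eventually.of_forall fun t x _ => hf.hasDerivAt_dS x t)).2

lemma SmoothCyl.continuous_integral {f : Cyl → E} (hf : SmoothCyl f) :
    Continuous fun s => ∫ t : Circ, f (s, t) :=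
  continuous_iff_continuousAt.2 fun s => (hf.hasDerivAt_integral s).continuousAt

lemma SmoothCyl.integral_dT [CompleteSpace E] {f : Cyl → E} (hf : SmoothCyl f) (s : ℝ) :
    ∫ t : Circ, Vortex.dT f (s, t) = 0 := by
  rw [← UnitAddCircle.intervalIntegral_preimage 0]
  rw [intervalIntegral.integral_eq_sub_of_hasDerivAt (fun t _ => hf.hasDerivAt_dT_coe s t)]
  · have : ((0 + 1 : ℝ) : Circ) = ((0 : ℝ) : Circ) := by
      rw [AddCircle.coe_add, AddCircle.coe_period, add_zero]
    rw [this, sub_self]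
  · refine Continuous.intervalIntegrable ?_ _ _
    exact hf.dT.continuous.comp (continuous_const.prodMk (AddCircle.continuous_mk' 1))

end SmoothCyl

section Fourier

lemma haarAddCircle_eq_volume :
    (AddCircle.haarAddCircle : Measure Circ) = volume := by
  have := AddCircle.volume_eq_smul_haarAddCircle (T := 1)
  simpa using this.symm

lemma fourier_coe (k : ℤ) (t : ℝ) :
    (fourier k : C(Circ, ℂ)) (t : Circ) = Complex.exp (2 * Real.pi * Complex.I * k * t) := by
  rw [fourier_coe_apply]; simp

lemma norm_fourier_apply (k : ℤ) (t : Circ) : ‖(fourier k : C(Circ, ℂ)) t‖ = 1 :=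
  Circle.norm_coe _

lemma smoothCyl_fourier (k : ℤ) : SmoothCyl fun p : Cyl => (fourier k : C(Circ, ℂ)) p.2 := by
  simp only [SmoothCyl, fourier_coe]
  have : ContDiff ℝ ∞ fun p : ℝ × ℝ => (p.2 : ℂ) := Complex.ofRealCLM.contDiff.comp contDiff_snd
  exact (contDiff_const.mul this).cexp

lemma dT_fourier (k : ℤ) (p : Cyl) :
    dT (fun p : Cyl => (fourier k : C(Circ, ℂ)) p.2) p
      = 2 * Real.pi * Complex.I * k * (fourier k : C(Circ, ℂ)) p.2 := by
  obtain ⟨s, t⟩ := p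
  induction t using QuotientAddGroup.induction_on with
  | H t =>
    have h1 := (smoothCyl_fourier k).hasDerivAt_dT_coe s t
    have h2 := hasDerivAt_fourier (T := 1) k t
    have h3 := h1.unique h2
    rw [h3]
    simp

lemma dS_fourier (k : ℤ) (p : Cyl) :
    dS (fun p : Cyl => (fourier k : C(Circ, ℂ)) p.2) p = 0 := by
  simp [dS]

lemma SmoothCyl.mul {f g : Cyl → ℂ} (hf : SmoothCyl f) (hg : SmoothCyl g) :
    SmoothCyl fun p => f p * g p := ContDiff.mul hf hg

lemma SmoothCyl.dS_mul {f g : Cyl → ℂ} (hf : SmoothCyl f) (hg : SmoothCyl g) (p : Cyl) :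
    Vortex.dS (fun p => f p * g p) p = Vortex.dS f p * g p + f p * Vortex.dS g p :=
  ((hf.hasDerivAt_dS p.1 p.2).mul (hg.hasDerivAt_dS p.1 p.2)).deriv

lemma SmoothCyl.dT_mul {f g : Cyl → ℂ} (hf : SmoothCyl f) (hg : SmoothCyl g) (p : Cyl) :
    Vortex.dT (fun p => f p * g p) p = Vortex.dT f p * g p + f p * Vortex.dT g p := by
  refine ((hf.hasDerivAt_dT p.1 p.2).mul (hg.hasDerivAt_dT p.1 p.2)).deriv.trans ?_
  simp

lemma fourierCoeff_eq (g : Circ → ℂ) (k : ℤ) :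
    fourierCoeff g k = ∫ t : Circ, (fourier (-k) : C(Circ, ℂ)) t * g t := by
  rw [fourierCoeff, haarAddCircle_eq_volume]; rfl

lemma hasSum_sq_fourierCoeff' {g : Circ → ℂ} (hg : MemLp g 2) :
    HasSum (fun k => ‖fourierCoeff g k‖ ^ 2) (∫ t, ‖g t‖ ^ 2) := by
  have hg' : MemLp g 2 (AddCircle.haarAddCircle : Measure Circ) := by
    rwa [haarAddCircle_eq_volume]
  have h := hasSum_sq_fourierCoeff hg'.toLp
  have e : (hg'.toLp : Circ → ℂ) =ᵐ[AddCircle.haarAddCircle] g := hg'.coeFn_toLp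
  simp_rw [fourierCoeff_congr_ae e] at h
  have e2 : ∫ t, ‖(hg'.toLp : Circ → ℂ) t‖ ^ 2 ∂AddCircle.haarAddCircle
      = ∫ t, ‖g t‖ ^ 2 ∂AddCircle.haarAddCircle :=
    integral_congr_ae (e.mono fun t ht => by simp only [ht])
  rwa [e2, haarAddCircle_eq_volume] at h

lemma SmoothCyl.memLp_slice {f : Cyl → ℂ} (hf : SmoothCyl f) (s : ℝ) :
    MemLp (fun t : Circ => f (s, t)) 2 := by
  have hc : Continuous fun t : Circ => f (s, t) := hf.continuous.comp (Continuous.prodMk_right s)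
  exact hc.memLp_of_hasCompactSupport (HasCompactSupport.of_compactSpace _)

/-- The integral over the circle of `∂ₜ (exp(-2πikt) f)` vanishes by periodicity. -/
lemma fourierCoeff_dT {f : Cyl → ℂ} (hf : SmoothCyl f) (s : ℝ) (k : ℤ) :
    fourierCoeff (fun t => dT f (s, t)) k
      = 2 * Real.pi * Complex.I * k * fourierCoeff (fun t => f (s, t)) k := by
  have h := ((smoothCyl_fourier (-k)).mul hf).integral_dT s
  simp_rw [(smoothCyl_fourier (-k)).dT_mul hf, dT_fourier] at h
  have hc : ∀ {g : Cyl → ℂ}, SmoothCyl g → Integrable fun t : Circ => g (s, t) := fun hg =>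
    (hg.memLp_slice s).integrable one_le_two
  have i1 := (hc ((smoothCyl_fourier (-k)).mul hf)).const_mul
    (2 * Real.pi * Complex.I * ((-k : ℤ) : ℂ))
  have i2 := hc ((smoothCyl_fourier (-k)).mul hf.dT)
  simp_rw [mul_assoc _ ((fourier (-k) : C(Circ, ℂ)) _)] at h
  rw [integral_add i1 i2, integral_const_mul, ← fourierCoeff_eq, ← fourierCoeff_eq] at h
  push_cast at h
  linear_combination h

lemma hasDerivAt_fourierCoeff_slice {f : Cyl → ℂ} (hf : SmoothCyl f) (s : ℝ) (k : ℤ) :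
    HasDerivAt (fun s => fourierCoeff (fun t => f (s, t)) k)
      (fourierCoeff (fun t => dS f (s, t)) k) s := by
  have h := ((smoothCyl_fourier (-k)).mul hf).hasDerivAt_integral s
  simp_rw [(smoothCyl_fourier (-k)).dS_mul hf, dS_fourier, zero_mul, zero_add] at h
  simp_rw [fourierCoeff_eq]
  exact h

end Fourier

end Vortex

/-! ### Asymptotics of the modes of a finite-energy vortex -/

namespace Vortex

open Filter Topology Set

lemma eq_exp_smul_of_hasDerivAt {η : ℝ → ℝ} {y : ℝ → ℂ} (hη : Continuous η) (k : ℤ)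
    (hy : ∀ s, HasDerivAt y ((2 * Real.pi * (k + η s) : ℝ) • y s) s) (s : ℝ) :
    y s = Real.exp (∫ r in (0 : ℝ)..s, 2 * Real.pi * (k + η r)) • y 0 := by
  set S : ℝ → ℝ := fun s => ∫ r in (0 : ℝ)..s, 2 * Real.pi * (k + η r) with hS
  have hSd : ∀ s, HasDerivAt S (2 * Real.pi * (k + η s)) s := fun s =>
    ((by fun_prop : Continuous fun r => 2 * Real.pi * (k + η r)).integral_hasStrictDerivAt
      0 s).hasDerivAt
  have hd : ∀ s, HasDerivAt (fun s => Real.exp (-S s) • y s) 0 s := fun s => by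
    refine ((hSd s).neg.exp.smul (hy s)).congr_deriv ?_
    rw [smul_smul, ← add_smul]
    ring_nf
    simp
  have h1 := is_const_of_deriv_eq_zero (fun s => (hd s).differentiableAt)
    (fun s => (hd s).deriv) s 0
  have hS0 : S 0 = 0 := by simp [hS]
  simp only [hS0, neg_zero, Real.exp_zero, one_smul] at h1
  rw [← h1, smul_smul, ← Real.exp_add, add_neg_cancel, Real.exp_zero, one_smul]

/-- The Fourier modes `c k`, the mass `N = ∫ |u|² dt` and the energy density `D = ∫ |∂ₛ u|² dt`
of a vortex, as functions of `s`. -/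
structure ModeData (c : ℤ → ℝ → ℂ) (η N N' D : ℝ → ℝ) : Prop where
  deriv_c : ∀ k s, HasDerivAt (c k) ((2 * Real.pi * (k + η s) : ℝ) • c k s) s
  deriv_η : ∀ s, HasDerivAt η (Real.pi * (N s - 1)) s
  deriv_N : ∀ s, HasDerivAt N (N' s) s
  continuous_N' : Continuous N'
  bound_N' : ∀ s l, 0 < l → |N' s| ≤ l * N s + l⁻¹ * D s
  hasSum_N : ∀ s, HasSum (fun k => ‖c k s‖ ^ 2) (N s)
  hasSum_D : ∀ s, HasSum (fun k : ℤ => (2 * Real.pi * (k + η s)) ^ 2 * ‖c k s‖ ^ 2) (D s)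
  integrable_D : Integrable D
  integrable_η : Integrable fun s => (N s - 1) ^ 2
  ne_zero : ∃ k, c k 0 ≠ 0

namespace ModeData

variable {c : ℤ → ℝ → ℂ} {η N N' D : ℝ → ℝ}

/-- The substitution `s ↦ -s`, `k ↦ -k`, `η ↦ -η` preserves the structure, so statements at `-∞`
follow from those at `+∞`. -/
lemma reflect (h : ModeData c η N N' D) : ModeData (fun k s => c (-k) (-s)) (fun s => -η (-s))
    (fun s => N (-s)) (fun s => -N' (-s)) (fun s => D (-s)) where
  deriv_c k s := by
    have := (h.deriv_c (-k) (-s)).scomp s (hasDerivAt_neg s)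
    refine this.congr_deriv ?_
    rw [smul_smul]
    congr 1; push_cast; ring
  deriv_η s := by
    have := ((h.deriv_η (-s)).scomp s (hasDerivAt_neg s)).neg
    refine this.congr_deriv ?_
    simp
  deriv_N s := by
    have := (h.deriv_N (-s)).scomp s (hasDerivAt_neg s)
    refine this.congr_deriv ?_
    simp
  continuous_N' := (h.continuous_N'.comp continuous_neg).neg
  bound_N' s l hl := by rw [abs_neg]; exact h.bound_N' (-s) l hl
  hasSum_N s := (Equiv.neg ℤ).hasSum_iff.2 (h.hasSum_N (-s))
  hasSum_D s := by
    have := (Equiv.neg ℤ).hasSum_iff.2 (h.hasSum_D (-s))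
    convert this using 2 with k
    simp only [Function.comp_apply, Equiv.neg_apply]
    push_cast
    ring
  integrable_D := h.integrable_D.comp_neg
  integrable_η := h.integrable_η.comp_neg
  ne_zero := by
    obtain ⟨k, hk⟩ := h.ne_zero
    exact ⟨-k, by simpa using hk⟩

lemma continuous_η (h : ModeData c η N N' D) : Continuous η :=
  continuous_iff_continuousAt.2 fun s => (h.deriv_η s).continuousAt

lemma continuous_N (h : ModeData c η N N' D) : Continuous N :=
  continuous_iff_continuousAt.2 fun s => (h.deriv_N s).continuousAt

lemma mode_eq (h : ModeData c η N N' D) (k : ℤ) (s : ℝ) :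
    c k s = Real.exp (∫ r in (0 : ℝ)..s, 2 * Real.pi * (k + η r)) • c k 0 :=
  eq_exp_smul_of_hasDerivAt h.continuous_η k (h.deriv_c k) s

lemma mode_eq_zero_iff (h : ModeData c η N N' D) (k : ℤ) (s : ℝ) : c k s = 0 ↔ c k 0 = 0 := by
  rw [h.mode_eq k s, smul_eq_zero, or_iff_right (Real.exp_pos _).ne']

lemma sq_norm_le (h : ModeData c η N N' D) (k : ℤ) (s : ℝ) : ‖c k s‖ ^ 2 ≤ N s :=
  le_hasSum (h.hasSum_N s) k fun _ _ => by positivity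

lemma N_pos (h : ModeData c η N N' D) (s : ℝ) : 0 < N s := by
  obtain ⟨k, hk⟩ := h.ne_zero
  refine lt_of_lt_of_le ?_ (h.sq_norm_le k s)
  have : c k s ≠ 0 := fun h0 => hk ((h.mode_eq_zero_iff k s).1 h0)
  positivity

lemma D_nonneg (h : ModeData c η N N' D) (s : ℝ) : 0 ≤ D s :=
  (h.hasSum_D s).nonneg fun _ => by positivity

/-- Both `F = (√N - 1)²` and its derivative are integrable, so `F → 0`. The square root is
essential, since `N` is not yet known to be bounded: `|F'|` is at most `F + D`, whereas
differentiating `(N - 1)²` would leave an uncontrolled power of `N`. -/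
lemma tendsto_N (h : ModeData c η N N' D) : Tendsto N atTop (𝓝 1) := by
  set F : ℝ → ℝ := fun s => (√(N s) - 1) ^ 2 with hF
  set F' : ℝ → ℝ := fun s => 2 * (√(N s) - 1) * (N' s / (2 * √(N s))) with hF'
  have hNc := h.continuous_N
  have hN'c := h.continuous_N'
  have hr : ∀ s, 0 < √(N s) := fun s => Real.sqrt_pos.2 (h.N_pos s)
  have hFd : ∀ s, HasDerivAt F (F' s) s := fun s => by
    have := (((h.deriv_N s).sqrt (h.N_pos s).ne').sub_const 1).pow 2
    refine this.congr_deriv ?_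
    simp [hF']
  have hFle : ∀ s, F s ≤ (N s - 1) ^ 2 := fun s => by
    have e : N s - 1 = (√(N s) - 1) * (√(N s) + 1) := by
      nlinarith [Real.mul_self_sqrt (h.N_pos s).le]
    rw [e, mul_pow]
    have : 1 ≤ (√(N s) + 1) ^ 2 := by nlinarith [hr s]
    exact le_mul_of_one_le_right (sq_nonneg _) this
  have hFi : Integrable F := h.integrable_η.mono' (by fun_prop)
    (Eventually.of_forall fun s => by rw [Real.norm_of_nonneg (sq_nonneg _)]; exact hFle s)
  have hF'c : Continuous F' := by
    have : ∀ s, 2 * √(N s) ≠ 0 := fun s => by have := hr s; positivity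
    fun_prop (disch := assumption)
  have hF'i : Integrable F' := by
    refine (hFi.add h.integrable_D).mono' hF'c.aestronglyMeasurable
      (Eventually.of_forall fun s => ?_)
    have hrs := hr s
    have hD := h.D_nonneg s
    rw [Real.norm_eq_abs]
    simp only [Pi.add_apply, hF, hF']
    rcases eq_or_ne (√(N s)) 1 with h1 | h1
    · rw [h1]; simpa using hD
    · have hp : 0 < |√(N s) - 1| := abs_pos.2 (sub_ne_zero.2 h1)
      -- This value of the free parameter turns the bound into exactly `(√N - 1)² + D`.
      have h2 := h.bound_N' s (|√(N s) - 1| / √(N s)) (by positivity)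
      have e : |2 * (√(N s) - 1) * (N' s / (2 * √(N s)))|
          = |√(N s) - 1| / √(N s) * |N' s| := by
        rw [abs_mul, abs_mul, abs_div, abs_mul, abs_of_pos hrs]
        norm_num
        field_simp
      rw [e]
      calc _ ≤ |√(N s) - 1| / √(N s) * (|√(N s) - 1| / √(N s) * N s
            + (|√(N s) - 1| / √(N s))⁻¹ * D s) := by gcongr
        _ = |√(N s) - 1| ^ 2 + D s := by
            have h3 := Real.sq_sqrt (h.N_pos s).le
            generalize √(N s) = r at *
            rw [← h3]
            field_simp
        _ = _ := by rw [sq_abs]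
  have h1 := tendsto_zero_of_hasDerivAt_of_integrableOn_Ioi (a := 0) (fun s _ => hFd s)
    hF'i.integrableOn hFi.integrableOn
  have h2 : Tendsto (fun s => √(N s) - 1) atTop (𝓝 0) := by
    rw [tendsto_zero_iff_abs_tendsto_zero]
    have := h1.sqrt
    simpa [hF, Real.sqrt_sq_eq_abs, Function.comp_def] using this
  have h3 : Tendsto (fun s => ((√(N s) - 1) + 1) ^ 2) atTop (𝓝 ((0 + 1) ^ 2)) :=
    (h2.add_const 1).pow 2
  simpa [Real.sq_sqrt (h.N_pos _).le] using h3

/-- The function `sin²(πx)` has period one, which gives a lower bound for the coefficients of all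
modes at once. -/
lemma sin_sq_le (x : ℝ) (k : ℤ) : Real.sin (Real.pi * x) ^ 2 ≤ (Real.pi * (k + x)) ^ 2 := by
  have e : Real.sin (Real.pi * (k + x)) ^ 2 = Real.sin (Real.pi * x) ^ 2 := by
    rw [mul_add, mul_comm Real.pi (k : ℝ), add_comm, Real.sin_add_int_mul_pi, mul_pow]
    rcases Int.even_or_odd k with hk | hk <;> simp [hk.neg_one_zpow]
  rw [← e]
  exact sq_le_sq.2 Real.abs_sin_le_abs

/-- Comparing the two Fourier sums term by term gives `4 sin²(πη) N ≤ D`. As `N` is eventually at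
least `1 / 2`, `sin²(πη)` is integrable near `+∞`. Its derivative is dominated by multiples of
`sin²(πη)` and `(N - 1)²`, so it tends to zero. -/
lemma tendsto_sin (h : ModeData c η N N' D) :
    Tendsto (fun s => Real.sin (Real.pi * η s) ^ 2) atTop (𝓝 0) := by
  obtain ⟨a, ha⟩ := eventually_atTop.1 (h.tendsto_N.eventually
    (lt_mem_nhds (by norm_num : (1 / 2 : ℝ) < 1)))
  have hη := h.continuous_η
  have hNc := h.continuous_N
  set G : ℝ → ℝ := fun s => Real.sin (Real.pi * η s) ^ 2 with hG
  have hGd : ∀ s, HasDerivAt G (2 * Real.sin (Real.pi * η s) *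
      (Real.cos (Real.pi * η s) * (Real.pi * (Real.pi * (N s - 1))))) s := fun s => by
    have := (((h.deriv_η s).const_mul Real.pi).sin).pow 2
    refine this.congr_deriv ?_
    simp
  have hGD : ∀ s, 4 * G s * N s ≤ D s := fun s => by
    refine hasSum_le (fun k => ?_) ((h.hasSum_N s).mul_left _) (h.hasSum_D s)
    refine mul_le_mul_of_nonneg_right ?_ (sq_nonneg _)
    have := sin_sq_le (η s) k
    simp only [hG]
    nlinarith
  have hGi : IntegrableOn G (Ioi a) := by
    refine (h.integrable_D.integrableOn (s := Ioi a)).mono' (by fun_prop) ?_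
    refine (ae_restrict_iff' measurableSet_Ioi).2 (Eventually.of_forall fun s hs => ?_)
    have h1 := hGD s
    have h2 := ha s (le_of_lt hs)
    have h3 : 0 ≤ G s := sq_nonneg _
    rw [Real.norm_of_nonneg h3]
    nlinarith
  refine tendsto_zero_of_hasDerivAt_of_integrableOn_Ioi (a := a) (fun s _ => hGd s) ?_ hGi
  refine ((hGi.const_mul (Real.pi ^ 2)).add
    ((h.integrable_η.const_mul (Real.pi ^ 2)).integrableOn (s := Ioi a))).mono' (by fun_prop) ?_
  refine Eventually.of_forall fun s => ?_
  have h1 : |Real.cos (Real.pi * η s)| ≤ 1 := Real.abs_cos_le_one _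
  simp only [Pi.add_apply, hG]
  rw [Real.norm_eq_abs, abs_mul, abs_mul, abs_mul, abs_mul, abs_mul, abs_two,
    abs_of_pos Real.pi_pos, ← sq_abs (Real.sin _), ← sq_abs (N s - 1)]
  have h2 := abs_nonneg (Real.sin (Real.pi * η s))
  have h3 := abs_nonneg (N s - 1)
  generalize |Real.sin (Real.pi * η s)| = x at *
  generalize |Real.cos (Real.pi * η s)| = y at *
  generalize |N s - 1| = z at *
  have h4 : x * z * y ≤ x * z := mul_le_of_le_one_right (mul_nonneg h2 h3) h1
  have h5 := Real.pi_pos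
  have h6 : Real.pi ^ 2 * (x * z * y) ≤ Real.pi ^ 2 * (x * z) := by gcongr
  nlinarith [mul_nonneg (sq_nonneg Real.pi) (sq_nonneg (x - z))]

lemma abs_le_of_sin_sq {x : ℝ} (hx : |x| ≤ 1 / 2) : |x| ≤ √(Real.sin (Real.pi * x) ^ 2) := by
  have hpi := Real.pi_pos
  rw [Real.sqrt_sq_eq_abs]
  have h1 : |Real.sin (Real.pi * x)| = Real.sin (Real.pi * |x|) := by
    rcases abs_cases x with ⟨h, h'⟩ | ⟨h, h'⟩
    · rw [h, abs_of_nonneg]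
      rw [h] at hx
      exact Real.sin_nonneg_of_nonneg_of_le_pi (by positivity) (by nlinarith)
    · rw [h, mul_neg, Real.sin_neg, abs_of_nonpos]
      rw [h] at hx
      exact Real.sin_nonpos_of_nonpos_of_neg_pi_le (by nlinarith) (by nlinarith)
  rw [h1]
  have h2 := Real.mul_le_sin (x := Real.pi * |x|) (by positivity) (by nlinarith)
  have e : 2 / Real.pi * (Real.pi * |x|) = 2 * |x| := by field_simp
  linarith [abs_nonneg x]

/-- A continuous function with `sin(π η) → 0` at `∞` converges to an integer. -/
lemma exists_tendsto_int {η : ℝ → ℝ} (hη : Continuous η)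
    (h : Tendsto (fun s => Real.sin (Real.pi * η s) ^ 2) atTop (𝓝 0)) :
    ∃ n : ℤ, Tendsto η atTop (𝓝 (-n)) := by
  obtain ⟨a, ha⟩ := eventually_atTop.1 (h.eventually (gt_mem_nhds one_pos))
  set c := round (η a) with hc
  have hsin : ∀ x : ℝ, Real.sin (Real.pi * (x - c)) ^ 2 = Real.sin (Real.pi * x) ^ 2 := fun x => by
    rw [mul_sub, mul_comm Real.pi (c : ℝ), Real.sin_sub_int_mul_pi, mul_pow]
    rcases Int.even_or_odd c with hk | hk <;> simp [hk.neg_one_zpow]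
  have hlt : ∀ s, a ≤ s → |η s - c| ≤ 1 / 2 := by
    intro s hs
    by_contra! hgt
    have hcont : ContinuousOn (fun s => |η s - c|) (Icc a s) := by fun_prop
    -- To move further than `1 / 2` away from the integer `c`, the function would have to pass
    -- through distance exactly `1 / 2`, where the squared sine equals `1`.
    obtain ⟨r, hr, hr2⟩ := intermediate_value_Icc hs hcont ⟨abs_sub_round (η a), hgt.le⟩
    have h1 := ha r hr.1
    rw [← hsin, ← sq_abs] at h1
    have h2 : |Real.sin (Real.pi * (η r - c))| = 1 := by
      rcases abs_cases (η r - c) with ⟨h3, -⟩ | ⟨h3, -⟩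
      · have h4 : η r - c = 1 / 2 := by rw [← h3]; exact hr2
        rw [h4, mul_one_div, Real.sin_pi_div_two, abs_one]
      · have h4 : η r - c = -(1 / 2) := by rw [← neg_eq_iff_eq_neg, ← h3]; exact hr2
        rw [h4, mul_neg, mul_one_div, Real.sin_neg, Real.sin_pi_div_two, abs_neg, abs_one]
    rw [h2] at h1
    norm_num at h1
  have hsq : Tendsto (fun s => |η s - c|) atTop (𝓝 0) := by
    have h1 := h.sqrt
    rw [Real.sqrt_zero] at h1
    refine squeeze_zero' (Eventually.of_forall fun _ => abs_nonneg _)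
      ((eventually_ge_atTop a).mono fun s hs => ?_) h1
    rw [← hsin]
    exact abs_le_of_sin_sq (hlt s hs)
  refine ⟨-c, ?_⟩
  have h2 := ((tendsto_zero_iff_abs_tendsto_zero _).2 hsq).add_const (c : ℝ)
  simpa using h2

/-- A nonzero mode with `k > n` would grow at least like `exp(πs)`, against `‖c k s‖² ≤ N s → 1`. If
mode `n` vanished as well, all remaining modes would have `k ≤ n - 1`; then `D ≥ π² N` near `+∞`,
and `D` would not be integrable. -/
lemma exists_limit_atTop (h : ModeData c η N N' D) :
    ∃ n : ℤ, Tendsto η atTop (𝓝 (-n)) ∧ c n 0 ≠ 0 ∧ ∀ k, n < k → c k 0 = 0 := by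
  obtain ⟨n, hn⟩ := exists_tendsto_int h.continuous_η h.tendsto_sin
  have hpi := Real.pi_pos
  have hηc := h.continuous_η
  have hupper : ∀ k, n < k → c k 0 = 0 := by
    intro k hk
    by_contra hk0
    have hk' : (n : ℝ) + 1 ≤ k := by exact_mod_cast hk
    have h1 : Tendsto (fun s => 2 * Real.pi * (k + η s) - Real.pi) atTop
        (𝓝 (2 * Real.pi * (k + -n) - Real.pi)) := ((hn.const_add _).const_mul _).sub_const _
    obtain ⟨A, hA, h2⟩ := integral_ge_of_eventually_nonneg_atTop
      (θ := fun s => 2 * Real.pi * (k + η s) - Real.pi) (by fun_prop)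
      ((h1.eventually (lt_mem_nhds (a := 0) (by nlinarith))).mono fun _ => le_of_lt)
    have h3 : ∀ s, 0 ≤ s → Real.pi * s - A ≤ ∫ r in (0 : ℝ)..s, 2 * Real.pi * (k + η r) := by
      intro s hs
      have := h2 0 s le_rfl hs
      rw [intervalIntegral.integral_sub (Continuous.intervalIntegrable (by fun_prop) _ _)
        (continuous_const.intervalIntegrable _ _), intervalIntegral.integral_const,
        smul_eq_mul] at this
      linarith
    have h4 : Tendsto (fun s => Real.exp (Real.pi * s - A) * ‖c k 0‖) atTop atTop := by
      refine Tendsto.atTop_mul_const (norm_pos_iff.2 hk0) (Real.tendsto_exp_atTop.comp ?_)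
      exact tendsto_atTop_add_const_right _ _ (tendsto_id.const_mul_atTop hpi)
    obtain ⟨s, hs0, hs1, hs2⟩ := ((eventually_ge_atTop 0).and
      ((h4.eventually_ge_atTop 2).and (h.tendsto_N.eventually
        (gt_mem_nhds (by norm_num : (1 : ℝ) < 2))))).exists
    have h5 := h.sq_norm_le k s
    rw [h.mode_eq k s, norm_smul, Real.norm_of_nonneg (Real.exp_pos _).le] at h5
    have h6 : Real.exp (Real.pi * s - A) * ‖c k 0‖
        ≤ Real.exp (∫ r in (0 : ℝ)..s, 2 * Real.pi * (k + η r)) * ‖c k 0‖ := by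
      gcongr
      exact h3 s hs0
    nlinarith
  refine ⟨n, hn, fun h0 => ?_, hupper⟩
  have h1 : ∀ᶠ s in atTop, η s < -n + 1 / 2 := hn.eventually (gt_mem_nhds (by linarith))
  obtain ⟨a, ha⟩ := eventually_atTop.1 (h1.and (h.tendsto_N.eventually
    (lt_mem_nhds (by norm_num : (1 / 2 : ℝ) < 1))))
  have h2 : ∀ s, a ≤ s → Real.pi ^ 2 / 2 ≤ D s := by
    intro s hs
    obtain ⟨h3, h4⟩ := ha s hs
    have h5 : Real.pi ^ 2 * N s ≤ D s := by
      refine hasSum_le (fun k => ?_) ((h.hasSum_N s).mul_left _) (h.hasSum_D s)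
      by_cases hk : c k 0 = 0
      · simp [(h.mode_eq_zero_iff k s).2 hk]
      · have hkn : k < n := by
          by_contra! hk'
          rcases hk'.eq_or_lt with rfl | hk'
          · exact hk h0
          · exact hk (hupper k hk')
        have hkn' : (k : ℝ) + 1 ≤ n := by exact_mod_cast hkn
        refine mul_le_mul_of_nonneg_right ?_ (sq_nonneg _)
        have : 1 ≤ (2 * (k + η s)) ^ 2 := by nlinarith
        nlinarith [mul_le_mul_of_nonneg_left this (sq_nonneg Real.pi)]
    nlinarith [sq_nonneg Real.pi]
  have h3 : IntegrableOn (fun _ : ℝ => Real.pi ^ 2 / 2) (Ioi a) := by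
    refine (h.integrable_D.integrableOn (s := Ioi a)).mono' (by fun_prop) ?_
    refine (ae_restrict_iff' measurableSet_Ioi).2 (Eventually.of_forall fun s hs => ?_)
    rw [Real.norm_of_nonneg (by positivity)]
    exact h2 s (le_of_lt hs)
  rw [integrableOn_const_iff] at h3
  simp [hpi.ne'] at h3

/-- The order `m ≤ n` holds because the mode `m` is nonzero, by the reflected statement, while every
mode above `n` vanishes. -/
lemma exists_limits (h : ModeData c η N N' D) :
    ∃ m n : ℤ, m ≤ n ∧ Tendsto η atTop (𝓝 (-n)) ∧ Tendsto η atBot (𝓝 (-m)) ∧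
      Tendsto N atTop (𝓝 1) ∧ Tendsto N atBot (𝓝 1) ∧
      ∀ k, k < m ∨ n < k → ∀ s, c k s = 0 := by
  obtain ⟨n, h1, h2, h3⟩ := h.exists_limit_atTop
  obtain ⟨m, h4, h5, h6⟩ := h.reflect.exists_limit_atTop
  simp only [neg_zero] at h5 h6
  have h7 : Tendsto η atBot (𝓝 (-((-m : ℤ) : ℝ))) := by
    have := (h4.comp tendsto_neg_atBot_atTop).neg
    simpa [Function.comp_def] using this
  have h8 : Tendsto N atBot (𝓝 1) := by
    have := h.reflect.tendsto_N.comp tendsto_neg_atBot_atTop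
    simpa [Function.comp_def] using this
  refine ⟨-m, n, ?_, h1, h7, h.tendsto_N, h8, fun k hk s => (h.mode_eq_zero_iff k s).2 ?_⟩
  · by_contra! hlt
    exact h5 (h3 _ hlt)
  · rcases hk with hk | hk
    · have := h6 (-k) (by omega)
      rwa [neg_neg] at this
    · exact h3 k hk

end ModeData

end Vortex

/-! ### Uniform bounds for vortices -/

namespace Vortex

open Filter Topology Set

lemma integrable_sq_of_lintegral {α F : Type*} [MeasurableSpace α] [NormedAddCommGroup F]
    {μ : Measure α} {f : α → F} (hf : AEStronglyMeasurable f μ)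
    (h : ∫⁻ x, ‖f x‖ₑ ^ 2 ∂μ < ⊤) : Integrable (fun x => ‖f x‖ ^ 2) μ := by
  rw [← memLp_two_iff_integrable_sq_norm hf]
  refine ⟨hf, ?_⟩
  rw [← eLpNorm_two_sq] at h
  by_contra h'
  rw [not_lt, top_le_iff] at h'
  simp [h'] at h

lemma exists_abs_le_of_tendsto {f : ℝ → ℝ} (hf : Continuous f) {a b : ℝ}
    (ha : Tendsto f atTop (𝓝 a)) (hb : Tendsto f atBot (𝓝 b)) : ∃ C, ∀ s, |f s| ≤ C := by
  obtain ⟨x, hx⟩ := eventually_atTop.1 (ha.abs.eventually (gt_mem_nhds (lt_add_one |a|)))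
  obtain ⟨y, hy⟩ := eventually_atBot.1 (hb.abs.eventually (gt_mem_nhds (lt_add_one |b|)))
  obtain ⟨C, hC⟩ := (isCompact_Icc (a := y) (b := x)).exists_bound_of_continuousOn hf.continuousOn
  refine ⟨max C (max (|a| + 1) (|b| + 1)), fun s => ?_⟩
  by_cases h1 : x ≤ s
  · exact (hx s h1).le.trans ((le_max_left _ _).trans (le_max_right _ _))
  · by_cases h2 : s ≤ y
    · exact (hy s h2).le.trans ((le_max_right _ _).trans (le_max_right _ _))
    · exact (hC s ⟨(not_le.1 h2).le, (not_le.1 h1).le⟩).trans (le_max_left _ _)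

/-- With finitely many modes each slice is a trigonometric polynomial, so bounds on the coefficients
give sup bounds. For a vortex this bounds `u`, `∂ₛ u` and `∂ₜ u`. -/
lemma SmoothCyl.norm_le_of_fourierCoeff {f : Cyl → ℂ} (hf : SmoothCyl f) {m n : ℤ} {B : ℝ} {s : ℝ}
    (h0 : ∀ k, k < m ∨ n < k → fourierCoeff (fun t => f (s, t)) k = 0)
    (hB : ∀ k ∈ Finset.Icc m n, ‖fourierCoeff (fun t => f (s, t)) k‖ ≤ B) (t : Circ) :
    ‖f (s, t)‖ ≤ (Finset.Icc m n).card * B := by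
  set g : C(Circ, ℂ) := ⟨fun t => f (s, t), hf.continuous.comp (Continuous.prodMk_right s)⟩ with hg
  have h0' : ∀ k ∉ Finset.Icc m n, fourierCoeff g k = 0 := fun k hk => h0 k (by
    rw [Finset.mem_Icc] at hk; omega)
  have hsum : Summable (fourierCoeff g) := summable_of_ne_finset_zero h0'
  have h1 := has_pointwise_sum_fourier_series_of_summable hsum t
  have h2 : HasSum (fun k => fourierCoeff g k • (fourier k : C(Circ, ℂ)) t)
      (∑ k ∈ Finset.Icc m n, fourierCoeff g k • (fourier k : C(Circ, ℂ)) t) :=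
    hasSum_sum_of_ne_finset_zero fun k hk => by rw [h0' k hk, zero_smul]
  have h3 : f (s, t) = ∑ k ∈ Finset.Icc m n, fourierCoeff g k • (fourier k : C(Circ, ℂ)) t :=
    h1.unique h2
  rw [h3]
  refine (norm_sum_le_of_le _ fun k hk => ?_).trans_eq (by rw [Finset.sum_const, nsmul_eq_mul])
  rw [norm_smul, norm_fourier_apply, mul_one]
  exact hB k hk

section Vortex

variable {u : Cyl → ℂ} {η : ℝ → ℝ}

lemma fourierCoeff_add_const_mul {f g : Cyl → ℂ} (hf : SmoothCyl f) (hg : SmoothCyl g) (a b : ℂ)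
    (s : ℝ) (k : ℤ) : fourierCoeff (fun t => a * f (s, t) + b * g (s, t)) k
      = a * fourierCoeff (fun t => f (s, t)) k + b * fourierCoeff (fun t => g (s, t)) k := by
  have hi : ∀ {g : Cyl → ℂ}, SmoothCyl g → Integrable fun t : Circ =>
      (fourier (-k) : C(Circ, ℂ)) t * g (s, t) := fun hg =>
    (((smoothCyl_fourier (-k)).mul hg).memLp_slice s).integrable one_le_two
  simp_rw [fourierCoeff_eq]
  rw [← integral_const_mul, ← integral_const_mul, ← integral_add ((hi hf).const_mul a)
    ((hi hg).const_mul b)]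
  congr 1; ext t; ring

/-- For given `η` the first vortex equation is linear in `u` with coefficients independent of `t`,
so its Fourier modes decouple. -/
lemma IsVortex.fourierCoeff_dS (h : IsVortex u η) (s : ℝ) (k : ℤ) :
    fourierCoeff (fun t => dS u (s, t)) k
      = (2 * Real.pi * (k + η s) : ℝ) • fourierCoeff (fun t => u (s, t)) k := by
  have e : (fun t => dS u (s, t)) = fun t => (2 * (Real.pi : ℂ) * (η s : ℂ)) * u (s, t)
      + (-Complex.I) * dT u (s, t) := by
    ext t
    have := h.eq_u (s, t)
    simp only at this
    linear_combination this
  rw [e, fourierCoeff_add_const_mul h.smooth_u h.smooth_u.dT, fourierCoeff_dT h.smooth_u,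
    Complex.real_smul]
  push_cast
  linear_combination (-2 * Real.pi * k * fourierCoeff (fun t => u (s, t)) k) * Complex.I_sq

/-- The mass `∫ |u|² dt`. -/
noncomputable def mass (u : Cyl → ℂ) (s : ℝ) : ℝ := ∫ t : Circ, ‖u (s, t)‖ ^ 2

lemma IsVortex.deriv_eta (h : IsVortex u η) (s : ℝ) :
    HasDerivAt η (Real.pi * (mass u s - 1)) s := by
  have h1 := (h.smooth_η.differentiable (by simp) s).hasDerivAt
  refine h1.congr_deriv ?_
  have := h.eq_η s
  rw [mass]
  linarith

lemma IsVortex.modeData (h : IsVortex u η) :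
    ModeData (fun k s => fourierCoeff (fun t => u (s, t)) k) η (mass u)
      (fun s => ∫ t : Circ, dS (fun p => ‖u p‖ ^ 2) (s, t))
      (fun s => ∫ t : Circ, ‖dS u (s, t)‖ ^ 2) := by
  have hsq : SmoothCyl fun p => ‖u p‖ ^ 2 := ContDiff.norm_sq ℝ h.smooth_u
  have hen := h.finite_energy
  rw [energy, ENNReal.add_lt_top] at hen
  have hDi : Integrable fun p : Cyl => ‖dS u p‖ ^ 2 :=
    integrable_sq_of_lintegral h.smooth_u.dS.continuous.aestronglyMeasurable hen.1
  have hηi : Integrable fun s => ‖deriv η s‖ ^ 2 :=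
    integrable_sq_of_lintegral (h.smooth_η.continuous_deriv (by simp)).aestronglyMeasurable hen.2
  have hηd : ∀ s, deriv η s = Real.pi * (mass u s - 1) := fun s => (h.deriv_eta s).deriv
  have hdc : ∀ k s, HasDerivAt (fun s => fourierCoeff (fun t => u (s, t)) k)
      ((2 * Real.pi * (k + η s) : ℝ) • fourierCoeff (fun t => u (s, t)) k) s := fun k s => by
    rw [← h.fourierCoeff_dS]
    exact hasDerivAt_fourierCoeff_slice h.smooth_u s k
  have hNi : Integrable fun s => (mass u s - 1) ^ 2 := by
    refine (hηi.const_mul (Real.pi ^ 2)⁻¹).congr (Eventually.of_forall fun s => ?_)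
    simp only [hηd, Real.norm_eq_abs, sq_abs]
    have := Real.pi_pos
    field_simp
  have hsumN : ∀ s, HasSum (fun k => ‖fourierCoeff (fun t => u (s, t)) k‖ ^ 2) (mass u s) :=
    fun s => hasSum_sq_fourierCoeff' (h.smooth_u.memLp_slice s)
  refine ⟨hdc, h.deriv_eta, fun s => hsq.hasDerivAt_integral s, hsq.dS.continuous_integral,
    fun s l hl => ?_, hsumN, fun s => ?_, ?_, hNi, ?_⟩
  · have hd : ∀ t, dS (fun p => ‖u p‖ ^ 2) (s, t) = 2 * inner ℝ (u (s, t)) (dS u (s, t)) :=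
      fun t => (h.smooth_u.hasDerivAt_dS s t).norm_sq.deriv
    have i1 : Integrable fun t : Circ => ‖u (s, t)‖ ^ 2 :=
      (h.smooth_u.memLp_slice s).integrable_norm_pow two_ne_zero
    have i2 : Integrable fun t : Circ => ‖dS u (s, t)‖ ^ 2 :=
      (h.smooth_u.dS.memLp_slice s).integrable_norm_pow two_ne_zero
    rw [← Real.norm_eq_abs, mass, ← integral_const_mul, ← integral_const_mul,
      ← integral_add (i1.const_mul l) (i2.const_mul l⁻¹)]
    refine norm_integral_le_of_norm_le ((i1.const_mul l).add (i2.const_mul l⁻¹))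
      (Eventually.of_forall fun t => ?_)
    rw [hd, norm_mul, Real.norm_two]
    have h1 := norm_inner_le_norm (𝕜 := ℝ) (u (s, t)) (dS u (s, t))
    -- Weighted arithmetic-geometric mean inequality, written as a completed square.
    have h2 : l * ‖u (s, t)‖ ^ 2 + l⁻¹ * ‖dS u (s, t)‖ ^ 2 - 2 * (‖u (s, t)‖ * ‖dS u (s, t)‖)
        = l⁻¹ * (l * ‖u (s, t)‖ - ‖dS u (s, t)‖) ^ 2 := by field_simp; ring
    have h3 : 0 ≤ l⁻¹ * (l * ‖u (s, t)‖ - ‖dS u (s, t)‖) ^ 2 := by positivity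
    linarith
  · have := hasSum_sq_fourierCoeff' (h.smooth_u.dS.memLp_slice s)
    simp_rw [h.fourierCoeff_dS, norm_smul, mul_pow, Real.norm_eq_abs, sq_abs] at this
    convert this using 2
  · rw [Measure.volume_eq_prod] at hDi
    exact hDi.integral_prod_left
  -- If all modes vanished, the mass would be identically zero and `(N - 1)²` would be the constant
  -- `1`, which is not integrable on the line.
  · by_contra! hz
    have hm : ∀ s, mass u s = 0 := fun s => by
      have h1 : ∀ k, fourierCoeff (fun t => u (s, t)) k = 0 := fun k => by
        rw [eq_exp_smul_of_hasDerivAt h.smooth_η.continuous k (hdc k) s, hz k, smul_zero]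
      have h2 := hsumN s
      simp only [h1, norm_zero, ne_eq, OfNat.ofNat_ne_zero, not_false_eq_true, zero_pow] at h2
      exact h2.unique hasSum_zero
    simp [hm, integrable_const_iff, isFiniteMeasure_iff] at hNi

/-- What the linear theory uses about the asymptotics of a vortex. -/
lemma IsVortex.exists_bounds (h : IsVortex u η) :
    ∃ m n : ℤ, m ≤ n ∧ Tendsto η atTop (𝓝 (-n)) ∧ Tendsto η atBot (𝓝 (-m)) ∧
      Tendsto (mass u) atTop (𝓝 1) ∧ Tendsto (mass u) atBot (𝓝 1) ∧ Continuous (mass u) ∧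
      (∀ s, 0 < mass u s) ∧ ∃ C, (∀ s, |η s| ≤ C) ∧ (∀ p, ‖u p‖ ≤ C) ∧ (∀ p, ‖dS u p‖ ≤ C) ∧
        (∀ p, ‖dT u p‖ ≤ C) ∧ (∀ s, |mass u s| ≤ C) := by
  have hM := h.modeData
  obtain ⟨m, n, hmn, hn, hm, hN, hN', h0⟩ := hM.exists_limits
  obtain ⟨C₁, hC₁⟩ := exists_abs_le_of_tendsto h.smooth_η.continuous hn hm
  obtain ⟨C₂, hC₂⟩ := exists_abs_le_of_tendsto hM.continuous_N hN hN'
  have hc : ∀ k s, ‖fourierCoeff (fun t => u (s, t)) k‖ ≤ √C₂ := fun k s =>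
    Real.le_sqrt_of_sq_le ((hM.sq_norm_le k s).trans ((le_abs_self _).trans (hC₂ s)))
  set K : ℝ := |(m : ℝ)| + |(n : ℝ)| with hK
  have hkK : ∀ k ∈ Finset.Icc m n, |(k : ℝ)| ≤ K := fun k hk => by
    obtain ⟨h1, h2⟩ := Finset.mem_Icc.1 hk
    have h1' : (m : ℝ) ≤ k := by exact_mod_cast h1
    have h2' : (k : ℝ) ≤ n := by exact_mod_cast h2
    have := le_abs_self (n : ℝ)
    have := neg_abs_le (m : ℝ)
    have := abs_nonneg (n : ℝ)
    have := abs_nonneg (m : ℝ)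
    exact abs_le.2 ⟨by linarith, by linarith⟩
  have hC₁0 : 0 ≤ C₁ := (abs_nonneg _).trans (hC₁ 0)
  have hK0 : 0 ≤ K := by positivity
  set L : ℝ := ((Finset.Icc m n).card : ℝ)
  have bu : ∀ p, ‖u p‖ ≤ L * √C₂ := fun p =>
    h.smooth_u.norm_le_of_fourierCoeff (fun k hk => h0 k hk p.1) (fun k _ => hc k p.1) p.2
  have bs : ∀ p, ‖dS u p‖ ≤ L * (2 * Real.pi * (K + C₁) * √C₂) := fun p => by
    refine h.smooth_u.dS.norm_le_of_fourierCoeff (fun k hk => ?_) (fun k hk => ?_) p.2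
    · rw [h.fourierCoeff_dS, h0 k hk p.1, smul_zero]
    · rw [h.fourierCoeff_dS, norm_smul, Real.norm_eq_abs, abs_mul,
        abs_of_pos (by positivity : 0 < 2 * Real.pi)]
      gcongr
      · exact (abs_add_le _ _).trans (add_le_add (hkK k hk) (hC₁ p.1))
      · exact hc k p.1
  have bt : ∀ p, ‖dT u p‖ ≤ L * (2 * Real.pi * K * √C₂) := fun p => by
    refine h.smooth_u.dT.norm_le_of_fourierCoeff (fun k hk => ?_) (fun k hk => ?_) p.2
    · rw [fourierCoeff_dT h.smooth_u, h0 k hk p.1, mul_zero]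
    · rw [fourierCoeff_dT h.smooth_u, norm_mul]
      have : ‖(2 * Real.pi * Complex.I * k : ℂ)‖ = 2 * Real.pi * |(k : ℝ)| := by
        simp [abs_of_pos Real.pi_pos]
      rw [this]
      gcongr
      · exact hkK k hk
      · exact hc k p.1
  have q1 : 0 ≤ L * √C₂ := by positivity
  have q2 : 0 ≤ L * (2 * Real.pi * (K + C₁) * √C₂) := by positivity
  have q3 : 0 ≤ L * (2 * Real.pi * K * √C₂) := by positivity
  have q4 : 0 ≤ C₂ := (abs_nonneg _).trans (hC₂ 0)
  refine ⟨m, n, hmn, hn, hm, hN, hN', hM.continuous_N, hM.N_pos,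
    C₁ + C₂ + L * √C₂ + L * (2 * Real.pi * (K + C₁) * √C₂) + L * (2 * Real.pi * K * √C₂),
    fun s => (hC₁ s).trans ?_, fun p => (bu p).trans ?_, fun p => (bs p).trans ?_,
    fun p => (bt p).trans ?_, fun s => (hC₂ s).trans ?_⟩ <;> linarith

end Vortex

end Vortex

/-! ### The fundamental lemma of the calculus of variations on the cylinder -/

namespace Vortex

open Filter Topology Set

section Uniqueness

lemma measurePreserving_cover : MeasurePreserving (fun p : ℝ × ℝ => ((p.1, (p.2 : Circ)) : Cyl))
    ((volume : Measure ℝ).prod (volume.restrict (Ioc (0 : ℝ) 1))) volume := by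
  have h := UnitAddCircle.measurePreserving_mk 0
  rw [zero_add] at h
  exact (MeasurePreserving.id volume).prod h

/-- The periodic extension to the cylinder of a test function supported in `ℝ × (0, 1)`. -/
noncomputable def periodize (ψ : ℝ × ℝ → ℝ) (p : Cyl) : ℝ :=
  ψ (p.1, (AddCircle.equivIco 1 0 p.2 : ℝ))

lemma periodize_coe (ψ : ℝ × ℝ → ℝ) (s t : ℝ) :
    periodize ψ (s, (t : Circ)) = ψ (s, Int.fract t) := by
  rw [periodize, AddCircle.coe_equivIco_mk_apply]
  simp

/-- The fractional part jumps only at integers, and the support condition makes `ψ` vanish near the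
corresponding heights `0` and `1`. -/
lemma smoothCyl_periodize {ψ : ℝ × ℝ → ℝ} (hψ : ContDiff ℝ ∞ ψ)
    (hs : tsupport ψ ⊆ {p | p.2 ∈ Ioo (0 : ℝ) 1}) : SmoothCyl (periodize ψ) := by
  have e : (fun p : ℝ × ℝ => periodize ψ (p.1, (p.2 : Circ))) = fun p => ψ (p.1, Int.fract p.2) :=
    funext fun p => periodize_coe ψ p.1 p.2
  rw [SmoothCyl, e, contDiff_iff_contDiffAt]
  rintro ⟨s, t⟩
  set n := ⌊t⌋
  have hsub : ∀ m : ℤ, ContDiff ℝ ∞ fun p : ℝ × ℝ => ψ (p.1, p.2 - m) := fun m =>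
    hψ.comp (contDiff_fst.prodMk (contDiff_snd.sub contDiff_const))
  have hlt : t < n + 1 := Int.lt_floor_add_one t
  rcases (Int.floor_le t).eq_or_lt with hn | hn
  -- At an integer `t` the two branches of the fractional part lead to the heights `0` and `1`, both
  -- outside the support, so the periodization is zero nearby.
  · have key : ∀ m : ℤ, ((s, t - m) : ℝ × ℝ) ∉ tsupport ψ →
        ∀ᶠ p : ℝ × ℝ in 𝓝 (s, t), ψ (p.1, p.2 - m) = 0 := by
      intro m hm
      have hc : Continuous fun p : ℝ × ℝ => ((p.1, p.2 - m) : ℝ × ℝ) := by fun_prop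
      have := (hc.continuousAt (x := (s, t))).eventually
        ((isClosed_tsupport ψ).isOpen_compl.mem_nhds (x := (s, t - m)) hm)
      exact this.mono fun p hp => image_eq_zero_of_notMem_tsupport hp
    have h1 := key n (fun h => by
      have h0 : 0 < t - n := (hs h).1
      have : (n : ℝ) = t := hn
      linarith)
    have h2 := key (n - 1) (fun h => by
      have h0 : t - ((n - 1 : ℤ) : ℝ) < 1 := (hs h).2
      have : (n : ℝ) = t := hn
      push_cast at h0
      linarith)
    have h3 : ∀ᶠ p : ℝ × ℝ in 𝓝 (s, t), p.2 ∈ Ioo ((n : ℝ) - 1) (n + 1) :=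
      continuous_snd.continuousAt.eventually (Ioo_mem_nhds (by simp only; linarith) hlt)
    refine (contDiffAt_const (c := (0 : ℝ))).congr_of_eventuallyEq ?_
    filter_upwards [h1, h2, h3] with p hp1 hp2 hp3
    rcases lt_or_ge p.2 n with h4 | h4
    · have : Int.fract p.2 = p.2 - ((n - 1 : ℤ) : ℝ) := by
        have h5 : ⌊p.2⌋ = n - 1 :=
          Int.floor_eq_iff.2 ⟨by push_cast; exact hp3.1.le, by push_cast; linarith⟩
        rw [Int.fract, h5]
      rw [this]; exact hp2
    · have : Int.fract p.2 = p.2 - n := by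
        rw [Int.fract, Int.floor_eq_iff.2 ⟨h4, hp3.2⟩]
      rw [this]; exact hp1
  · refine (hsub n).contDiffAt.congr_of_eventuallyEq ?_
    have h3 : ∀ᶠ p : ℝ × ℝ in 𝓝 (s, t), p.2 ∈ Ioo (n : ℝ) (n + 1) :=
      continuous_snd.continuousAt.eventually (Ioo_mem_nhds hn hlt)
    filter_upwards [h3] with p hp
    rw [Int.fract, Int.floor_eq_iff.2 ⟨hp.1.le, hp.2⟩]

lemma hasCompactSupport_periodize {ψ : ℝ × ℝ → ℝ} (hc : HasCompactSupport ψ) :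
    HasCompactSupport (periodize ψ) := by
  refine HasCompactSupport.intro (hc.isCompact.image isOpenQuotientMap_cover.continuous) ?_
  rintro ⟨s, t⟩ hp
  induction t using QuotientAddGroup.induction_on with
  | H t =>
    by_contra h0
    rw [periodize_coe] at h0
    refine hp ⟨(s, Int.fract t), subset_tsupport ψ h0, ?_⟩
    have : ((Int.fract t : ℝ) : Circ) = (t : Circ) := by
      rw [Int.fract, AddCircle.coe_sub]
      simp
    exact Prod.ext rfl this

/-- Periodized test functions reduce the claim to the open strip `ℝ × (0, 1)` in the plane. The
strip covers the cylinder up to the null set over `t = 0`. -/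
lemma ae_eq_zero_of_integral_smoothCyl_eq_zero {g : Cyl → ℂ} (hg : LocallyIntegrable g)
    (h : ∀ φ : Cyl → ℝ, SmoothCyl φ → HasCompactSupport φ → ∫ p, φ p • g p = 0) :
    g =ᵐ[volume] 0 := by
  set π : ℝ × ℝ → Cyl := fun p => (p.1, (p.2 : Circ)) with hπ
  have hMP := measurePreserving_cover
  have hπm : AEMeasurable π ((volume : Measure ℝ).prod (volume.restrict (Ioc (0 : ℝ) 1))) :=
    hMP.measurable.aemeasurable
  have hμ : ((volume : Measure ℝ).prod (volume.restrict (Ioc (0 : ℝ) 1)))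
      = (volume : Measure (ℝ × ℝ)).restrict (univ ×ˢ Ioc (0 : ℝ) 1) := by
    rw [Measure.volume_eq_prod, ← Measure.prod_restrict, Measure.restrict_univ]
  set U : Set (ℝ × ℝ) := {p | p.2 ∈ Ioo (0 : ℝ) 1} with hU
  have hUo : IsOpen U := isOpen_Ioo.preimage continuous_snd
  have hUsub : U ⊆ univ ×ˢ Ioc (0 : ℝ) 1 := fun p hp => ⟨trivial, Ioo_subset_Ioc_self hp⟩
  have hloc : LocallyIntegrableOn (g ∘ π) U := by
    rw [locallyIntegrableOn_iff hUo.isLocallyClosed]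
    intro K hKU hK
    have hK' : IsCompact (π '' K) := hK.image isOpenQuotientMap_cover.continuous
    have h1 : IntegrableOn g (π '' K) := hg.integrableOn_isCompact hK'
    have h2 := hMP.restrict_preimage hK'.measurableSet
    have h3 := h2.integrable_comp_of_integrable h1
    have h4 : (volume : Measure (ℝ × ℝ)).restrict K
        ≤ ((volume : Measure ℝ).prod (volume.restrict (Ioc (0 : ℝ) 1))).restrict
          (π ⁻¹' (π '' K)) := by
      rw [hμ, Measure.restrict_restrict (hMP.measurable hK'.measurableSet)]
      have h5 : K ⊆ π ⁻¹' (π '' K) ∩ univ ×ˢ Ioc (0 : ℝ) 1 := fun p hp =>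
        ⟨subset_preimage_image π K hp, hUsub (hKU hp)⟩
      exact Measure.restrict_mono h5 le_rfl
    exact h3.mono_measure h4
  have hae := hUo.ae_eq_zero_of_integral_contDiff_smul_eq_zero hloc (fun ψ hψ hc hs => by
    have h1 := h _ (smoothCyl_periodize hψ hs) (hasCompactSupport_periodize hc)
    have hm : AEStronglyMeasurable (fun p => periodize ψ p • g p) volume :=
      (smoothCyl_periodize hψ hs).continuous.aestronglyMeasurable.smul hg.aestronglyMeasurable
    rw [← hMP.map_eq] at h1 hm
    rw [integral_map hπm hm, hμ] at h1
    rw [← h1, ← integral_indicator (MeasurableSet.univ.prod measurableSet_Ioc)]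
    congr 1
    ext p
    by_cases hp : p.2 ∈ Ioo (0 : ℝ) 1
    · rw [indicator_of_mem (hUsub hp)]
      have : Int.fract p.2 = p.2 := Int.fract_eq_self.2 ⟨hp.1.le, hp.2⟩
      simp only [hπ, periodize_coe, this, Function.comp_apply]
    · have h0 : ψ p = 0 := image_eq_zero_of_notMem_tsupport fun h => hp (hs h)
      rw [h0, zero_smul]
      -- The half-open strip contains the height `1`, which the open one does not; the periodization
      -- takes there the value of `ψ` at height `0`, which is zero.
      by_cases hp' : p ∈ univ ×ˢ Ioc (0 : ℝ) 1
      · have h2 : p.2 = 1 := by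
          by_contra hne
          exact hp ⟨hp'.2.1, lt_of_le_of_ne hp'.2.2 hne⟩
        have h3 : ψ (p.1, 0) = 0 := image_eq_zero_of_notMem_tsupport fun h =>
          lt_irrefl _ (hs h).1
        rw [indicator_of_mem hp', hπ, periodize_coe, h2]
        simp [h3]
      · rw [indicator_of_notMem hp'])
  have h5 : ∫⁻ p, ‖g p‖ₑ = 0 := by
    have hm : AEMeasurable (fun p => ‖g p‖ₑ) (volume : Measure Cyl) := hg.aestronglyMeasurable.enorm
    rw [← hMP.map_eq] at hm ⊢
    rw [lintegral_map' hm hπm, hμ]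
    refine (lintegral_congr_ae ?_).trans lintegral_zero
    have h6 : (univ ×ˢ Ioc (0 : ℝ) 1 : Set (ℝ × ℝ)) =ᵐ[volume] (univ ×ˢ Ioo (0 : ℝ) 1) := by
      rw [Measure.volume_eq_prod]
      exact Measure.set_prod_ae_eq (ae_eq_refl _) Ioo_ae_eq_Ioc.symm
    rw [Measure.restrict_congr_set h6, EventuallyEq,
      ae_restrict_iff' (MeasurableSet.univ.prod measurableSet_Ioo)]
    filter_upwards [hae] with p hp hp'
    have := hp hp'.2
    simp only [Function.comp_apply, hπ] at this
    simp [this]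
  have h7 := (lintegral_eq_zero_iff' hg.aestronglyMeasurable.enorm).1 h5
  filter_upwards [h7] with p hp
  simpa using hp

end Uniqueness

end Vortex

/-! ### Weak derivatives on the cylinder -/

namespace Vortex

open Filter Topology Set

section WeakCyl

/-- A derivation on smooth functions on the cylinder: `∂ₛ` or `∂ₜ`. -/
structure IsCylDerivation (d : (Cyl → ℝ) → Cyl → ℝ) : Prop where
  smooth : ∀ φ, SmoothCyl φ → SmoothCyl (d φ)
  support : ∀ φ, HasCompactSupport φ → HasCompactSupport (d φ)
  mul : ∀ φ a, SmoothCyl φ → SmoothCyl a → ∀ p, d (fun p => φ p * a p) p = d φ p * a p + φ p * d a p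

/-- `g` is the weak derivative of `f` with respect to the derivation `d`. -/
def IsWeak (d : (Cyl → ℝ) → Cyl → ℝ) (f g : Cyl → ℂ) : Prop :=
  LocallyIntegrable f ∧ LocallyIntegrable g ∧
    ∀ φ : Cyl → ℝ, SmoothCyl φ → HasCompactSupport φ →
      ∫ p : Cyl, d φ p • f p = - ∫ p : Cyl, φ p • g p

lemma isCylDerivation_dS : IsCylDerivation (dS (E := ℝ)) where
  smooth φ hφ := hφ.dS
  support φ hφ := by
    refine HasCompactSupport.intro hφ.isCompact fun p hp => ?_
    have h1 : φ =ᶠ[𝓝 p] 0 := notMem_tsupport_iff_eventuallyEq.1 hp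
    have h2 : (fun σ => φ (σ, p.2)) =ᶠ[𝓝 p.1] fun _ => 0 :=
      ((Continuous.prodMk_left p.2).continuousAt (x := p.1)).eventually h1
    rw [dS, h2.deriv_eq, deriv_const]
  mul φ a hφ ha p := ((hφ.hasDerivAt_dS p.1 p.2).mul (ha.hasDerivAt_dS p.1 p.2)).deriv

lemma isCylDerivation_dT : IsCylDerivation (dT (E := ℝ)) where
  smooth φ hφ := hφ.dT
  support φ hφ := by
    refine HasCompactSupport.intro hφ.isCompact fun p hp => ?_
    have h1 : φ =ᶠ[𝓝 p] 0 := notMem_tsupport_iff_eventuallyEq.1 hp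
    have hc : Continuous fun τ : ℝ => ((p.1, p.2 + (τ : Circ)) : Cyl) :=
      continuous_const.prodMk (continuous_const.add (AddCircle.continuous_mk' 1))
    have h0 : ((p.1, p.2 + ((0 : ℝ) : Circ)) : Cyl) = p := by simp
    have h2 : (fun τ : ℝ => φ (p.1, p.2 + (τ : Circ))) =ᶠ[𝓝 0] fun _ => 0 := by
      have := hc.tendsto 0
      rw [h0] at this
      exact this.eventually h1
    rw [dT, h2.deriv_eq, deriv_const]
  mul φ a hφ ha p := by
    refine ((hφ.hasDerivAt_dT p.1 p.2).mul (ha.hasDerivAt_dT p.1 p.2)).deriv.trans ?_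
    simp

variable {d : (Cyl → ℝ) → Cyl → ℝ} {f g f' g' : Cyl → ℂ}

lemma integrable_test {φ : Cyl → ℝ} (hφ : Continuous φ) (hc : HasCompactSupport φ)
    (hf : LocallyIntegrable f) : Integrable fun p => φ p • f p :=
  integrable_smul_of_hasCompactSupport hφ hc hf

lemma IsWeak.unique (h : IsWeak d f g) (h' : IsWeak d f g') : g =ᵐ[volume] g' := by
  have h1 := ae_eq_zero_of_integral_smoothCyl_eq_zero (h.2.1.sub h'.2.1) (fun φ hφ hc => by
    have e1 := h.2.2 φ hφ hc
    have e2 := h'.2.2 φ hφ hc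
    simp only [Pi.sub_apply, smul_sub]
    rw [integral_sub (integrable_test hφ.continuous hc h.2.1)
      (integrable_test hφ.continuous hc h'.2.1), sub_eq_zero, ← neg_inj, ← e1, ← e2])
  filter_upwards [h1] with p hp
  simpa [sub_eq_zero] using hp

lemma IsWeak.congr_ae (h : IsWeak d f g) (hf : f =ᵐ[volume] f') (hg : g =ᵐ[volume] g') :
    IsWeak d f' g' := by
  refine ⟨h.1.congr hf, h.2.1.congr hg, fun φ hφ hc => ?_⟩
  have e1 : ∫ p, d φ p • f p = ∫ p, d φ p • f' p :=
    integral_congr_ae (hf.mono fun s hs => by simp only [hs])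
  have e2 : ∫ p, φ p • g p = ∫ p, φ p • g' p :=
    integral_congr_ae (hg.mono fun s hs => by simp only [hs])
  rw [← e1, ← e2, h.2.2 φ hφ hc]

lemma IsWeak.add (hd : IsCylDerivation d) (h : IsWeak d f g) (h' : IsWeak d f' g') :
    IsWeak d (fun p => f p + f' p) (fun p => g p + g' p) := by
  refine ⟨h.1.add h'.1, h.2.1.add h'.2.1, fun φ hφ hc => ?_⟩
  have hc' := hd.support φ hc
  have hφ' := (hd.smooth φ hφ).continuous
  simp_rw [smul_add]
  rw [integral_add (integrable_test hφ' hc' h.1) (integrable_test hφ' hc' h'.1),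
    integral_add (integrable_test hφ.continuous hc h.2.1)
      (integrable_test hφ.continuous hc h'.2.1), h.2.2 φ hφ hc, h'.2.2 φ hφ hc, neg_add]

lemma IsWeak.const_mul (h : IsWeak d f g) (c : ℂ) :
    IsWeak d (fun p => c * f p) (fun p => c * g p) := by
  refine ⟨h.1.smul c, h.2.1.smul c, fun φ hφ hc => ?_⟩
  have e : ∀ (ψ : Cyl → ℝ) (F : Cyl → ℂ), ∫ p, ψ p • (c * F p) = c * ∫ p, ψ p • F p :=
    fun ψ F => by
      rw [← integral_const_mul]
      exact integral_congr_ae (Eventually.of_forall fun p => (mul_smul_comm _ _ _).symm)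
  rw [e]
  refine Eq.trans ?_ (congrArg Neg.neg (e φ g).symm)
  rw [h.2.2 φ hφ hc, mul_neg]

lemma IsWeak.smul (hd : IsCylDerivation d) (h : IsWeak d f g) {a : Cyl → ℝ} (ha : SmoothCyl a) :
    IsWeak d (fun p => a p • f p) (fun p => d a p • f p + a p • g p) := by
  have l1 := h.1.continuous_smul ha.continuous
  have l2 := h.1.continuous_smul (hd.smooth a ha).continuous
  have l3 := h.2.1.continuous_smul ha.continuous
  refine ⟨l1, l2.add l3, fun φ hφ hc => ?_⟩
  have h1 := h.2.2 (fun p => φ p * a p) (ContDiff.mul hφ ha) hc.mul_right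
  simp_rw [hd.mul φ a hφ ha, add_smul, mul_smul] at h1
  rw [integral_add (integrable_test (hd.smooth φ hφ).continuous (hd.support φ hc) l1)
    (integrable_test hφ.continuous hc l2)] at h1
  simp_rw [smul_add]
  rw [integral_add (integrable_test hφ.continuous hc l2) (integrable_test hφ.continuous hc l3),
    neg_add, ← h1]
  abel

/-- Test functions are real, so a complex multiplier is treated through its real and imaginary
parts. -/
lemma IsWeak.mul (hd : IsCylDerivation d) (h : IsWeak d f g) {a a' : Cyl → ℂ} (ha : SmoothCyl a)
    (hre : ∀ p, d (fun p => (a p).re) p = (a' p).re)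
    (him : ∀ p, d (fun p => (a p).im) p = (a' p).im) :
    IsWeak d (fun p => a p * f p) (fun p => a' p * f p + a p * g p) := by
  have h1 := h.smul hd (a := fun p => (a p).re) (Complex.reCLM.contDiff.comp ha)
  have h2 := (h.smul hd (a := fun p => (a p).im) (Complex.imCLM.contDiff.comp ha)).const_mul
    Complex.I
  refine (h1.add hd h2).congr_ae (Eventually.of_forall fun p => ?_)
    (Eventually.of_forall fun p => ?_)
  · simp only [Complex.real_smul]
    conv_rhs => rw [← Complex.re_add_im (a p)]
    ring
  · simp only [Complex.real_smul, hre, him]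
    conv_rhs => rw [← Complex.re_add_im (a p), ← Complex.re_add_im (a' p)]
    ring

lemma dS_re {a : Cyl → ℂ} (ha : SmoothCyl a) (p : Cyl) :
    dS (fun p => (a p).re) p = (dS a p).re :=
  (Complex.reCLM.hasFDerivAt.comp_hasDerivAt p.1 (ha.hasDerivAt_dS p.1 p.2)).deriv

lemma dS_im {a : Cyl → ℂ} (ha : SmoothCyl a) (p : Cyl) :
    dS (fun p => (a p).im) p = (dS a p).im :=
  (Complex.imCLM.hasFDerivAt.comp_hasDerivAt p.1 (ha.hasDerivAt_dS p.1 p.2)).deriv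

lemma dT_re {a : Cyl → ℂ} (ha : SmoothCyl a) (p : Cyl) :
    dT (fun p => (a p).re) p = (dT a p).re :=
  (Complex.reCLM.hasFDerivAt.comp_hasDerivAt (0 : ℝ) (ha.hasDerivAt_dT p.1 p.2)).deriv

lemma dT_im {a : Cyl → ℂ} (ha : SmoothCyl a) (p : Cyl) :
    dT (fun p => (a p).im) p = (dT a p).im :=
  (Complex.imCLM.hasFDerivAt.comp_hasDerivAt (0 : ℝ) (ha.hasDerivAt_dT p.1 p.2)).deriv

lemma IsWeakDS.mul_smooth (h : IsWeakDS f g) {a : Cyl → ℂ} (ha : SmoothCyl a) :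
    IsWeakDS (fun p => a p * f p) (fun p => dS a p * f p + a p * g p) :=
  IsWeak.mul isCylDerivation_dS h ha (dS_re ha) (dS_im ha)

lemma IsWeakDT.mul_smooth (h : IsWeakDT f g) {a : Cyl → ℂ} (ha : SmoothCyl a) :
    IsWeakDT (fun p => a p * f p) (fun p => dT a p * f p + a p * g p) :=
  IsWeak.mul isCylDerivation_dT h ha (dT_re ha) (dT_im ha)

/-- By uniqueness the arbitrary choice in `weakDS` is immaterial up to a null set, so `linCyl` can
be computed with any explicit weak derivative. -/
lemma weakDS_ae_eq (h : IsWeakDS f g) : weakDS f =ᵐ[volume] g := by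
  have h' : ∃ g, IsWeakDS f g := ⟨g, h⟩
  rw [weakDS, dif_pos h']
  exact IsWeak.unique (d := dS) h'.choose_spec h

lemma weakDT_ae_eq (h : IsWeakDT f g) : weakDT f =ᵐ[volume] g := by
  have h' : ∃ g, IsWeakDT f g := ⟨g, h⟩
  rw [weakDT, dif_pos h']
  exact IsWeak.unique (d := dT) h'.choose_spec h

lemma weakDLine_ae_eq {f g : ℝ → ℝ} (h : IsWeakDLine f g) : weakDLine f =ᵐ[volume] g := by
  have h' : ∃ g, IsWeakDLine f g := ⟨g, h⟩
  rw [weakDLine, dif_pos h']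
  have h1 := h'.choose_spec
  set g' := h'.choose
  have h2 := ae_eq_zero_of_integral_contDiff_smul_eq_zero (h1.2.1.sub h.2.1) (fun φ hφ hc => by
    have e1 := h1.2.2 φ hφ hc
    have e2 := h.2.2 φ hφ hc
    have i1 : Integrable fun s => φ s * g' s :=
      integrable_smul_of_hasCompactSupport hφ.continuous hc h1.2.1
    have i2 : Integrable fun s => φ s * g s :=
      integrable_smul_of_hasCompactSupport hφ.continuous hc h.2.1
    simp only [Pi.sub_apply, smul_eq_mul, mul_sub]
    rw [integral_sub i1 i2, sub_eq_zero, ← neg_inj, ← e1, ← e2])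
  filter_upwards [h2] with p hp
  simpa [sub_eq_zero] using hp

end WeakCyl

section Tensor

variable {y g : ℝ → ℂ}

/-- The function `(s, t) ↦ y(s) exp(2πikt)`. -/
noncomputable def tensor (k : ℤ) (y : ℝ → ℂ) (p : Cyl) : ℂ :=
  y p.1 * (fourier k : C(Circ, ℂ)) p.2

lemma locallyIntegrable_comp_fst (hy : LocallyIntegrable y) :
    LocallyIntegrable fun p : Cyl => y p.1 := by
  rw [locallyIntegrable_iff]
  intro K hK
  have h1 : IntegrableOn y (Prod.fst '' K) :=
    hy.integrableOn_isCompact (hK.image continuous_fst)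
  have h2 : IntegrableOn (fun p : Cyl => y p.1) ((Prod.fst '' K) ×ˢ (univ : Set Circ)) := by
    rw [IntegrableOn, Measure.volume_eq_prod, ← Measure.prod_restrict, Measure.restrict_univ]
    exact h1.comp_fst _
  exact h2.mono_set fun p hp => ⟨⟨p, hp, rfl⟩, trivial⟩

lemma locallyIntegrable_tensor (k : ℤ) (hy : LocallyIntegrable y) :
    LocallyIntegrable (tensor k y) := by
  have := (locallyIntegrable_comp_fst hy).continuous_smul
    (smoothCyl_fourier k).continuous
  refine this.congr (Eventually.of_forall fun p => ?_)
  simp only [tensor, smul_eq_mul, mul_comm]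

lemma isWeakDS_tensor (h : WeakDeriv y g) (k : ℤ) : IsWeakDS (tensor k y) (tensor k g) := by
  have l1 := locallyIntegrable_tensor k h.left
  have l2 := locallyIntegrable_tensor k h.right
  refine ⟨l1, l2, fun φ hφ hc => ?_⟩
  have i1 := integrable_test hφ.dS.continuous (isCylDerivation_dS.support φ hc) l1
  have i2 := integrable_test hφ.continuous hc l2
  rw [Measure.volume_eq_prod] at i1 i2 ⊢
  rw [integral_prod_symm _ i1, integral_prod_symm _ i2, ← integral_neg]
  congr 1
  ext t
  have hct : HasCompactSupport fun s => φ (s, t) := by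
    refine HasCompactSupport.intro (hc.isCompact.image continuous_fst) fun s hs => ?_
    exact image_eq_zero_of_notMem_tsupport fun h' => hs ⟨(s, t), h', rfl⟩
  have h1 := h.eq (fun s => φ (s, t)) ((hφ.contDiff_left t).of_le (by simp)) hct
  have e : ∀ s, dS φ (s, t) = deriv (fun s => φ (s, t)) s := fun s => rfl
  simp only [tensor, e, ← smul_mul_assoc]
  rw [integral_mul_const, integral_mul_const, h1, neg_mul]

lemma isWeakDT_tensor (h : LocallyIntegrable y) (k : ℤ) :
    IsWeakDT (tensor k y) (tensor k fun s => 2 * Real.pi * Complex.I * k * y s) := by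
  have l1 := locallyIntegrable_tensor k h
  have l2 := locallyIntegrable_tensor k (h.smul (2 * Real.pi * Complex.I * k : ℂ))
  refine ⟨l1, l2, fun φ hφ hc => ?_⟩
  have i1 := integrable_test hφ.dT.continuous (isCylDerivation_dT.support φ hc) l1
  have i2 := integrable_test hφ.continuous hc l2
  rw [Measure.volume_eq_prod] at i1 i2 ⊢
  rw [integral_prod _ i1]
  refine Eq.trans ?_ (congrArg Neg.neg (integral_prod _ i2).symm)
  rw [← integral_neg]
  congr 1
  ext s
  have hφ' : SmoothCyl fun p => (φ p : ℂ) := Complex.ofRealCLM.contDiff.comp hφ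
  have hd : ∀ p, dT (fun p => (φ p : ℂ)) p = ((dT φ p : ℝ) : ℂ) := fun p =>
    (Complex.ofRealCLM.hasFDerivAt.comp_hasDerivAt (0 : ℝ) (hφ.hasDerivAt_dT p.1 p.2)).deriv
  -- Integration by parts on each circle: the integral of `∂ₜ (φ exp(2πikt))` vanishes.
  have h1 := (hφ'.mul (smoothCyl_fourier k)).integral_dT s
  simp_rw [hφ'.dT_mul (smoothCyl_fourier k), dT_fourier, hd] at h1
  have hc1 : ∀ {F : Cyl → ℂ}, SmoothCyl F → Integrable fun t : Circ => F (s, t) := fun hF =>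
    (hF.memLp_slice s).integrable one_le_two
  have j1 : Integrable fun t : Circ => ((dT φ (s, t) : ℝ) : ℂ) * (fourier k : C(Circ, ℂ)) t := by
    have := hc1 (hφ'.dT.mul (smoothCyl_fourier k))
    simpa only [hd] using this
  have j2 : Integrable fun t : Circ => (φ (s, t) : ℂ) * (2 * Real.pi * Complex.I * k *
      (fourier k : C(Circ, ℂ)) t) := by
    refine ((hc1 (hφ'.mul (smoothCyl_fourier k))).const_mul (2 * Real.pi * Complex.I * k)).congr
      (Eventually.of_forall fun t => ?_)
    simp only; ring
  rw [integral_add j1 j2, add_eq_zero_iff_eq_neg] at h1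
  have e1 : ∀ t : Circ, dT φ (s, t) • tensor k y (s, t)
      = y s * (((dT φ (s, t) : ℝ) : ℂ) * (fourier k : C(Circ, ℂ)) t) := fun t => by
    simp only [tensor, Complex.real_smul]; ring
  have e2 : ∀ t : Circ, φ (s, t) • tensor k (fun s => 2 * Real.pi * Complex.I * k * y s) (s, t)
      = y s * ((φ (s, t) : ℂ) * (2 * Real.pi * Complex.I * k * (fourier k : C(Circ, ℂ)) t)) :=
    fun t => by simp only [tensor, Complex.real_smul]; ring
  simp_rw [e1]
  refine Eq.trans ?_ (congrArg Neg.neg (integral_congr_ae (Eventually.of_forall e2)).symm)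
  rw [integral_const_mul, integral_const_mul, h1, mul_neg]

end Tensor

end Vortex

/-! ### Fourier series in `L²` of the cylinder -/

namespace Vortex

open Filter Topology Set

section Hilbert

variable {ι H : Type*} [NormedAddCommGroup H] [InnerProductSpace ℂ H] {x : ι → H} {X : H}

lemma norm_sum_sq_of_pairwise (h : Pairwise fun i j => inner ℂ (x i) (x j) = 0) (S : Finset ι) :
    ‖∑ i ∈ S, x i‖ ^ 2 = ∑ i ∈ S, ‖x i‖ ^ 2 := by
  classical
  induction S using Finset.induction_on with
  | empty => simp
  | insert a S ha ih =>
    have h0 : inner ℂ (x a) (∑ i ∈ S, x i) = 0 := by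
      rw [inner_sum]
      exact Finset.sum_eq_zero fun i hi => h fun hai => ha (hai ▸ hi)
    rw [Finset.sum_insert ha, Finset.sum_insert ha, ← ih, sq, sq, sq]
    exact norm_add_sq_eq_norm_sq_add_norm_sq_of_inner_eq_zero _ _ h0

lemma summable_of_pairwise [CompleteSpace H] (h : Pairwise fun i j => inner ℂ (x i) (x j) = 0)
    (hs : Summable fun i => ‖x i‖ ^ 2) : Summable x := by
  rw [summable_iff_vanishing_norm] at hs ⊢
  intro ε hε
  obtain ⟨S, hS⟩ := hs (ε ^ 2) (by positivity)
  refine ⟨S, fun T hT => ?_⟩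
  have := hS T hT
  rw [← norm_sum_sq_of_pairwise h, Real.norm_of_nonneg (sq_nonneg _)] at this
  exact lt_of_pow_lt_pow_left₀ 2 hε.le this

/-- Condition `hX` makes each `x i` behave as the projection of `X` to its line, whence `‖∑ x i -
X‖² = ‖X‖² - ∑ ‖x i‖²` over finite sets. Parseval then gives convergence. -/
lemma hasSum_of_pairwise (h : Pairwise fun i j => inner ℂ (x i) (x j) = 0)
    (hX : ∀ i, inner ℂ (x i) X = ((‖x i‖ ^ 2 : ℝ) : ℂ))
    (hs : HasSum (fun i => ‖x i‖ ^ 2) (‖X‖ ^ 2)) : HasSum x X := by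
  have key : ∀ S : Finset ι, ‖∑ i ∈ S, x i - X‖ ^ 2 = ‖X‖ ^ 2 - ∑ i ∈ S, ‖x i‖ ^ 2 := by
    intro S
    have h1 : RCLike.re (inner ℂ (∑ i ∈ S, x i) X) = ∑ i ∈ S, ‖x i‖ ^ 2 := by
      rw [sum_inner]
      simp_rw [hX]
      rw [← Complex.ofReal_sum]
      exact Complex.ofReal_re _
    rw [norm_sub_sq (𝕜 := ℂ), h1, norm_sum_sq_of_pairwise h]
    ring
  rw [HasSum, tendsto_iff_norm_sub_tendsto_zero]
  have h2 : Tendsto (fun S : Finset ι => ‖X‖ ^ 2 - ∑ i ∈ S, ‖x i‖ ^ 2)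
      (SummationFilter.unconditional ι).filter (𝓝 (‖X‖ ^ 2 - ‖X‖ ^ 2)) :=
    tendsto_const_nhds.sub hs
  rw [sub_self] at h2
  have h3 := h2.sqrt
  rw [Real.sqrt_zero] at h3
  refine h3.congr fun S => ?_
  rw [← key, Real.sqrt_sq (norm_nonneg _)]

end Hilbert

section Modes

variable {a b : ℝ → ℂ}

lemma norm_tensor (k : ℤ) (a : ℝ → ℂ) (p : Cyl) : ‖tensor k a p‖ = ‖a p.1‖ := by
  rw [tensor, norm_mul, norm_fourier_apply, mul_one]

instance isProbabilityMeasure_circ : IsProbabilityMeasure (volume : Measure Circ) :=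
  ⟨UnitAddCircle.measure_univ⟩

lemma measurePreserving_cyl_fst : MeasurePreserving (Prod.fst : Cyl → ℝ) volume volume := by
  rw [Measure.volume_eq_prod]
  exact measurePreserving_fst

lemma memLp_tensor (k : ℤ) (ha : MemLp a 2) : MemLp (tensor k a) 2 := by
  have h1 := ha.comp_measurePreserving measurePreserving_cyl_fst
  refine h1.congr_norm (h1.1.mul (smoothCyl_fourier k).continuous.aestronglyMeasurable)
    (Eventually.of_forall fun p => (norm_tensor k a p).symm)

lemma eLpNorm_tensor (k : ℤ) (ha : AEStronglyMeasurable a) :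
    eLpNorm (tensor k a) 2 volume = eLpNorm a 2 volume := by
  rw [← eLpNorm_comp_measurePreserving ha measurePreserving_cyl_fst]
  exact eLpNorm_congr_norm_ae (Eventually.of_forall fun p => norm_tensor k a p)

/-- The class in `L²(ℝ × S¹)` of `(s, t) ↦ a(s) exp(2πikt)`. -/
noncomputable def tensorLp (k : ℤ) (ha : MemLp a 2) : Lp ℂ 2 (volume : Measure Cyl) :=
  (memLp_tensor k ha).toLp

lemma norm_tensorLp (k : ℤ) (ha : MemLp a 2) : ‖tensorLp k ha‖ = (eLpNorm a 2 volume).toReal := by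
  rw [tensorLp, Lp.norm_toLp, eLpNorm_tensor k ha.1]

lemma integral_fourier_mul (j k : ℤ) :
    ∫ t : Circ, (fourier (-j) : C(Circ, ℂ)) t * (fourier k : C(Circ, ℂ)) t
      = if j = k then 1 else 0 := by
  rw [← fourierCoeff_eq, fourierCoeff_fourier, Pi.single_apply]

lemma integral_conj_tensor_mul_tensor (j k : ℤ) (a b : ℝ → ℂ) :
    ∫ p, (starRingEnd ℂ) (tensor j a p) * tensor k b p
      = (∫ s, (starRingEnd ℂ) (a s) * b s) * if j = k then 1 else 0 := by
  rw [← integral_fourier_mul, ← integral_prod_mul, ← Measure.volume_eq_prod]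
  congr 1
  ext p
  rw [tensor, tensor, map_mul, ← fourier_neg]
  ring

lemma Lp_inner_eq {f g : Cyl → ℂ} {F G : Lp ℂ 2 (volume : Measure Cyl)}
    (hF : F =ᵐ[volume] f) (hG : G =ᵐ[volume] g) :
    inner ℂ F G = ∫ p, (starRingEnd ℂ) (f p) * g p := by
  rw [L2.inner_def]
  refine integral_congr_ae ?_
  filter_upwards [hF, hG] with p h1 h2
  rw [h1, h2, RCLike.inner_apply, mul_comm]

lemma pairwise_tensorLp {a : ℤ → ℝ → ℂ} (ha : ∀ k, MemLp (a k) 2) :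
    Pairwise fun j k => inner ℂ (tensorLp j (ha j)) (tensorLp k (ha k)) = 0 := by
  intro j k hjk
  refine (Lp_inner_eq (memLp_tensor j (ha j)).coeFn_toLp
    (memLp_tensor k (ha k)).coeFn_toLp).trans ?_
  rw [integral_conj_tensor_mul_tensor,
    if_neg hjk, mul_zero]

/-- Pairing with an `L²` function is continuous and so commutes with the sum. The conjugate
compensates for the conjugate linearity of the inner product in its first slot. -/
lemma hasSum_integral_mul {ι : Type*} {x : ι → Lp ℂ 2 (volume : Measure Cyl)}
    {X : Lp ℂ 2 (volume : Measure Cyl)} (h : HasSum x X) {ψ : Cyl → ℂ} (hψ : MemLp ψ 2) :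
    HasSum (fun i => ∫ p, ψ p * x i p) (∫ p, ψ p * X p) := by
  have hψ' : MemLp (fun p => (starRingEnd ℂ) (ψ p)) 2 := hψ.star
  have h1 := h.mapL (innerSL ℂ hψ'.toLp)
  have e : ∀ Y : Lp ℂ 2 (volume : Measure Cyl), innerSL ℂ hψ'.toLp Y = ∫ p, ψ p * Y p := by
    intro Y
    rw [innerSL_apply_apply, Lp_inner_eq hψ'.coeFn_toLp (ae_eq_refl _)]
    simp
  simpa only [e] using h1

section Coefficients

variable {F : Cyl → ℂ}

/-- The `k`-th Fourier coefficient in `t`. -/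
noncomputable def cylCoeff (F : Cyl → ℂ) (k : ℤ) (s : ℝ) : ℂ := fourierCoeff (fun t => F (s, t)) k

lemma aestronglyMeasurable_cylCoeff (hF : AEStronglyMeasurable F) (k : ℤ) :
    AEStronglyMeasurable (cylCoeff F k) := by
  have h1 : AEStronglyMeasurable (fun p : Cyl => (fourier (-k) : C(Circ, ℂ)) p.2 * F p)
      ((volume : Measure ℝ).prod volume) := by
    rw [← Measure.volume_eq_prod]
    exact (smoothCyl_fourier (-k)).continuous.aestronglyMeasurable.mul hF
  have e : cylCoeff F k = fun s => ∫ t : Circ, (fourier (-k) : C(Circ, ℂ)) t * F (s, t) :=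
    funext fun s => fourierCoeff_eq _ _
  rw [e]
  exact h1.integral_prod_right'

lemma ae_memLp_slice (hF : MemLp F 2) : ∀ᵐ s : ℝ, MemLp (fun t : Circ => F (s, t)) 2 := by
  have h1 := hF.1
  rw [Measure.volume_eq_prod] at h1
  have h2 : ∫⁻ p, ‖F p‖ₑ ^ 2 ≠ ⊤ := by
    rw [← eLpNorm_two_sq]
    exact (ENNReal.pow_lt_top hF.2).ne
  rw [Measure.volume_eq_prod, lintegral_prod _ (h1.enorm.pow_const 2)] at h2
  filter_upwards [h1.prodMk_left, ae_lt_top' (h1.enorm.pow_const 2).lintegral_prod_right' h2]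
    with s hs1 hs2
  refine ⟨hs1, ?_⟩
  rw [← eLpNorm_two_sq] at hs2
  by_contra h'
  rw [not_lt, top_le_iff] at h'
  simp [h'] at hs2

/-- Parseval on almost every circle, integrated over `s` by Tonelli. -/
lemma tsum_eLpNorm_cylCoeff (hF : MemLp F 2) :
    ∑' k, eLpNorm (cylCoeff F k) 2 volume ^ 2 = eLpNorm F 2 volume ^ 2 := by
  have h1 := hF.1
  rw [Measure.volume_eq_prod] at h1
  simp_rw [eLpNorm_two_sq]
  rw [← lintegral_tsum fun k => (aestronglyMeasurable_cylCoeff hF.1 k).enorm.pow_const 2,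
    Measure.volume_eq_prod, lintegral_prod _ (h1.enorm.pow_const 2)]
  refine lintegral_congr_ae ?_
  filter_upwards [ae_memLp_slice hF] with s hs
  have h2 : HasSum (fun k => ‖cylCoeff F k s‖ ^ 2) (∫ t, ‖F (s, t)‖ ^ 2) :=
    hasSum_sq_fourierCoeff' hs
  have h3 : ∀ k, ‖cylCoeff F k s‖ₑ ^ 2 = ENNReal.ofReal (‖cylCoeff F k s‖ ^ 2) := fun k => by
    rw [ENNReal.ofReal_pow (norm_nonneg _), ofReal_norm]
  simp_rw [h3]
  rw [← ENNReal.ofReal_tsum_of_nonneg (fun _ => by positivity) h2.summable]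
  rw [h2.tsum_eq, ofReal_integral_eq_lintegral_ofReal (hs.integrable_norm_pow two_ne_zero)
    (Eventually.of_forall fun _ => by positivity)]
  refine lintegral_congr fun t => ?_
  rw [ENNReal.ofReal_pow (norm_nonneg _), ofReal_norm]

lemma memLp_cylCoeff (hF : MemLp F 2) (k : ℤ) : MemLp (cylCoeff F k) 2 := by
  refine ⟨aestronglyMeasurable_cylCoeff hF.1 k, ?_⟩
  have h1 : eLpNorm (cylCoeff F k) 2 volume ^ 2 ≤ eLpNorm F 2 volume ^ 2 := by
    rw [← tsum_eLpNorm_cylCoeff hF]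
    exact ENNReal.le_tsum k
  exact lt_of_le_of_lt ((ENNReal.pow_le_pow_left_iff two_ne_zero).1 h1) hF.2

lemma hasSum_sq_norm_cylCoeff (hF : MemLp F 2) :
    HasSum (fun k => ‖tensorLp k (memLp_cylCoeff hF k)‖ ^ 2) (‖hF.toLp‖ ^ 2) := by
  have h1 := tsum_eLpNorm_cylCoeff hF
  have h2 := ENNReal.hasSum_toReal (f := fun k => eLpNorm (cylCoeff F k) 2 volume ^ 2)
    (by rw [h1]; exact (ENNReal.pow_lt_top hF.2).ne)
  rw [← ENNReal.tsum_toReal_eq fun k => (ENNReal.pow_lt_top (memLp_cylCoeff hF k).2).ne, h1] at h2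
  simp_rw [norm_tensorLp, Lp.norm_toLp]
  simpa only [ENNReal.toReal_pow] using h2

lemma hasSum_cylCoeff (hF : MemLp F 2) :
    HasSum (fun k => tensorLp k (memLp_cylCoeff hF k)) hF.toLp := by
  refine hasSum_of_pairwise (pairwise_tensorLp _) (fun k => ?_) (hasSum_sq_norm_cylCoeff hF)
  have hk := memLp_tensor k (memLp_cylCoeff hF k)
  have hself : inner ℂ (tensorLp k (memLp_cylCoeff hF k)) (tensorLp k (memLp_cylCoeff hF k))
      = ((‖tensorLp k (memLp_cylCoeff hF k)‖ ^ 2 : ℝ) : ℂ) := by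
    rw [inner_self_eq_norm_sq_to_K]; norm_cast
  have hk' : tensorLp k (memLp_cylCoeff hF k) =ᵐ[volume] tensor k (cylCoeff F k) := hk.coeFn_toLp
  rw [← hself, Lp_inner_eq hk' hF.coeFn_toLp, Lp_inner_eq hk' hk',
    integral_conj_tensor_mul_tensor, if_pos rfl, mul_one]
  have hi : Integrable (fun p => (starRingEnd ℂ) (tensor k (cylCoeff F k) p) * F p)
      ((volume : Measure ℝ).prod volume) := by
    rw [← Measure.volume_eq_prod]
    exact hk.star.integrable_mul hF
  rw [Measure.volume_eq_prod, integral_prod _ hi]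
  congr 1
  ext s
  have e : ∫ t : Circ, (starRingEnd ℂ) (cylCoeff F k s) * (fourier (-k) t * F (s, t))
      = (starRingEnd ℂ) (cylCoeff F k s) * cylCoeff F k s := by
    rw [integral_const_mul]
    exact congrArg _ (fourierCoeff_eq _ _).symm
  refine Eq.trans ?_ e
  congr 1
  ext t
  rw [tensor, map_mul, ← fourier_neg]
  ring

end Coefficients

end Modes

/-! ### Solving the Cauchy-Riemann equation mode by mode -/

section Solve

variable {ρ η : ℝ → ℝ} {f : Cyl → ℂ} {C : ℝ}

lemma norm_tensorLp_le {a b : ℝ → ℂ} (ha : MemLp a 2) (hb : MemLp b 2) {k : ℤ} {l C : ℝ}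
    (hl : 0 ≤ l) (hC : 0 ≤ C)
    (h : ENNReal.ofReal l * eLpNorm a 2 volume ≤ ENNReal.ofReal C * eLpNorm b 2 volume) :
    l * ‖tensorLp k ha‖ ≤ C * ‖tensorLp k hb‖ := by
  rw [norm_tensorLp, norm_tensorLp]
  have := ENNReal.toReal_mono (ENNReal.mul_lt_top ENNReal.ofReal_lt_top hb.2).ne h
  rwa [ENNReal.toReal_mul, ENNReal.toReal_mul, ENNReal.toReal_ofReal hl,
    ENNReal.toReal_ofReal hC] at this

lemma integral_sub_mul_add {A B D : Cyl → ℂ} (hA : Integrable A) (hB : Integrable B)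
    (hD : Integrable D) (c : ℂ) :
    (∫ p, A p) - c * (∫ p, B p) + ∫ p, D p = ∫ p, (A p - c * B p + D p) := by
  rw [← integral_const_mul, ← integral_sub hA (hB.const_mul c)]
  exact (integral_add (hA.sub (hB.const_mul c)) hD).symm

lemma locallyIntegrable_of_weighted (hρ : Continuous ρ) (hρ0 : ∀ s, 0 < ρ s)
    (hf : MemLp (fun p : Cyl => ρ p.1 • f p) 2) : LocallyIntegrable f := by
  have h1 : Continuous fun p : Cyl => (ρ p.1)⁻¹ :=
    (hρ.comp continuous_fst).inv₀ fun p => (hρ0 p.1).ne'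
  have := (hf.locallyIntegrable one_le_two).continuous_smul h1
  refine this.congr (Eventually.of_forall fun p => ?_)
  simp only [smul_smul, inv_mul_cancel₀ (hρ0 p.1).ne', one_smul]

/-- The operator `∂ₛ + i ∂ₜ - 2πη` is onto the weighted space if all its Fourier modes are, with
uniform bounds. -/
lemma exists_cyl_solution (hρ : Continuous ρ) (hρ0 : ∀ s, 0 < ρ s) (hη : Continuous η)
    (hC : 0 ≤ C) (hmode : ∀ k, ModeSolvable ℂ η ρ C k)
    (hf : MemLp (fun p : Cyl => ρ p.1 • f p) 2) :
    ∃ v vs vt : Cyl → ℂ, IsWeakDS v vs ∧ IsWeakDT v vt ∧ MemLp (fun p => ρ p.1 • v p) 2 ∧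
      MemLp (fun p => ρ p.1 • vt p) 2 ∧
      ∀ p, vs p + Complex.I * vt p - 2 * Real.pi * η p.1 * v p = f p := by
  set F : Cyl → ℂ := fun p => ρ p.1 • f p with hFdef
  have hFk := memLp_cylCoeff hf
  have hρc : ∀ s, (ρ s : ℂ) ≠ 0 := fun s => Complex.ofReal_ne_zero.2 (hρ0 s).ne'
  have e0 : ∀ k, (fun s => ρ s • (ρ s)⁻¹ • cylCoeff F k s) = cylCoeff F k := fun k => by
    ext s
    rw [smul_smul, mul_inv_cancel₀ (hρ0 s).ne', one_smul]
  have hsol := fun k => hmode k (fun s => (ρ s)⁻¹ • cylCoeff F k s) (by rw [e0]; exact hFk k)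
  simp only [e0] at hsol
  choose y hy1 hy2 hy3 using hsol
  set a : ℤ → ℝ → ℂ := fun k s => ρ s • y k s with ha
  -- These are the modes of the weighted `∂ₜ v`; the factor `k` is paid for by the factor `1 + |k|`
  -- in `ModeSolvable`.
  set b : ℤ → ℝ → ℂ := fun k s => (2 * Real.pi * Complex.I * k : ℂ) * a k s with hb
  have hbm : ∀ k, MemLp (b k) 2 := fun k => (hy2 k).const_mul _
  have hsumF := hasSum_cylCoeff hf
  have hnF := (hasSum_sq_norm_cylCoeff hf).summable
  have hna : ∀ k : ℤ, (1 + |(k : ℝ)|) * ‖tensorLp k (hy2 k)‖ ≤ C * ‖tensorLp k (hFk k)‖ :=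
    fun k => norm_tensorLp_le (hy2 k) (hFk k) (by positivity) hC (hy3 k)
  have hnb : ∀ k : ℤ, ‖tensorLp k (hbm k)‖ ≤ 2 * Real.pi * C * ‖tensorLp k (hFk k)‖ := fun k => by
    have h1 : ‖tensorLp k (hbm k)‖ = 2 * Real.pi * |(k : ℝ)| * ‖tensorLp k (hy2 k)‖ := by
      rw [norm_tensorLp, norm_tensorLp]
      have : b k = (2 * Real.pi * Complex.I * k : ℂ) • a k := rfl
      have e : ‖(2 * Real.pi * Complex.I * k : ℂ)‖ₑ.toReal = 2 * Real.pi * |(k : ℝ)| := by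
        simp [abs_of_pos Real.pi_pos]
      rw [this, eLpNorm_const_smul, ENNReal.toReal_mul, e]
    have h2 := hna k
    have h3 := norm_nonneg (tensorLp k (hy2 k))
    have h4 := Real.pi_pos
    rw [h1]
    nlinarith
  have hsa : Summable fun k => tensorLp k (hy2 k) := by
    refine summable_of_pairwise (pairwise_tensorLp hy2) ?_
    refine Summable.of_nonneg_of_le (fun _ => sq_nonneg _) (fun k => ?_) (hnF.mul_left (C ^ 2))
    rw [← mul_pow]
    have h1 := hna k
    have h2 := norm_nonneg (tensorLp k (hy2 k))
    have h3 := abs_nonneg (k : ℝ)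
    exact pow_le_pow_left₀ h2 (by nlinarith) 2
  have hsb : Summable fun k => tensorLp k (hbm k) := by
    refine summable_of_pairwise (pairwise_tensorLp hbm) ?_
    refine Summable.of_nonneg_of_le (fun _ => sq_nonneg _) (fun k => ?_)
      (hnF.mul_left ((2 * Real.pi * C) ^ 2))
    rw [← mul_pow]
    exact pow_le_pow_left₀ (norm_nonneg _) (hnb k) 2
  obtain ⟨V, hV⟩ := hsa
  obtain ⟨W, hW⟩ := hsb
  have cF : ∀ k, tensorLp k (hFk k) =ᵐ[volume] tensor k (cylCoeff F k) :=
    fun k => (memLp_tensor k (hFk k)).coeFn_toLp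
  have ca : ∀ k, tensorLp k (hy2 k) =ᵐ[volume] tensor k (a k) :=
    fun k => (memLp_tensor k (hy2 k)).coeFn_toLp
  have cb : ∀ k, tensorLp k (hbm k) =ᵐ[volume] tensor k (b k) :=
    fun k => (memLp_tensor k (hbm k)).coeFn_toLp
  set v : Cyl → ℂ := fun p => (ρ p.1)⁻¹ • V p with hv
  set vt : Cyl → ℂ := fun p => (ρ p.1)⁻¹ • W p with hvt
  have hρv : (fun p => ρ p.1 • v p) = V := by
    ext p; simp only [hv, smul_smul, mul_inv_cancel₀ (hρ0 p.1).ne', one_smul]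
  have hρvt : (fun p => ρ p.1 • vt p) = W := by
    ext p; simp only [hvt, smul_smul, mul_inv_cancel₀ (hρ0 p.1).ne', one_smul]
  have hvm : MemLp (fun p => ρ p.1 • v p) 2 := by rw [hρv]; exact Lp.memLp V
  have hvtm : MemLp (fun p => ρ p.1 • vt p) 2 := by rw [hρvt]; exact Lp.memLp W
  have lv := locallyIntegrable_of_weighted hρ hρ0 hvm
  have lvt := locallyIntegrable_of_weighted hρ hρ0 hvtm
  have lf := locallyIntegrable_of_weighted hρ hρ0 hf
  -- The candidate for `∂ₛ v` is read off from the equation, which then holds everywhere by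
  -- definition. What remains is to verify that it is a weak derivative.
  set vs : Cyl → ℂ := fun p => f p - Complex.I * vt p + (2 * Real.pi * η p.1) * v p with hvs
  have hηc : Continuous fun p : Cyl => (2 * Real.pi * η p.1 : ℂ) := by
    have : Continuous fun p : Cyl => (η p.1 : ℂ) :=
      Complex.continuous_ofReal.comp (hη.comp continuous_fst)
    fun_prop
  have lηv : LocallyIntegrable fun p => (2 * Real.pi * η p.1 : ℂ) * v p := lv.continuous_smul hηc
  have lvs : LocallyIntegrable vs := (lf.sub (lvt.smul Complex.I)).add lηv
  have hρic : Continuous fun p : Cyl => ((ρ p.1)⁻¹ : ℂ) :=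
    (Complex.continuous_ofReal.comp (hρ.comp continuous_fst)).inv₀ fun p => hρc p.1
  have test : ∀ ψ : Cyl → ℝ, Continuous ψ → HasCompactSupport ψ → ∀ w : Cyl → ℂ, Continuous w →
      MemLp (fun p => (ψ p : ℂ) * w p) 2 := fun ψ hψ hc w hw =>
    ((Complex.continuous_ofReal.comp hψ).mul hw).memLp_of_hasCompactSupport
      ((hc.comp_left (g := ((↑) : ℝ → ℂ)) Complex.ofReal_zero).mul_right)
  refine ⟨v, vs, vt, ⟨lv, lvs, fun φ hφ hc => ?_⟩, ⟨lv, lvt, fun φ hφ hc => ?_⟩, hvm, hvtm,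
    fun p => by simp only [hvs]; ring⟩
  · have m1 := test _ hφ.dS.continuous (isCylDerivation_dS.support φ hc) _ hρic
    have m2 := test _ hφ.continuous hc _ hρic
    have m3 := test _ hφ.continuous hc _ (hρic.mul hηc)
    have s1 := hasSum_integral_mul hV m1
    have s2 := hasSum_integral_mul hsumF m2
    have s3 := hasSum_integral_mul hW m2
    have s4 := hasSum_integral_mul hV m3
    have s5 := ((s2.sub (s3.mul_left Complex.I)).add s4).neg
    -- The weak equation of a single mode. All pairings are against compactly supported continuous
    -- functions divided by the weight, hence in `L²`, so the identity can be summed over `k`.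
    have hterm : ∀ k, (∫ p, ((dS φ p : ℝ) : ℂ) * ((ρ p.1)⁻¹ : ℂ) * tensorLp k (hy2 k) p)
        = -((∫ p, (φ p : ℂ) * ((ρ p.1)⁻¹ : ℂ) * tensorLp k (hFk k) p)
          - Complex.I * (∫ p, (φ p : ℂ) * ((ρ p.1)⁻¹ : ℂ) * tensorLp k (hbm k) p)
          + ∫ p, (φ p : ℂ) * (((ρ p.1)⁻¹ : ℂ) * (2 * Real.pi * η p.1)) * tensorLp k (hy2 k) p) := by
      intro k
      have h1 := (isWeakDS_tensor (hy1 k) k).2.2 φ hφ hc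
      have i2 := m2.integrable_mul (Lp.memLp (tensorLp k (hFk k)))
      have i3 := m2.integrable_mul (Lp.memLp (tensorLp k (hbm k)))
      have i4 := m3.integrable_mul (Lp.memLp (tensorLp k (hy2 k)))
      refine Eq.trans (Eq.trans (integral_congr_ae ?_) (h1.trans (congrArg Neg.neg
        (integral_congr_ae ?_)))) (congrArg Neg.neg (integral_sub_mul_add i2 i3 i4 Complex.I).symm)
      · filter_upwards [ca k] with p hp
        rw [hp, tensor, tensor, Complex.real_smul]
        simp only [ha, Complex.real_smul]
        have := hρc p.1
        field_simp
      · filter_upwards [ca k, cb k, cF k] with p hp hp' hp''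
        simp only [Pi.mul_apply]
        rw [hp, hp', hp'', tensor, tensor, tensor, tensor, Complex.real_smul]
        simp only [ha, hb, Complex.real_smul]
        have := hρc p.1
        push_cast
        field_simp
        linear_combination (2 * Real.pi * k * φ p * ρ p.1 * y k p.1) * Complex.I_sq
    simp_rw [hterm] at s1
    have h2 := s1.unique s5
    have i2 := m2.integrable_mul (Lp.memLp hf.toLp)
    have i3 := m2.integrable_mul (Lp.memLp W)
    have i4 := m3.integrable_mul (Lp.memLp V)
    replace h2 := h2.trans (congrArg Neg.neg (integral_sub_mul_add i2 i3 i4 Complex.I))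
    refine Eq.trans (integral_congr_ae ?_) (h2.trans (congrArg Neg.neg (integral_congr_ae ?_)))
    · refine Eventually.of_forall fun p => ?_
      simp only [hv, Complex.real_smul]
      push_cast
      ring
    · filter_upwards [hf.coeFn_toLp] with p hp
      simp only [Pi.mul_apply]
      rw [hp]
      simp only [hvs, hv, hvt, hFdef, Complex.real_smul]
      have := hρc p.1
      push_cast
      field_simp
  · have m1 := test _ hφ.dT.continuous (isCylDerivation_dT.support φ hc) _ hρic
    have m2 := test _ hφ.continuous hc _ hρic
    have s1 := hasSum_integral_mul hV m1
    have s2 := (hasSum_integral_mul hW m2).neg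
    have hterm : ∀ k, (∫ p, ((dT φ p : ℝ) : ℂ) * ((ρ p.1)⁻¹ : ℂ) * tensorLp k (hy2 k) p)
        = -(∫ p, (φ p : ℂ) * ((ρ p.1)⁻¹ : ℂ) * tensorLp k (hbm k) p) := by
      intro k
      have h1 := (isWeakDT_tensor (hy1 k).left k).2.2 φ hφ hc
      refine Eq.trans (integral_congr_ae ?_) (h1.trans (congrArg Neg.neg (integral_congr_ae ?_)))
      · filter_upwards [ca k] with p hp
        rw [hp, tensor, tensor, Complex.real_smul]
        simp only [ha, Complex.real_smul]
        have := hρc p.1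
        field_simp
      · filter_upwards [cb k] with p hp
        rw [hp, tensor, tensor, Complex.real_smul]
        simp only [ha, hb, Complex.real_smul]
        have := hρc p.1
        field_simp
    simp_rw [hterm] at s1
    refine Eq.trans (integral_congr_ae ?_)
      ((s1.unique s2).trans (congrArg Neg.neg (integral_congr_ae ?_)))
    · refine Eventually.of_forall fun p => ?_
      simp only [hv, Complex.real_smul]
      push_cast
      ring
    · refine Eventually.of_forall fun p => ?_
      simp only [hvt, Complex.real_smul]
      push_cast
      ring

end Solve

end Vortex

/-! ### Weighted Sobolev spaces -/

namespace Vortex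

open Filter Topology Set

section Weights

/-- A smooth positive weight with bounded logarithmic derivative. -/
structure IsWeight (ρ : ℝ → ℝ) : Prop where
  smooth : ContDiff ℝ ∞ ρ
  pos : ∀ s, 0 < ρ s
  deriv_le : ∃ L, ∀ s, |deriv ρ s / ρ s| ≤ L

variable {β ρ : ℝ → ℝ} {κ : ℝ}

lemma IsCutoff.isWeight (hβ : IsCutoff β) (κ : ℝ) : IsWeight (weight β κ) where
  smooth := ((contDiff_const.mul hβ.smooth).mul contDiff_id).exp
  pos s := Real.exp_pos _
  deriv_le := by
    obtain ⟨T, hT, hl, hr⟩ := hβ.eventually_const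
    have hd : ∀ s, HasDerivAt (weight β κ)
        (weight β κ s * (κ * deriv β s * s + κ * β s)) s := fun s => by
      have h1 := (hβ.smooth.differentiable (by simp) s).hasDerivAt
      have h2 := ((h1.const_mul κ).mul (hasDerivAt_id s)).exp
      simp only [id, mul_one] at h2
      exact h2
    have he : ∀ s, deriv (weight β κ) s / weight β κ s = κ * deriv β s * s + κ * β s := by
      intro s
      rw [(hd s).deriv, mul_div_cancel_left₀]
      exact (Real.exp_pos _).ne'
    have hc : Continuous fun s => κ * deriv β s * s + κ * β s := by
      have h1 := hβ.smooth.continuous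
      have h2 := hβ.smooth.continuous_deriv (by simp)
      fun_prop
    have htop : (fun s => κ * deriv β s * s + κ * β s) =ᶠ[atTop] fun _ => κ := by
      filter_upwards [eventually_gt_atTop T] with s hs
      have h1 : β =ᶠ[𝓝 s] fun _ => 1 := (eventually_gt_nhds hs).mono fun r hr' => hr r hr'
      rw [h1.deriv_eq, h1.eq_of_nhds]
      simp
    have hbot : (fun s => κ * deriv β s * s + κ * β s) =ᶠ[atBot] fun _ => -κ := by
      filter_upwards [eventually_lt_atBot (-T)] with s hs
      have h1 : β =ᶠ[𝓝 s] fun _ => -1 := (eventually_lt_nhds hs).mono fun r hr' => hl r hr'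
      rw [h1.deriv_eq, h1.eq_of_nhds]
      simp
    simp_rw [he]
    exact exists_abs_le_of_tendsto hc (tendsto_const_nhds.congr' htop.symm)
      (tendsto_const_nhds.congr' hbot.symm)

/-- Outside `[-T, T]` one has `β(s) s = |s|` and the expression vanishes; inside, it is at most
`2Tδ`. -/
lemma IsCutoff.exists_log_weight_le (hβ : IsCutoff β) {δ : ℝ} (hδ : 0 < δ) :
    ∃ B, ∀ s, |Real.log (weight β (-δ) s) + δ * (|s|)| ≤ B := by
  obtain ⟨T, hT, hl, hr⟩ := hβ.eventually_const
  refine ⟨δ * (2 * T), fun s => ?_⟩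
  have e : Real.log (weight β (-δ) s) + δ * (|s|) = δ * (|s| - β s * s) := by
    rw [weight, Real.log_exp]; ring
  rw [e, abs_mul, abs_of_pos hδ]
  refine mul_le_mul_of_nonneg_left ?_ hδ.le
  rcases lt_or_ge T s with h | h
  · rw [hr s h, abs_of_pos (hT.trans h), one_mul, sub_self, abs_zero]
    positivity
  rcases lt_or_ge s (-T) with h' | h'
  · rw [hl s h', abs_of_neg (h'.trans (neg_lt_zero.2 hT)), neg_one_mul, sub_self, abs_zero]
    positivity
  have h1 : |s| ≤ T := abs_le.2 ⟨h', h⟩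
  have h2 : |β s| ≤ 1 := abs_le.2 (hβ.mem_Icc s)
  calc |(|s| - β s * s)| ≤ |(|s|)| + |β s * s| := abs_sub _ _
    _ = |s| + |β s| * |s| := by rw [abs_abs, abs_mul]
    _ ≤ T + 1 * T := by gcongr
    _ = 2 * T := by ring

lemma IsWeight.memLp_deriv_smul {X E : Type*} [MeasurableSpace X] {μ : Measure X}
    [NormedAddCommGroup E] [NormedSpace ℝ E] (hρ : IsWeight ρ) {x : X → ℝ} (hx : Measurable x)
    {f : X → E} (hf : MemLp (fun p => ρ (x p) • f p) 2 μ) :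
    MemLp (fun p => deriv ρ (x p) • f p) 2 μ := by
  obtain ⟨L, hL⟩ := hρ.deriv_le
  have hc : Continuous fun s => deriv ρ s / ρ s :=
    (hρ.smooth.continuous_deriv (by simp)).div hρ.smooth.continuous fun s => (hρ.pos s).ne'
  have := hf.bdd_smul' (a := fun p => deriv ρ (x p) / ρ (x p))
    (hc.measurable.comp hx).aestronglyMeasurable fun p => hL _
  simpa only [smul_smul, div_mul_cancel₀ _ (hρ.pos _).ne'] using this

lemma memL2Loc_of_smul {X E : Type*} [TopologicalSpace X] [T2Space X] [MeasureSpace X]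
    [BorelSpace X] [NormedAddCommGroup E] [NormedSpace ℝ E] {r : X → ℝ} (hr : Continuous r)
    (hr0 : ∀ x, 0 < r x) {f : X → E} (hf : MemLp (fun x => r x • f x) 2) : MemL2Loc f := by
  intro K hK
  have h1 : Continuous fun x => (r x)⁻¹ := hr.inv₀ fun x => (hr0 x).ne'
  obtain ⟨C, hC⟩ := hK.exists_bound_of_continuousOn h1.continuousOn
  have h2 : MemLp (fun x => (r x)⁻¹) ∞ ((volume : Measure X).restrict K) :=
    memLp_top_of_bound h1.measurable.aestronglyMeasurable C
      (ae_restrict_of_forall_mem hK.measurableSet hC)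
  have h3 : MemLp (fun x => (r x)⁻¹ • r x • f x) 2 ((volume : Measure X).restrict K) :=
    (hf.restrict K).smul h2
  simpa only [smul_smul, inv_mul_cancel₀ (hr0 _).ne', one_smul] using h3

lemma smoothCyl_comp_fst {E : Type*} [NormedAddCommGroup E] [NormedSpace ℝ E] {a : ℝ → E}
    (ha : ContDiff ℝ ∞ a) : SmoothCyl fun p => a p.1 :=
  ha.comp contDiff_fst

lemma dT_comp_fst {E : Type*} [NormedAddCommGroup E] [NormedSpace ℝ E] (a : ℝ → E) (p : Cyl) :
    dT (fun p => a p.1) p = 0 :=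
  deriv_const (0 : ℝ) (a p.1)

lemma isWeakDS_weight_smul (hρ : IsWeight ρ) {v vs : Cyl → ℂ} (hs : IsWeakDS v vs) :
    IsWeakDS (fun p => ρ p.1 • v p) (fun p => deriv ρ p.1 • v p + ρ p.1 • vs p) :=
  IsWeak.smul isCylDerivation_dS hs (smoothCyl_comp_fst hρ.smooth)

lemma isWeakDT_weight_smul (hρ : IsWeight ρ) {v vt : Cyl → ℂ} (ht : IsWeakDT v vt) :
    IsWeakDT (fun p => ρ p.1 • v p) (fun p => ρ p.1 • vt p) := by
  have h1 := IsWeak.smul isCylDerivation_dT ht (smoothCyl_comp_fst hρ.smooth)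
  simp only [dT_comp_fst, zero_smul, zero_add] at h1
  exact h1

lemma memW12WeightedCyl_of_isWeak (hρ : IsWeight (weight β κ)) {v vs vt : Cyl → ℂ}
    (hs : IsWeakDS v vs) (ht : IsWeakDT v vt) (h : MemL2WeightedCyl β κ v)
    (h' : MemL2WeightedCyl β κ vs) (h'' : MemL2WeightedCyl β κ vt) :
    MemW12WeightedCyl β κ v := by
  have hc : Continuous fun p : Cyl => weight β κ p.1 := hρ.smooth.continuous.comp continuous_fst
  have h0 : ∀ p : Cyl, 0 < weight β κ p.1 := fun p => hρ.pos _
  exact ⟨⟨memL2Loc_of_smul hc h0 h, ⟨vs, hs, memL2Loc_of_smul hc h0 h'⟩,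
    ⟨vt, ht, memL2Loc_of_smul hc h0 h''⟩⟩, h,
    ⟨_, isWeakDS_weight_smul hρ hs, (hρ.memLp_deriv_smul measurable_fst h).add h'⟩,
    ⟨_, isWeakDT_weight_smul hρ ht, h''⟩⟩

/-- The derivative of the weighted function is `γ' v + γ ∂ₛ v`, and `γ' v` is in `L²` because `γ' /
γ` is bounded. Subtracting it shows that `∂ₛ v` itself lies in the weighted space. -/
lemma MemW12WeightedCyl.exists_isWeak (hρ : IsWeight (weight β κ)) {v : Cyl → ℂ}
    (h : MemW12WeightedCyl β κ v) :
    ∃ vs vt, IsWeakDS v vs ∧ IsWeakDT v vt ∧ MemL2WeightedCyl β κ v ∧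
      MemL2WeightedCyl β κ vs ∧ MemL2WeightedCyl β κ vt := by
  obtain ⟨⟨-, ⟨vs, hs, -⟩, ⟨vt, ht, -⟩⟩, h0, ⟨ws, hs', hm⟩, ⟨wt, ht', hm'⟩⟩ := h
  refine ⟨vs, vt, hs, ht, h0, ?_, ?_⟩
  · refine (memLp_congr_ae ?_).1 (hm.sub (hρ.memLp_deriv_smul measurable_fst h0))
    filter_upwards [IsWeak.unique hs' (isWeakDS_weight_smul hρ hs)] with p hp
    rw [Pi.sub_apply, hp, add_sub_cancel_left]
  · exact (memLp_congr_ae (IsWeak.unique ht' (isWeakDT_weight_smul hρ ht))).1 hm'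

lemma WeakDeriv.isWeakDLine {f g : ℝ → ℝ} (h : WeakDeriv f g) : IsWeakDLine f g :=
  ⟨h.left, h.right, fun φ hφ hc => h.eq φ (hφ.of_le (by simp)) hc⟩

lemma IsWeakDLine.mul {f g a : ℝ → ℝ} (h : IsWeakDLine f g) (ha : ContDiff ℝ ∞ a) :
    IsWeakDLine (fun s => a s * f s) (fun s => deriv a s * f s + a s * g s) := by
  have ha' : Continuous (deriv a) := ha.continuous_deriv (by simp)
  have l1 := h.1.continuous_smul ha.continuous
  have l2 := h.1.continuous_smul ha'
  have l3 := h.2.1.continuous_smul ha.continuous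
  refine ⟨l1, l2.add l3, fun φ hφ hc => ?_⟩
  have h1 := h.2.2 (fun s => φ s * a s) (hφ.mul ha) hc.mul_right
  have hd : ∀ s, deriv (fun s => φ s * a s) s = deriv φ s * a s + φ s * deriv a s := fun s =>
    deriv_fun_mul (hφ.differentiable (by simp) s) (ha.differentiable (by simp) s)
  have i1 : Integrable fun s => deriv φ s * (a s * f s) :=
    integrable_smul_of_hasCompactSupport (hφ.continuous_deriv (by simp)) hc.deriv l1
  have i2 : Integrable fun s => φ s * (deriv a s * f s) :=
    integrable_smul_of_hasCompactSupport hφ.continuous hc l2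
  have i3 : Integrable fun s => φ s * (a s * g s) :=
    integrable_smul_of_hasCompactSupport hφ.continuous hc l3
  simp_rw [hd, add_mul, mul_assoc] at h1
  rw [integral_add i1 i2] at h1
  simp_rw [mul_add]
  rw [integral_add i2 i3, neg_add, ← h1]
  ring

lemma memW12WeightedLine_of_isWeak (hρ : IsWeight (weight β κ)) {f g : ℝ → ℝ}
    (hs : IsWeakDLine f g) (h : MemL2WeightedLine β κ f) (h' : MemL2WeightedLine β κ g) :
    MemW12WeightedLine β κ f :=
  ⟨⟨memL2Loc_of_smul hρ.smooth.continuous hρ.pos h,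
    ⟨g, hs, memL2Loc_of_smul hρ.smooth.continuous hρ.pos h'⟩⟩, h,
    ⟨_, hs.mul hρ.smooth, (hρ.memLp_deriv_smul measurable_id h).add h'⟩⟩

lemma MemW12WeightedLine.exists_isWeak (hρ : IsWeight (weight β κ)) {f : ℝ → ℝ}
    (h : MemW12WeightedLine β κ f) :
    ∃ g, IsWeakDLine f g ∧ MemL2WeightedLine β κ f ∧ MemL2WeightedLine β κ g := by
  obtain ⟨⟨-, ⟨g, hg, -⟩⟩, h0, ⟨w, hw, hm⟩⟩ := h
  refine ⟨g, hg, h0, ?_⟩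
  refine (memLp_congr_ae ?_).1 (hm.sub (hρ.memLp_deriv_smul measurable_id h0))
  filter_upwards [(weakDLine_ae_eq hw).symm.trans (weakDLine_ae_eq (hg.mul hρ.smooth))] with s hs
  rw [Pi.sub_apply, hs]
  exact add_sub_cancel_left _ _

end Weights

/-! ### Pairing with a bounded function, and the spectral gap -/

section InnerProduct

variable {ρ : ℝ → ℝ} {u v : Cyl → ℂ}

lemma memLp_inner_of_bound {C : ℝ} (hu : Continuous u) (hC : ∀ p, ‖u p‖ ≤ C) (hv : MemLp v 2) :
    MemLp (fun p => ((inner ℝ (u p) (v p) : ℝ) : ℂ)) 2 := by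
  refine (hv.const_mul (C : ℂ)).mono
    (Complex.continuous_ofReal.comp_aestronglyMeasurable (hu.aestronglyMeasurable.inner hv.1))
    (Eventually.of_forall fun p => ?_)
  rw [Complex.norm_real, norm_mul, Complex.norm_real]
  refine (norm_inner_le_norm _ _).trans (mul_le_mul_of_nonneg_right ?_ (norm_nonneg _))
  exact (hC p).trans (le_abs_self C)

/-- Pairing with a bounded function maps the weighted space on the cylinder to the one on the
line. -/
lemma memLp_integral_inner (hρ0 : ∀ s, 0 < ρ s) {C : ℝ} (hu : Continuous u)
    (hC : ∀ p, ‖u p‖ ≤ C) (hv : MemLp (fun p => ρ p.1 • v p) 2) :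
    MemLp (fun s => ρ s * ∫ t : Circ, (inner ℝ (u (s, t)) (v (s, t)) : ℝ)) 2 ∧
      ∀ᵐ s, Integrable fun t : Circ => (inner ℝ (u (s, t)) (v (s, t)) : ℝ) := by
  have h1 := memLp_inner_of_bound hu hC hv
  have h3 : ∀ p, (inner ℝ (u p) (ρ p.1 • v p) : ℝ) = ρ p.1 * inner ℝ (u p) (v p) := fun p =>
    real_inner_smul_right _ _ _
  constructor
  -- The integral over the circle is the zeroth Fourier coefficient, so the bound for coefficients
  -- applies.
  · refine (memLp_congr_ae (Eventually.of_forall fun s => ?_)).1 (memLp_cylCoeff h1 0).re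
    simp only [cylCoeff, fourierCoeff_eq, neg_zero, fourier_zero, one_mul, h3]
    rw [integral_complex_ofReal]
    exact integral_const_mul _ _
  · filter_upwards [ae_memLp_slice h1] with s hs
    have h2 := ((hs.integrable one_le_two).re).const_mul (ρ s)⁻¹
    refine h2.congr (Eventually.of_forall fun t => ?_)
    simp only [h3]
    exact inv_mul_cancel_left₀ (hρ0 s).ne' _

end InnerProduct

section Gap

/-- At the critical point `(1, 0)` the pair `(exp(2πit), 0)` is an eigenvector with eigenvalue
`-2π`. Only this upper bound on the gap is needed. -/
lemma spectralGap_le : spectralGap ≤ 2 * Real.pi := by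
  refine csInf_le ⟨0, ?_⟩ ⟨fun _ => 1, 0, -(2 * Real.pi), ?_, ?_, ?_, ?_⟩
  · rintro a ⟨v, η, c, -, -, -, rfl⟩
    exact abs_nonneg c
  · refine ⟨contDiff_const, fun t => ?_, ?_⟩
    · simp [gradLoop, derivCirc]
    · simp [gradReal]
  · have hd : ∀ t : Circ, derivCirc (fun t => (fourier 1 : C(Circ, ℂ)) t) t
        = 2 * Real.pi * Complex.I * (fourier 1 : C(Circ, ℂ)) t := fun t => by
      have := dT_fourier 1 ((0, t) : Cyl)
      rw [Int.cast_one, mul_one] at this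
      exact this
    refine ⟨fun t => (fourier 1 : C(Circ, ℂ)) t, 0, ?_, ?_, fun t => ?_, ?_⟩
    · have h1 : ContDiff ℝ ∞ fun p : ℝ × ℝ => (fourier 1 : C(Circ, ℂ)) (p.2 : Circ) :=
        smoothCyl_fourier 1
      exact h1.comp (contDiff_prodMk_right (0 : ℝ))
    · rintro ⟨h, -⟩
      have := congrFun h 0
      simp at this
    · rw [hessLoop, hd]
      push_cast
      linear_combination (2 * Real.pi * (fourier 1 : C(Circ, ℂ)) t) * Complex.I_sq
    · rw [hessReal, mul_zero]
      have h0 : ∫ t : Circ, (fourier 1 : C(Circ, ℂ)) t = 0 := by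
        have h1 := (smoothCyl_fourier 1).integral_dT 0
        simp_rw [dT_fourier, integral_const_mul] at h1
        refine (mul_eq_zero.1 h1).resolve_left ?_
        simp [Real.pi_ne_zero]
      have h1 : ∀ t : Circ, (inner ℝ (1 : ℂ) ((fourier 1 : C(Circ, ℂ)) t) : ℝ)
          = ((fourier 1 : C(Circ, ℂ)) t).re := fun t => by simp [Complex.inner]
      have h2 : Integrable fun t : Circ => (fourier 1 : C(Circ, ℂ)) t :=
        ((smoothCyl_fourier 1).memLp_slice 0).integrable one_le_two
      simp_rw [h1]
      have h3 := integral_re h2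
      rw [h0] at h3
      simp only [RCLike.re_to_complex, Complex.zero_re] at h3
      rw [h3, mul_zero]
  · exact neg_ne_zero.2 (by positivity)
  · rw [abs_neg, abs_of_pos (by positivity)]

end Gap

end Vortex

/-! ### The linearized operator -/

namespace Vortex

open Filter Topology Set

section LinearizedOperator

variable {β : ℝ → ℝ} {κ : ℝ} {u : Cyl → ℂ} {η : ℝ → ℝ}

lemma memLp_bounded_mul {a f : Cyl → ℂ} {C : ℝ} (ha : Continuous a) (hC : ∀ p, ‖a p‖ ≤ C)
    (hf : MemLp f 2) : MemLp (fun p => a p * f p) 2 :=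
  hf.smul (memLp_top_of_bound ha.aestronglyMeasurable C (Eventually.of_forall hC))

lemma MemL2WeightedCyl.bounded_mul {a f : Cyl → ℂ} {C : ℝ} (ha : Continuous a)
    (hC : ∀ p, ‖a p‖ ≤ C) (hf : MemL2WeightedCyl β κ f) :
    MemL2WeightedCyl β κ fun p => a p * f p :=
  (memLp_congr_ae (Eventually.of_forall fun _ => mul_smul_comm _ _ _)).1
    (memLp_bounded_mul ha hC hf)

lemma MemL2WeightedCyl.const_mul {f : Cyl → ℂ} (hf : MemL2WeightedCyl β κ f) (c : ℂ) :
    MemL2WeightedCyl β κ fun p => c * f p :=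
  hf.bounded_mul continuous_const fun _ => le_rfl

lemma MemL2WeightedCyl.add {f g : Cyl → ℂ} (hf : MemL2WeightedCyl β κ f)
    (hg : MemL2WeightedCyl β κ g) : MemL2WeightedCyl β κ fun p => f p + g p :=
  (memLp_congr_ae (Eventually.of_forall fun _ => (smul_add _ _ _).symm)).1 (MemLp.add hf hg)

lemma MemL2WeightedCyl.sub {f g : Cyl → ℂ} (hf : MemL2WeightedCyl β κ f)
    (hg : MemL2WeightedCyl β κ g) : MemL2WeightedCyl β κ fun p => f p - g p :=
  (memLp_congr_ae (Eventually.of_forall fun _ => (smul_sub _ _ _).symm)).1 (MemLp.sub hf hg)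

lemma MemL2WeightedCyl.congr_ae {f g : Cyl → ℂ} (hf : MemL2WeightedCyl β κ f)
    (h : f =ᵐ[volume] g) : MemL2WeightedCyl β κ g :=
  (memLp_congr_ae (h.mono fun p hp => by simp only [hp])).1 hf

lemma MemL2WeightedLine.comp_fst {f : ℝ → ℝ} (hf : MemL2WeightedLine β κ f) :
    MemL2WeightedCyl β κ fun p => (f p.1 : ℂ) := by
  have h1 : MemLp (fun s => ((weight β κ s * f s : ℝ) : ℂ)) 2 := hf.ofReal
  refine (memLp_congr_ae (Eventually.of_forall fun p => ?_)).1
    (h1.comp_measurePreserving measurePreserving_cyl_fst)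
  simp only [Function.comp, Complex.real_smul, Complex.ofReal_mul]

lemma MemL2WeightedCyl.two_pi_mul {f : Cyl → ℂ} {C : ℝ} (hf : MemL2WeightedCyl β κ f)
    (hη : Continuous η) (hC : ∀ s, |η s| ≤ C) :
    MemL2WeightedCyl β κ fun p => 2 * (Real.pi : ℂ) * (η p.1 : ℂ) * f p := by
  refine hf.bounded_mul (C := 2 * Real.pi * C) ?_ fun p => ?_
  · have : Continuous fun p : Cyl => (η p.1 : ℂ) :=
      Complex.continuous_ofReal.comp (hη.comp continuous_fst)
    fun_prop
  · simp only [norm_mul, Complex.norm_real, Real.norm_eq_abs, Complex.norm_ofNat,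
      abs_of_pos Real.pi_pos]
    exact mul_le_mul_of_nonneg_left (hC p.1) (by positivity)

lemma memL2Weighted_linearization {Cη Cu : ℝ} (hη : Continuous η) (hCη : ∀ s, |η s| ≤ Cη)
    (hu : Continuous u) (hCu : ∀ p, ‖u p‖ ≤ Cu) {uh : Cyl → ℂ} {ηh : ℝ → ℝ}
    (hρ : IsWeight (weight β κ))
    (huh : MemW12WeightedCyl β κ uh) (hηh : MemW12WeightedLine β κ ηh) :
    MemL2WeightedCyl β κ (linCyl u η uh ηh) ∧ MemL2WeightedLine β κ (linLine u uh ηh) := by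
  obtain ⟨vs, vt, hs, ht, h0, h1, h2⟩ := huh.exists_isWeak hρ
  obtain ⟨g, hg, h3, h4⟩ := hηh.exists_isWeak hρ
  constructor
  · refine MemL2WeightedCyl.congr_ae (((h1.add (h2.const_mul Complex.I)).sub
      (h0.two_pi_mul hη hCη)).sub
        ((h3.comp_fst.bounded_mul hu hCu).const_mul (2 * (Real.pi : ℂ)))) ?_
    filter_upwards [weakDS_ae_eq hs, weakDT_ae_eq ht] with p hp hp'
    rw [linCyl, hp, hp', mul_assoc (2 * (Real.pi : ℂ)) (u p)]
  · have h5 := (memLp_integral_inner hρ.pos hu hCu h0).1.const_mul (2 * Real.pi)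
    refine (memLp_congr_ae ?_).1 (MemLp.sub h4 h5)
    filter_upwards [weakDLine_ae_eq hg] with s hs
    rw [linLine, hs, Pi.sub_apply]
    ring

lemma WeakDeriv.ofReal {f g : ℝ → ℝ} (h : WeakDeriv f g) :
    WeakDeriv (fun s => (f s : ℂ)) (fun s => (g s : ℂ)) where
  left := fun x => (h.left x).imp fun _ hs => ⟨hs.1, hs.2.ofReal⟩
  right := fun x => (h.right x).imp fun _ hs => ⟨hs.1, hs.2.ofReal⟩
  eq φ hφ hc := by
    simp only [Complex.real_smul, ← Complex.ofReal_mul]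
    rw [integral_complex_ofReal, integral_complex_ofReal, ← Complex.ofReal_neg]
    exact congrArg _ (h.eq φ hφ hc)

lemma tensor_zero (y : ℝ → ℂ) : tensor 0 y = fun p => y p.1 := by
  ext p
  rw [tensor, fourier_zero, mul_one]

lemma WeakDeriv.isWeakDS_comp_fst {f g : ℝ → ℂ} (h : WeakDeriv f g) :
    IsWeakDS (fun p => f p.1) (fun p => g p.1) := by
  simpa only [tensor_zero] using isWeakDS_tensor h 0

lemma isWeakDT_comp_fst {f : ℝ → ℂ} (h : LocallyIntegrable f) :
    IsWeakDT (fun p => f p.1) (fun _ => 0) := by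
  simpa [tensor_zero] using isWeakDT_tensor h 0

lemma integral_inner_add_mul {v : Cyl → ℂ} (hu : Continuous u) {s : ℝ}
    (hv : Integrable fun t : Circ => (inner ℝ (u (s, t)) (v (s, t)) : ℝ)) (x : ℝ) :
    ∫ t : Circ, (inner ℝ (u (s, t)) (v (s, t) + u (s, t) * (x : ℂ)) : ℝ)
      = (∫ t : Circ, (inner ℝ (u (s, t)) (v (s, t)) : ℝ)) + mass u s * x := by
  have hc : Continuous fun t : Circ => ‖u (s, t)‖ ^ 2 * x := by fun_prop
  have h1 : Integrable fun t : Circ => ‖u (s, t)‖ ^ 2 * x :=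
    hc.integrable_of_hasCompactSupport (HasCompactSupport.of_compactSpace _)
  rw [mass, ← integral_mul_const, ← integral_add hv h1]
  congr 1
  ext t
  rw [inner_add_right, mul_comm (u (s, t)), ← Complex.real_smul, real_inner_smul_right,
    real_inner_self_eq_norm_sq, mul_comm x]

lemma IsVortex.exists_mass_bounds (h : IsVortex u η) {δ : ℝ} (hδ : δ < 2 * Real.pi) (hδ₀ : 0 < δ) :
    ∃ a b c d : ℝ, 0 < a ∧ a ≤ b ∧ δ < c ∧ 0 < d ∧
      (∀ s, a ^ 2 ≤ 4 * Real.pi ^ 2 * mass u s) ∧ (∀ s, 4 * Real.pi ^ 2 * mass u s ≤ b ^ 2) ∧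
      (∀ᶠ s in atTop, c ^ 2 + d ≤ 4 * Real.pi ^ 2 * mass u s) ∧
      ∀ᶠ s in atBot, c ^ 2 + d ≤ 4 * Real.pi ^ 2 * mass u s := by
  obtain ⟨-, -, -, -, -, htop, hbot, hc, h0, -⟩ := h.exists_bounds
  set q : ℝ → ℝ := fun s => 4 * Real.pi ^ 2 * mass u s with hq
  have hqt : Tendsto q atTop (𝓝 (4 * Real.pi ^ 2)) := by
    simpa using htop.const_mul (4 * Real.pi ^ 2)
  have hqb : Tendsto q atBot (𝓝 (4 * Real.pi ^ 2)) := by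
    simpa using hbot.const_mul (4 * Real.pi ^ 2)
  have hqc : Continuous q := continuous_const.mul hc
  have hπ := Real.pi_pos
  have hq0 : ∀ s, 0 < q s := fun s => by have := h0 s; positivity
  have hne : (4 * Real.pi ^ 2) ≠ 0 := by positivity
  obtain ⟨A, hA⟩ := exists_abs_le_of_tendsto hqc hqt hqb
  obtain ⟨A', hA'⟩ := exists_abs_le_of_tendsto (hqc.inv₀ fun s => (hq0 s).ne') (hqt.inv₀ hne)
    (hqb.inv₀ hne)
  have hA0 : 0 < A := (abs_pos.2 (hq0 0).ne').trans_le (hA 0)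
  have hA0' : 0 < A' := (abs_pos.2 (inv_pos.2 (hq0 0)).ne').trans_le (hA' 0)
  have hl : ∀ s, A'⁻¹ ≤ q s := fun s => inv_le_of_inv_le₀ (hq0 s) ((le_abs_self _).trans (hA' s))
  have hr : ∀ s, q s ≤ A := fun s => (le_abs_self _).trans (hA s)
  have hcd : ((δ + 2 * Real.pi) / 2) ^ 2 < 4 * Real.pi ^ 2 := by nlinarith
  -- The rate `c` is the midpoint of `δ` and `2π`, and `d` is half of the remaining room between
  -- `c²` and the limit `4π²` of the potential.
  refine ⟨√A'⁻¹, √A, (δ + 2 * Real.pi) / 2, (4 * Real.pi ^ 2 - ((δ + 2 * Real.pi) / 2) ^ 2) / 2,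
    Real.sqrt_pos.2 (inv_pos.2 hA0'), Real.sqrt_le_sqrt ((hl 0).trans (hr 0)), by linarith,
    by linarith, fun s => ?_, fun s => ?_, ?_, ?_⟩
  · rw [Real.sq_sqrt (inv_pos.2 hA0').le]; exact hl s
  · rw [Real.sq_sqrt hA0.le]; exact hr s
  · exact (hqt.eventually (lt_mem_nhds (by linarith))).mono fun s hs => hs.le
  · exact (hqb.eventually (lt_mem_nhds (by linarith))).mono fun s hs => hs.le

end LinearizedOperator

end Vortex

/-! ### Surjectivity of the linearized operator -/

theorem mainTheorem7 (β : ℝ → ℝ) (hβ : Vortex.IsCutoff β)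
    (δ : ℝ) (hδ₀ : 0 < δ) (hδ : δ < Vortex.spectralGap)
    (u : Vortex.Cyl → ℂ) (η : ℝ → ℝ) (h : Vortex.IsVortex u η) :
    (∀ (uh : Vortex.Cyl → ℂ) (ηh : ℝ → ℝ),
      Vortex.MemW12WeightedCyl β (-δ) uh → Vortex.MemW12WeightedLine β (-δ) ηh →
        Vortex.MemL2WeightedCyl β (-δ) (Vortex.linCyl u η uh ηh) ∧
        Vortex.MemL2WeightedLine β (-δ) (Vortex.linLine u uh ηh)) ∧
    (∀ (f : Vortex.Cyl → ℂ) (g : ℝ → ℝ),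
      Vortex.MemL2WeightedCyl β (-δ) f → Vortex.MemL2WeightedLine β (-δ) g →
        ∃ (uh : Vortex.Cyl → ℂ) (ηh : ℝ → ℝ),
          Vortex.MemW12WeightedCyl β (-δ) uh ∧ Vortex.MemW12WeightedLine β (-δ) ηh ∧
          (∀ᵐ p : Vortex.Cyl, Vortex.linCyl u η uh ηh p = f p) ∧
          (∀ᵐ s : ℝ, Vortex.linLine u uh ηh s = g s)) := by
  open Vortex in
  have hρ : IsWeight (weight β (-δ)) := hβ.isWeight (-δ)
  have hρc := hρ.smooth.continuous
  have hδ' : δ < 2 * Real.pi := hδ.trans_le spectralGap_le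
  have hη := h.smooth_η.continuous
  have hu := h.smooth_u.continuous
  obtain ⟨m, n, hmn, hn, hm, -, -, hmass, -, C, hCη, hCu, hCs, hCt, hCm⟩ := h.exists_bounds
  refine ⟨fun uh ηh huh hηh => memL2Weighted_linearization hη hCη hu hCu hρ huh hηh,
    fun f g hf hg => ?_⟩
  obtain ⟨B, hB⟩ := hβ.exists_log_weight_le hδ₀
  obtain ⟨K, hK, hmode⟩ := exists_modeSolvable (E := ℂ) hη hρc hρ.pos hδ₀ hδ' hB hmn hn hm
  obtain ⟨v, vs, vt, hvs, hvt, mv, mvt, hveq⟩ := exists_cyl_solution hρc hρ.pos hη hK hmode hf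
  obtain ⟨mi, hi⟩ := memLp_integral_inner hρ.pos hu hCu mv
  obtain ⟨a, b, c, d, ha, hab, hc, hd, hqa, hqb, htop, hbot⟩ := h.exists_mass_bounds hδ' hδ₀
  -- The inhomogeneity of the second-order equation obtained by inserting `û = v + u H` and `η̂ = H'
  -- / (2π)` into the second component.
  have mR : MemLp (fun s => weight β (-δ) s • (2 * Real.pi * g s
      + 4 * Real.pi ^ 2 * ∫ t : Circ, (inner ℝ (u (s, t)) (v (s, t)) : ℝ))) 2 := by
    refine (memLp_congr_ae (Filter.Eventually.of_forall fun s => ?_)).1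
      ((MemLp.const_mul hg (2 * Real.pi)).add (mi.const_mul (4 * Real.pi ^ 2)))
    simp only [Pi.add_apply, smul_eq_mul]
    ring
  obtain ⟨H, H₁, hH, hH₁, mH, mH₁⟩ := exists_second_order_solution
    (q := fun s => 4 * Real.pi ^ 2 * mass u s) ha hab (continuous_const.mul hmass) hqa hqb hδ₀ hc hd htop hbot hρc hρ.pos hB mR
  have hHc := hH.ofReal
  have ws := IsWeak.add isCylDerivation_dS hvs (hHc.isWeakDS_comp_fst.mul_smooth h.smooth_u)
  have wt := IsWeak.add isCylDerivation_dT hvt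
    ((isWeakDT_comp_fst hHc.left).mul_smooth h.smooth_u)
  -- The choice `η̂ = H' / (2π)` makes `2π u η̂` cancel the term `u H'` produced by `∂ₛ (u H)`.
  have hη₁ := hH₁.isWeakDLine.mul (a := fun _ => (2 * Real.pi)⁻¹) contDiff_const
  simp only [deriv_const, zero_mul, zero_add] at hη₁
  have mv' : MemL2WeightedCyl β (-δ) v := mv
  have mvt' : MemL2WeightedCyl β (-δ) vt := mvt
  have mHc : MemL2WeightedCyl β (-δ) fun p => (H p.1 : ℂ) := MemL2WeightedLine.comp_fst mH
  have mH₁c : MemL2WeightedCyl β (-δ) fun p => (H₁ p.1 : ℂ) := MemL2WeightedLine.comp_fst mH₁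
  have huh : MemW12WeightedCyl β (-δ) fun p => v p + u p * (H p.1 : ℂ) := by
    have mvs : MemL2WeightedCyl β (-δ) vs := by
      refine (((MemL2WeightedCyl.add hf (mv'.two_pi_mul hη hCη))).sub
        (mvt'.const_mul Complex.I)).congr_ae (Filter.Eventually.of_forall fun p => ?_)
      simp only [← hveq p]
      ring
    refine memW12WeightedCyl_of_isWeak hρ ws wt (mv'.add (mHc.bounded_mul hu hCu))
      (mvs.add ((mHc.bounded_mul h.smooth_u.dS.continuous hCs).add (mH₁c.bounded_mul hu hCu)))
      (mvt'.add ((mHc.bounded_mul h.smooth_u.dT.continuous hCt).congr_ae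
        (Filter.Eventually.of_forall fun p => ?_)))
    simp
  have hηh : MemW12WeightedLine β (-δ) fun s => (2 * Real.pi)⁻¹ * H₁ s := by
    have mqH := MemLp.bdd_smul' mH (a := fun s => 4 * Real.pi ^ 2 * mass u s)
      (continuous_const.mul hmass).aestronglyMeasurable (C := 4 * Real.pi ^ 2 * C) fun s => by
        rw [abs_mul, abs_of_pos (by positivity)]
        exact mul_le_mul_of_nonneg_left (hCm s) (by positivity)
    refine memW12WeightedLine_of_isWeak hρ hη₁
      ((memLp_congr_ae (Filter.Eventually.of_forall fun s => ?_)).1 (mH₁.const_mul (2 * Real.pi)⁻¹))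
      ((memLp_congr_ae (Filter.Eventually.of_forall fun s => ?_)).1
        ((mqH.add mR).const_mul (2 * Real.pi)⁻¹))
    · simp only [smul_eq_mul]; ring
    · simp only [smul_eq_mul, Pi.add_apply]; ring
  refine ⟨_, _, huh, hηh, ?_, ?_⟩
  · filter_upwards [weakDS_ae_eq ws, weakDT_ae_eq wt] with p hp hp'
    have e := h.eq_u p
    have hπ : (Real.pi : ℂ) ≠ 0 := Complex.ofReal_ne_zero.2 Real.pi_ne_zero
    rw [linCyl, hp, hp', ← hveq p]
    push_cast
    have e' : 2 * (Real.pi : ℂ) * u p * ((2 * (Real.pi : ℂ))⁻¹ * (H₁ p.1 : ℂ))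
        = u p * (H₁ p.1 : ℂ) := by field_simp
    rw [e']
    -- What is left is `H` times the first vortex equation.
    linear_combination (H p.1 : ℂ) * e
  · filter_upwards [weakDLine_ae_eq hη₁, hi] with s hs hs'
    have hπ := Real.pi_ne_zero
    have e := integral_inner_add_mul hu hs' (H s)
    rw [linLine, hs, e]
    field_simp
    ring
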